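/- **Model.** Let $0<\pi<1$, let $g_\mu,g_\sigma$ be probability measures on $\mathbb R$ with $g_\mu(\{0\})=0$, and let the triples $(\mu_i,\sigma_i^2,X_i)$, $i\ge 1$, be independent and identically distributed, where $\mu_i\sim(1-\pi)\delta_0+\pi g_\mu$ and $\sigma_i^2\sim g_\sigma$ are independent and $X_i\mid\mu_i,\sigma_i^2\sim N(\mu_i,\sigma_i^2)$. Put $\theta_i=\mathbb I(\mu_i\ne 0)$ and fix a level $0<\alpha<1-\pi$. For a decision rule $\delta=(\delta_1,\dots,\delta_m)\in\{0,1\}^m$ let $$\mathrm{FDR}=\mathbb E\Big[\frac{\sum_i(1-\theta_i)\delta_i}{\max(\sum_i\delta_i,1)}\Big],\quad \mathrm{mFDR}=\frac{\mathbb E\sum_i(1-\theta_i)\delta_i}{\mathbb E\sum_i\delta_i},\quad \mathrm{ETP}=\mathbb E\sum_i\theta_i\delta_i .$$ **Oracle.** With $\phi_h(z)=\frac{1}{\sqrt{2\pi}\,h}e^{-z^2/(2h^2)}$ (here $\pi=3.14\ldots$), let $f_{0,\sigma}(x)=\phi_\sigma(x)$, $f_{1,\sigma}(x)=\int\phi_\sigma(x-u)\,g_\mu(du)$,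 $f_\sigma=(1-\pi)f_{0,\sigma}+\pi f_{1,\sigma}$ and $T_i=(1-\pi)f_{0,\sigma_i}(X_i)/f_{\sigma_i}(X_i)$, which is $\mathbb P(\theta_i=0\mid X_i,\sigma_i)$. Let $Q(t)$ be the mFDR of the rule $(\mathbb I\{T_i<t\})_{i\le m}$, $t^*=\sup\{t:Q(t)\le\alpha\}$ and $\delta^{\rm full}=(\mathbb I\{T_i<t^*\})_{i\le m}$. **Data-driven procedure.** Given bandwidths $h_x,h_\sigma>0$ (depending on $m$) and a random variable $\hat\pi=\hat\pi_m$, for weights $w\in\mathbb R^m$ let $$\hat f_{1,\sigma}[w](x)=\sum_{j=1}^m\frac{w_j\phi_{h_\sigma}(\sigma-\sigma_j)}{\sum_{k=1}^m w_k\phi_{h_\sigma}(\sigma-\sigma_k)}\,\phi_{h_x\sigma_j}(x-X_j),\qquad \hat f^*_\sigma=\hat f_{1,\sigma}[(1,\dots,1)].$$ Put $\hat T^{(0)}_i=\min\{(1-\hat\pi)f_{0,\sigma_i}(X_i)/\hat f^*_{\sigma_i}(X_i),\,1\}$, then, for $r=1,2$, $$\hat T^{(r)}_i=\frac{(1-\hat\pi)f_{0,\sigma_i}(X_i)}{(1-\hat\pi)f_{0,\sigma_i}(X_i)+\hat\pi\,\hat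 f_{1,\sigma_i}[1-\hat T^{(r-1)}](X_i)},$$ and $\hat T_i=\hat T^{(2)}_i$. Let $\hat T_{(1)}\le\dots\le\hat T_{(m)}$ be the ordered values, $k=\max\{j:\frac1j\sum_{i=1}^j\hat T_{(i)}\le\alpha\}$, $\hat t^*=\hat T_{(k)}$ ($\hat t^*=0$ if there is no such $j$), and $\delta^{\rm dd}=(\mathbb I\{\hat T_i\le\hat t^*\})_{i\le m}$. **Theorem.** Assume: (a) $\operatorname{supp}(g_\sigma)\subseteq(M_1,M_2)$ and $\operatorname{supp}(g_\mu)\subseteq(-M,M)$ for some $M_1>0$, $M_2<\infty$, $M<\infty$; (b) as $m\to\infty$, $h_\sigma\to0$, $h_x=o\{(\log m)^{-1}\}$, $m h_x h_\sigma^2\to\infty$ and, for some $\delta>0$, $m^{1-\delta}h_\sigma h_x^2\to\infty$ and $m^{-\delta/2}h_\sigma^2h_x^{-1}\to0$; (c) $\hat\pi\to\pi$ in probability. Then, as $m\to\infty$, $\hat t^*-t^*\to0$ in probability; $\mathrm{mFDR}(\delta^{\rm dd})\le\alpha+o(1)$ and $\mathrm{FDR}(\delta^{\rm dd})\le\alpha+o(1)$;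 and $\mathrm{ETP}(\delta^{\rm dd})/\mathrm{ETP}(\delta^{\rm full})=1+o(1)$. -/

import Mathlib

open MeasureTheory ProbabilityTheory Filter Topology Asymptotics

noncomputable section

namespace HART

/-! ### The hierarchical model -/

/-- The prior `(1 - p) δ₀ + p g` of the effects. -/
def effectPrior (p : ℝ) (gμ : Measure ℝ) : Measure ℝ :=
  ENNReal.ofReal (1 - p) • Measure.dirac 0 + ENNReal.ofReal p • gμ

/-- The kernel `(u, v) ↦ N(u, v)`, where `v` is the variance. -/
def normalKernel : Kernel (ℝ × ℝ) ℝ where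
  toFun q := gaussianReal q.1 q.2.toNNReal
  measurable' := measurable_gaussianReal.comp
    (measurable_fst.prodMk (measurable_real_toNNReal.comp measurable_snd))

/-- The joint law of `((μᵢ, σᵢ²), Xᵢ)`: the effect and the variance are independent with laws
`effectPrior p gμ` and `gσ`, and, given them, `Xᵢ` is `N(μᵢ, σᵢ²)`. -/
def unitLaw (p : ℝ) (gμ gσ : Measure ℝ) : Measure ((ℝ × ℝ) × ℝ) :=
  ((effectPrior p gμ).prod gσ).compProd normalKernel

/-- `μ i`, `V i` and `X i` are the effect, the variance `σᵢ²` and the summary statistic of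
the `i`-th unit; the units are independent and identically distributed. -/
structure IsModel {Ω : Type*} [MeasurableSpace Ω] (P : Measure Ω) (p : ℝ) (gμ gσ : Measure ℝ)
    (μ V X : ℕ → Ω → ℝ) : Prop where
  measurable_effect : ∀ i, Measurable (μ i)
  measurable_var : ∀ i, Measurable (V i)
  measurable_obs : ∀ i, Measurable (X i)
  indep : iIndepFun (fun i ω => ((μ i ω, V i ω), X i ω)) P
  law : ∀ i, P.map (fun ω => ((μ i ω, V i ω), X i ω)) = unitLaw p gμ gσ

/-! ### Densities and the oracle statistic -/

/-- The density of `N(0, h²)`, also used as the Gaussian kernel with bandwidth `h`. -/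
def phi (h z : ℝ) : ℝ := 1 / (√(2 * Real.pi) * h) * Real.exp (-z ^ 2 / (2 * h ^ 2))

/-- The null density. -/
def f0 (σ x : ℝ) : ℝ := phi σ x

/-- The alternative density. -/
def f1 (gμ : Measure ℝ) (σ x : ℝ) : ℝ := ∫ u, phi σ (x - u) ∂gμ

/-- The marginal density of an observation with standard deviation `σ`. -/
def fMix (p : ℝ) (gμ : Measure ℝ) (σ x : ℝ) : ℝ := (1 - p) * f0 σ x + p * f1 gμ σ x

/-- The posterior probability of the null given `(x, σ)`. -/
def oracleT (p : ℝ) (gμ : Measure ℝ) (x σ : ℝ) : ℝ := (1 - p) * f0 σ x / fMix p gμ σ x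

/-! ### Error rates and power of a decision rule -/

section Criteria

variable {Ω : Type*} [MeasurableSpace Ω] {m : ℕ}

/-- False discovery rate; `θ i ω` and `δ i ω` take the values `0` and `1`. -/
def FDR (P : Measure Ω) (θ δ : Fin m → Ω → ℝ) : ℝ :=
  ∫ ω, (∑ i, (1 - θ i ω) * δ i ω) / max (∑ i, δ i ω) 1 ∂P

/-- Marginal false discovery rate. -/
def mFDR (P : Measure Ω) (θ δ : Fin m → Ω → ℝ) : ℝ :=
  (∫ ω, ∑ i, (1 - θ i ω) * δ i ω ∂P) / ∫ ω, ∑ i, δ i ω ∂P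

/-- Expected number of true positives. -/
def ETP (P : Measure Ω) (θ δ : Fin m → Ω → ℝ) : ℝ := ∫ ω, ∑ i, θ i ω * δ i ω ∂P

end Criteria

/-! ### The data-driven statistics, as functions of the data `(x, s)`, where `s` holds the
standard deviations, of the bandwidths `hx`, `hs` and of the estimate `q` of the non-null
proportion -/

section Estimators

variable {m : ℕ}

/-- The weighted bivariate kernel estimate of the marginal density at `(y, σ)`. -/
def fStarHat (hx hs : ℝ) (x s : Fin m → ℝ) (σ y : ℝ) : ℝ :=
  ∑ j, phi hs (σ - s j) / (∑ k, phi hs (σ - s k)) * phi (hx * s j) (y - x j)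

/-- The estimate of the alternative density at `(y, σ)` with weights `w`. -/
def f1Hat (hx hs : ℝ) (x s w : Fin m → ℝ) (σ y : ℝ) : ℝ :=
  ∑ j, w j * phi hs (σ - s j) / (∑ k, w k * phi hs (σ - s k)) * phi (hx * s j) (y - x j)

/-- The initial statistics. -/
def That0 (hx hs q : ℝ) (x s : Fin m → ℝ) (j : Fin m) : ℝ :=
  min ((1 - q) * f0 (s j) (x j) / fStarHat hx hs x s (s j) (x j)) 1

/-- One update: the plug-in statistics computed from the weights `1 - T`. -/
def updateT (hx hs q : ℝ) (x s T : Fin m → ℝ) (j : Fin m) : ℝ :=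
  (1 - q) * f0 (s j) (x j) /
    ((1 - q) * f0 (s j) (x j) + q * f1Hat hx hs x s (fun k => 1 - T k) (s j) (x j))

/-- The final statistics, after two updates. -/
def That (hx hs q : ℝ) (x s : Fin m → ℝ) : Fin m → ℝ :=
  updateT hx hs q x s (updateT hx hs q x s (That0 hx hs q x s))

/-- The order statistics `T₍₁₎ ≤ ⋯ ≤ T₍ₘ₎` (indexed from `0`). -/
def orderStat (T : Fin m → ℝ) : Fin m → ℝ := T ∘ Tuple.sort T

/-- The indices `j` (counted from `0`) for which the mean of the `j + 1` smallest statistics is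
at most `α`. -/
def admissible (α : ℝ) (T : Fin m → ℝ) : Finset (Fin m) :=
  Finset.univ.filter fun j => (∑ i ∈ Finset.Iic j, orderStat T i) / ((j : ℝ) + 1) ≤ α

/-- The step-wise threshold: the largest order statistic whose index is admissible. If no index
is admissible (all statistics exceed `α`), it is `0`, and then no statistic is below it. -/
def stepThreshold (α : ℝ) (T : Fin m → ℝ) : ℝ :=
  if h : (admissible α T).Nonempty then orderStat T ((admissible α T).max' h) else 0

end Estimators

/-! ### The procedures applied to the first `m` units -/

section Procedures

variable {Ω : Type*} [MeasurableSpace Ω]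

/-- The indicators `θᵢ = 1{μᵢ ≠ 0}` of the first `m` units. -/
def theta (μ : ℕ → Ω → ℝ) (m : ℕ) (i : Fin m) (ω : Ω) : ℝ :=
  Set.indicator {ω | μ i ω ≠ 0} (fun _ => 1) ω

/-- The rule that rejects when the oracle statistic is below `t`. -/
def oracleRule (p : ℝ) (gμ : Measure ℝ) (V X : ℕ → Ω → ℝ) (m : ℕ) (t : ℝ) (i : Fin m) (ω : Ω) :
    ℝ :=
  Set.indicator {ω | oracleT p gμ (X i ω) √(V i ω) < t} (fun _ => 1) ω

/-- The oracle threshold `t* = sup {t : mFDR of the rule with threshold t is at most α}`. -/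
def tStar (P : Measure Ω) (p : ℝ) (gμ : Measure ℝ) (μ V X : ℕ → Ω → ℝ) (α : ℝ) (m : ℕ) : ℝ :=
  sSup {t : ℝ | mFDR P (theta μ m) (oracleRule p gμ V X m t) ≤ α}

/-- The oracle procedure. -/
def deltaFull (P : Measure Ω) (p : ℝ) (gμ : Measure ℝ) (μ V X : ℕ → Ω → ℝ) (α : ℝ) (m : ℕ) :
    Fin m → Ω → ℝ :=
  oracleRule p gμ V X m (tStar P p gμ μ V X α m)

/-- The data-driven statistics. -/
def dataT (hx hs : ℕ → ℝ) (phat : ℕ → Ω → ℝ) (V X : ℕ → Ω → ℝ) (m : ℕ) (ω : Ω) : Fin m → ℝ :=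
  That (hx m) (hs m) (phat m ω) (fun i => X i ω) (fun i => √(V i ω))

/-- The data-driven threshold. -/
def tHat (hx hs : ℕ → ℝ) (phat : ℕ → Ω → ℝ) (V X : ℕ → Ω → ℝ) (α : ℝ) (m : ℕ) (ω : Ω) : ℝ :=
  stepThreshold α (dataT hx hs phat V X m ω)

/-- The data-driven procedure. -/
def deltaDD (hx hs : ℕ → ℝ) (phat : ℕ → Ω → ℝ) (V X : ℕ → Ω → ℝ) (α : ℝ) (m : ℕ) (i : Fin m)
    (ω : Ω) : ℝ :=
  Set.indicator {ω | dataT hx hs phat V X m ω i ≤ tHat hx hs phat V X α m ω} (fun _ => 1) ω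

end Procedures

/-- The conditions on the (deterministic, positive) bandwidth sequences. -/
structure BandwidthCondition (hx hs : ℕ → ℝ) : Prop where
  pos_x : ∀ m, 0 < hx m
  pos_s : ∀ m, 0 < hs m
  tendsto_s : Tendsto hs atTop (𝓝 0)
  isLittleO_x : hx =o[atTop] fun m : ℕ => (Real.log m)⁻¹
  tendsto_mul : Tendsto (fun m : ℕ => m * hx m * hs m ^ 2) atTop atTop
  exists_delta : ∃ δ : ℝ, 0 < δ ∧
    Tendsto (fun m : ℕ => (m : ℝ) ^ (1 - δ) * hs m * hx m ^ 2) atTop atTop ∧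
    Tendsto (fun m : ℕ => (m : ℝ) ^ (-δ / 2) * hs m ^ 2 * (hx m)⁻¹) atTop (𝓝 0)

end HART

end

open MeasureTheory ProbabilityTheory Filter Topology Asymptotics

noncomputable section

namespace HART

set_option linter.unusedSectionVars false

/-! ### The Gaussian kernel -/

/-! The statistic T is the posterior probability of the null, so the error rates of rules based on T
depend only on its law ν: the rule {T < t} rejects a unit with probability ν(-∞, t), and falsely
with probability ∫_{u<t} u dν (`unitLaw_null_inter`). The oracle threshold t* is therefore the
crossing point of the excess G(t) = ∫_{u≤t} (u - α) dν, and the step-wise threshold is the crossing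
point of the empirical version of G. It remains to see that the estimates T̂ are close to T and that
the crossing is stable.

Closeness is needed only on average over the units (`Negligible`), because all the criteria are
averages. The law of σ may have no density, so the usual lower bound for the normalizing sums of the
kernel weights w_ij is replaced by a count of units in bins of length h_σ (`sum_div_sum_phi_le`).
For arbitrary design points in a bounded interval, the diagonal weights sum to O(1/h_σ), the column
sums are bounded, and the column sums weighted by distance are O(h_σ). Given the variances, the X_j
are independent with densities that are bounded and Lipschitz jointly in (σ, x). A kernel average
then splits into a centered sum, the own term j = i, and a bias. Over all units the second moments
of the centered sums add up to O(1/(h_x h_σ)), which is o(m), and the bias is O(h_σ + h_x) on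
average (`negligible_kernelAverage_sub`).

In an update the weights 1 - T̂_j depend on the whole sample, so conditional independence is lost.
The effect of replacing T̂ by T is bounded column by column (`sum_sum_varWeight_mul_phi_le`): up to
a small centered part, the coefficient of the error at j is bounded, so a negligible input error
stays negligible. With the weights 1 - T the numerator tends to p f₁ and the normalizer to p, hence
one update preserves consistency (`negligible_updateT_sub`).

For the threshold, strict convexity in x of the likelihood ratio (`strictConvexOn_likelihoodRatio`)
shows that T takes each value at most twice for a given σ, so ν has no atoms, and that T comes
arbitrarily close to 0, so by continuity the support of ν is an interval starting at 0. Consequently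
G is strictly negative on (0, t*) and positive beyond t* (`lawExcess_neg`, `lawExcess_pos`). The
empirical excess converges to G, which pins down the step-wise threshold
(`tendstoInMeasure_stepThreshold`). Since ν has no atom at t*, the data-driven and the oracle
decisions agree for most units (`negligible_deltaDD_sub`), and the rates and the power follow by
comparing averages. -/

lemma one_le_sqrt_two_pi : 1 ≤ √(2 * Real.pi) :=
  Real.one_le_sqrt.2 (by nlinarith [Real.pi_gt_three])

lemma phi_nonneg {h : ℝ} (hh : 0 ≤ h) (z : ℝ) : 0 ≤ phi h z := by
  unfold phi; positivity

lemma phi_pos {h : ℝ} (hh : 0 < h) (z : ℝ) : 0 < phi h z := by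
  unfold phi; positivity

lemma phi_le_inv {h : ℝ} (hh : 0 < h) (z : ℝ) : phi h z ≤ h⁻¹ := by
  unfold phi
  have h1 : Real.exp (-z ^ 2 / (2 * h ^ 2)) ≤ 1 :=
    Real.exp_le_one_iff.2 (div_nonpos_of_nonpos_of_nonneg (by nlinarith [sq_nonneg z])
      (by positivity))
  calc 1 / (√(2 * Real.pi) * h) * Real.exp (-z ^ 2 / (2 * h ^ 2))
      ≤ 1 / (√(2 * Real.pi) * h) * 1 := by gcongr
    _ ≤ 1 / (1 * h) * 1 := by gcongr; exact one_le_sqrt_two_pi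
    _ = h⁻¹ := by simp

@[fun_prop]
lemma measurable_phi {α : Type*} [MeasurableSpace α] {f g : α → ℝ} (hf : Measurable f)
    (hg : Measurable g) : Measurable fun a => phi (f a) (g a) := by
  unfold phi; fun_prop

lemma phi_eq_gaussianPDFReal {h : ℝ} (hh : 0 < h) (x u : ℝ) :
    phi h (x - u) = gaussianPDFReal u (h ^ 2).toNNReal x := by
  rw [gaussianPDFReal, phi, Real.coe_toNNReal _ (by positivity),
    Real.sqrt_mul (x := 2 * Real.pi) (by positivity) (h ^ 2), Real.sqrt_sq hh.le, one_div]

lemma integral_phi {h : ℝ} (hh : 0 < h) (x : ℝ) : ∫ y, phi h (x - y) = 1 := by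
  have : ∀ y, phi h (x - y) = gaussianPDFReal x (h ^ 2).toNNReal y := fun y => by
    rw [← phi_eq_gaussianPDFReal hh, phi, phi, ← neg_sub, neg_sq]
  simp_rw [this]
  exact integral_gaussianPDFReal_eq_one _ (by simp [hh.ne'])

lemma integrable_phi {h : ℝ} (hh : 0 < h) (x : ℝ) : Integrable fun y => phi h (x - y) := by
  have := integral_phi hh x
  -- A function that is not integrable has integral 0 by convention, so a nonzero value of the
  -- integral proves integrability.
  by_contra hn
  rw [integral_undef hn] at this
  norm_num at this

lemma integrable_sq_mul_phi {h : ℝ} (hh : 0 < h) (x : ℝ) :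
    Integrable (fun y => (x - y) ^ 2 * phi h (x - y)) ∧
      ∫ y, (x - y) ^ 2 * phi h (x - y) = h ^ 2 := by
  have hv : (h ^ 2).toNNReal ≠ 0 := by simp [hh.ne']
  have e : ∀ y, (x - y) ^ 2 * phi h (x - y) = gaussianPDFReal x (h ^ 2).toNNReal y •
      (y - x) ^ 2 := fun y => by
    rw [← phi_eq_gaussianPDFReal hh, phi, phi, ← neg_sub, neg_sq, smul_eq_mul]; ring
  have h2 : ∫ y, (x - y) ^ 2 * phi h (x - y) = h ^ 2 := by
    simp_rw [e]
    rw [← integral_gaussianReal_eq_integral_smul hv]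
    have := variance_id_gaussianReal (μ := x) (v := (h ^ 2).toNNReal)
    rw [variance_eq_integral (by fun_prop)] at this
    simpa [hh.le] using this
  refine ⟨?_, h2⟩
  by_contra hn
  rw [integral_undef hn] at h2
  exact absurd h2.symm (by positivity)

/-- The mean absolute deviation of `N(x, h²)` is at most `h`. -/
lemma integral_abs_mul_phi {h : ℝ} (hh : 0 < h) (x : ℝ) :
    Integrable (fun y => |x - y| * phi h (x - y)) ∧ ∫ y, |x - y| * phi h (x - y) ≤ h := by
  obtain ⟨i2, e2⟩ := integrable_sq_mul_phi hh x
  -- AM-GM in the form |t| ≤ h/2 + t²/(2h), balanced so that the zeroth and the second moment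
  -- contribute h/2 each.
  have hb : ∀ y, |x - y| * phi h (x - y)
      ≤ (h / 2) * phi h (x - y) + (2 * h)⁻¹ * ((x - y) ^ 2 * phi h (x - y)) := fun y => by
    rw [← mul_assoc, ← add_mul]
    refine mul_le_mul_of_nonneg_right ?_ (phi_nonneg hh.le _)
    have : h / 2 + (2 * h)⁻¹ * (x - y) ^ 2 - |x - y| = (h - |x - y|) ^ 2 / (2 * h) := by
      field_simp; rw [← sq_abs (x - y)]; ring
    have : 0 ≤ (h - |x - y|) ^ 2 / (2 * h) := by positivity
    linarith
  have ib := ((integrable_phi hh x).const_mul (h / 2)).add (i2.const_mul (2 * h)⁻¹)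
  have i1 : Integrable (fun y => |x - y| * phi h (x - y)) := by
    refine ib.mono' (by fun_prop) (Eventually.of_forall fun y => ?_)
    rw [Real.norm_of_nonneg (mul_nonneg (abs_nonneg _) (phi_nonneg hh.le _))]
    exact hb y
  refine ⟨i1, (integral_mono i1 ib hb).trans ?_⟩
  simp only [Pi.add_apply]
  rw [integral_add ((integrable_phi hh x).const_mul (h / 2)) (i2.const_mul (2 * h)⁻¹),
    integral_const_mul, integral_const_mul, e2, integral_phi hh]
  apply le_of_eq; field_simp; norm_num

lemma hasDerivAt_phi_right {h : ℝ} (hh : 0 < h) (z : ℝ) :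
    HasDerivAt (fun z => phi h z) (-(z / h ^ 2) * phi h z) z := by
  unfold phi
  have := (((((hasDerivAt_id z).pow 2).neg).div_const (2 * h ^ 2)).exp).const_mul
    (1 / (√(2 * Real.pi) * h))
  refine this.congr_deriv ?_
  simp; field_simp

lemma hasDerivAt_phi_left {h : ℝ} (hh : 0 < h) (z : ℝ) :
    HasDerivAt (fun h => phi h z) ((z ^ 2 / h ^ 3 - 1 / h) * phi h z) h := by
  have h0 : √(2 * Real.pi) ≠ 0 := by positivity
  have h1 : HasDerivAt (fun h => 1 / (√(2 * Real.pi) * h)) (-(√(2 * Real.pi))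
      / (√(2 * Real.pi) * h) ^ 2) h := by
    simp only [one_div]
    refine (((hasDerivAt_id h).const_mul √(2 * Real.pi)).inv (mul_ne_zero h0 hh.ne')).congr_deriv
      (by simp)
  have h2 : HasDerivAt (fun h => Real.exp (-z ^ 2 / (2 * h ^ 2)))
      (Real.exp (-z ^ 2 / (2 * h ^ 2)) * (z ^ 2 / h ^ 3)) h := by
    have := ((((hasDerivAt_pow 2 h).const_mul 2).inv (by positivity)).const_mul (-z ^ 2)).exp
    refine this.congr_deriv ?_
    simp only [Pi.inv_apply, div_eq_mul_inv]
    field_simp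
    ring
  refine (h1.mul h2).congr_deriv ?_
  unfold phi
  field_simp
  ring

lemma abs_mul_exp_le (t : ℝ) : |t| * Real.exp (-t ^ 2 / 2) ≤ 1 := by
  have h1 : |t| ≤ Real.exp (t ^ 2 / 2) :=
    le_trans (by nlinarith [sq_abs t, sq_nonneg (|t| - 1)]) (Real.add_one_le_exp _)
  calc |t| * Real.exp (-t ^ 2 / 2) ≤ Real.exp (t ^ 2 / 2) * Real.exp (-t ^ 2 / 2) := by gcongr
    _ = 1 := by rw [← Real.exp_add]; ring_nf; simp

lemma sq_mul_exp_le (t : ℝ) : t ^ 2 * Real.exp (-t ^ 2 / 2) ≤ 2 := by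
  have h1 : t ^ 2 ≤ 2 * Real.exp (t ^ 2 / 2) := by linarith [Real.add_one_le_exp (t ^ 2 / 2)]
  calc t ^ 2 * Real.exp (-t ^ 2 / 2) ≤ 2 * Real.exp (t ^ 2 / 2) * Real.exp (-t ^ 2 / 2) := by
        gcongr
    _ = 2 := by rw [mul_assoc, ← Real.exp_add]; ring_nf; simp

lemma phi_eq_scaled {h : ℝ} (hh : 0 < h) (z : ℝ) :
    phi h z = (√(2 * Real.pi) * h)⁻¹ * Real.exp (-(z / h) ^ 2 / 2) := by
  unfold phi
  rw [one_div]; congr 2; field_simp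

/-- The constant 1 would do here; 3 = 2 + 1 is what the derivative in the bandwidth requires, and
both partial derivatives are given the same bound. -/
lemma abs_deriv_phi_right_le {a h : ℝ} (ha : 0 < a) (hh : a ≤ h) (z : ℝ) :
    |-(z / h ^ 2) * phi h z| ≤ 3 / a ^ 2 := by
  have hh0 : 0 < h := ha.trans_le hh
  rw [phi_eq_scaled hh0]
  have e : -(z / h ^ 2) * ((√(2 * Real.pi) * h)⁻¹ * Real.exp (-(z / h) ^ 2 / 2))
      = (√(2 * Real.pi))⁻¹ * (h ^ 2)⁻¹ * (-((z / h) * Real.exp (-(z / h) ^ 2 / 2))) := by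
    field_simp
  rw [e, abs_mul, abs_neg, abs_mul (z / h), Real.abs_exp,
    abs_of_nonneg (a := (√(2 * Real.pi))⁻¹ * (h ^ 2)⁻¹) (by positivity)]
  calc (√(2 * Real.pi))⁻¹ * (h ^ 2)⁻¹ * (|z / h| * Real.exp (-(z / h) ^ 2 / 2))
      ≤ 1 * (a ^ 2)⁻¹ * 1 := by
        gcongr
        · exact inv_le_one_of_one_le₀ one_le_sqrt_two_pi
        · exact abs_mul_exp_le _
    _ ≤ 3 / a ^ 2 := by rw [one_mul, mul_one, ← one_div]; gcongr; norm_num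

lemma abs_deriv_phi_left_le {a h : ℝ} (ha : 0 < a) (hh : a ≤ h) (z : ℝ) :
    |(z ^ 2 / h ^ 3 - 1 / h) * phi h z| ≤ 3 / a ^ 2 := by
  have hh0 : 0 < h := ha.trans_le hh
  rw [phi_eq_scaled hh0]
  set E := Real.exp (-(z / h) ^ 2 / 2) with hE
  have e : (z ^ 2 / h ^ 3 - 1 / h) * ((√(2 * Real.pi) * h)⁻¹ * E)
      = (√(2 * Real.pi))⁻¹ * (h ^ 2)⁻¹ * ((z / h) ^ 2 * E - E) := by
    field_simp
  have hE1 : E ≤ 1 := Real.exp_le_one_iff.2 (by nlinarith [sq_nonneg (z / h)])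
  have hE0 : 0 < E := Real.exp_pos _
  have hq := sq_mul_exp_le (z / h)
  have hb : |(z / h) ^ 2 * E - E| ≤ 3 := by
    rw [abs_le]; constructor <;> nlinarith [mul_nonneg (sq_nonneg (z / h)) hE0.le]
  rw [e, abs_mul, abs_of_nonneg (a := (√(2 * Real.pi))⁻¹ * (h ^ 2)⁻¹) (by positivity)]
  calc (√(2 * Real.pi))⁻¹ * (h ^ 2)⁻¹ * |(z / h) ^ 2 * E - E|
      ≤ 1 * (a ^ 2)⁻¹ * 3 := by
        gcongr
        exact inv_le_one_of_one_le₀ one_le_sqrt_two_pi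
    _ = 3 / a ^ 2 := by ring

/-- Away from bandwidth zero the Gaussian kernel is Lipschitz in both arguments. -/
lemma abs_phi_sub_phi_le {a h h' : ℝ} (ha : 0 < a) (hh : a ≤ h) (hh' : a ≤ h') (z z' : ℝ) :
    |phi h z - phi h' z'| ≤ 3 / a ^ 2 * (|h - h'| + |z - z'|) := by
  have h1 : |phi h z - phi h' z| ≤ 3 / a ^ 2 * |h - h'| := by
    have := Convex.norm_image_sub_le_of_norm_hasDerivWithin_le (f := fun h => phi h z)
      (f' := fun h => (z ^ 2 / h ^ 3 - 1 / h) * phi h z) (C := 3 / a ^ 2) (s := Set.Ici a)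
      (x := h') (y := h)
      (fun t ht => (hasDerivAt_phi_left (ha.trans_le ht) z).hasDerivWithinAt)
      (fun t ht => abs_deriv_phi_left_le ha ht z) (convex_Ici a) hh' hh
    simpa using this
  have h2 : |phi h' z - phi h' z'| ≤ 3 / a ^ 2 * |z - z'| := by
    have := Convex.norm_image_sub_le_of_norm_hasDerivWithin_le (f := fun z => phi h' z)
      (f' := fun z => -(z / h' ^ 2) * phi h' z) (C := 3 / a ^ 2) (s := Set.univ)
      (x := z') (y := z)
      (fun t _ => (hasDerivAt_phi_right (ha.trans_le hh') t).hasDerivWithinAt)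
      (fun t _ => abs_deriv_phi_right_le ha hh' t) convex_univ trivial trivial
    simpa using this
  calc |phi h z - phi h' z'| ≤ |phi h z - phi h' z| + |phi h' z - phi h' z'| :=
        abs_sub_le _ _ _
    _ ≤ _ := by rw [mul_add]; exact add_le_add h1 h2

/-! ### The densities and the oracle statistic -/

section Densities

variable {gμ : Measure ℝ} [IsProbabilityMeasure gμ] {p : ℝ}

lemma integrable_phi_sub {σ : ℝ} (hσ : 0 < σ) (x : ℝ) :
    Integrable (fun u => phi σ (x - u)) gμ := by
  refine Integrable.of_bound (C := σ⁻¹)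
    (Measurable.aestronglyMeasurable (by fun_prop)) (Eventually.of_forall fun u => ?_)
  rw [Real.norm_of_nonneg (phi_nonneg hσ.le _)]
  exact phi_le_inv hσ _

omit [IsProbabilityMeasure gμ] in
lemma f1_nonneg {σ : ℝ} (hσ : 0 ≤ σ) (x : ℝ) : 0 ≤ f1 gμ σ x :=
  integral_nonneg fun _ => phi_nonneg hσ _

lemma f1_pos {σ : ℝ} (hσ : 0 < σ) (x : ℝ) : 0 < f1 gμ σ x := by
  refine (integral_pos_iff_support_of_nonneg (fun u => phi_nonneg hσ.le _)
    (integrable_phi_sub hσ x)).2 ?_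
  have : Function.support (fun u => phi σ (x - u)) = Set.univ :=
    Set.eq_univ_of_forall fun u => (phi_pos hσ _).ne'
  simp [this]

lemma f1_le_inv {σ : ℝ} (hσ : 0 < σ) (x : ℝ) : f1 gμ σ x ≤ σ⁻¹ := by
  calc f1 gμ σ x ≤ ∫ _, σ⁻¹ ∂gμ :=
        integral_mono (integrable_phi_sub hσ x) (integrable_const _) fun u => phi_le_inv hσ _
    _ = σ⁻¹ := by simp

lemma abs_f1_sub_f1_le {a σ σ' : ℝ} (ha : 0 < a) (hσ : a ≤ σ) (hσ' : a ≤ σ') (x x' : ℝ) :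
    |f1 gμ σ x - f1 gμ σ' x'| ≤ 3 / a ^ 2 * (|σ - σ'| + |x - x'|) := by
  rw [f1, f1, ← integral_sub (integrable_phi_sub (ha.trans_le hσ) x)
    (integrable_phi_sub (ha.trans_le hσ') x'), ← Real.norm_eq_abs]
  refine (norm_integral_le_of_norm_le_const (C := 3 / a ^ 2 * (|σ - σ'| + |x - x'|))
    (Eventually.of_forall fun u => ?_)).trans (by simp)
  simpa using abs_phi_sub_phi_le ha hσ hσ' (x - u) (x' - u)

@[fun_prop]
lemma measurable_f1 {α : Type*} [MeasurableSpace α] {f g : α → ℝ} (hf : Measurable f)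
    (hg : Measurable g) : Measurable fun a => f1 gμ (f a) (g a) := by
  unfold f1
  have : StronglyMeasurable fun q : α × ℝ => phi (f q.1) (g q.1 - q.2) :=
    Measurable.stronglyMeasurable (by fun_prop)
  exact this.integral_prod_right.measurable

@[fun_prop]
lemma measurable_f0 {α : Type*} [MeasurableSpace α] {f g : α → ℝ} (hf : Measurable f)
    (hg : Measurable g) : Measurable fun a => f0 (f a) (g a) := by
  unfold f0; fun_prop

@[fun_prop]
lemma measurable_fMix {α : Type*} [MeasurableSpace α] {f g : α → ℝ} (hf : Measurable f)
    (hg : Measurable g) : Measurable fun a => fMix p gμ (f a) (g a) := by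
  unfold fMix; fun_prop

@[fun_prop]
lemma measurable_oracleT {α : Type*} [MeasurableSpace α] {f g : α → ℝ} (hf : Measurable f)
    (hg : Measurable g) : Measurable fun a => oracleT p gμ (f a) (g a) := by
  unfold oracleT; fun_prop

variable (hp0 : 0 < p) (hp1 : p < 1)
include hp0 hp1

lemma fMix_pos {σ : ℝ} (hσ : 0 < σ) (x : ℝ) : 0 < fMix p gμ σ x := by
  have := phi_pos hσ x
  have := f1_pos (gμ := gμ) hσ x
  have : 0 < 1 - p := by linarith
  unfold fMix f0; positivity

lemma fMix_le_inv {σ : ℝ} (hσ : 0 < σ) (x : ℝ) : fMix p gμ σ x ≤ σ⁻¹ := by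
  unfold fMix f0
  nlinarith [phi_le_inv hσ x, f1_le_inv (gμ := gμ) hσ x]

lemma abs_fMix_sub_fMix_le {a σ σ' : ℝ} (ha : 0 < a) (hσ : a ≤ σ) (hσ' : a ≤ σ') (x x' : ℝ) :
    |fMix p gμ σ x - fMix p gμ σ' x'| ≤ 3 / a ^ 2 * (|σ - σ'| + |x - x'|) := by
  unfold fMix f0
  have h1 := abs_phi_sub_phi_le ha hσ hσ' x x'
  have h2 := abs_f1_sub_f1_le (gμ := gμ) ha hσ hσ' x x'
  rw [abs_le] at *
  constructor <;> nlinarith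

omit [IsProbabilityMeasure gμ] hp0 hp1 in
lemma oracleT_nonneg (hp0 : 0 ≤ p) (hp1 : p ≤ 1) {σ : ℝ} (hσ : 0 ≤ σ) (x : ℝ) :
    0 ≤ oracleT p gμ x σ := by
  have h1 : 0 ≤ (1 - p) * phi σ x := mul_nonneg (by linarith) (phi_nonneg hσ _)
  have h2 : 0 ≤ p * f1 gμ σ x := mul_nonneg hp0 (f1_nonneg hσ _)
  unfold oracleT fMix f0; positivity

omit [IsProbabilityMeasure gμ] hp0 hp1 in
lemma oracleT_le_one (hp0 : 0 ≤ p) (hp1 : p ≤ 1) {σ : ℝ} (hσ : 0 ≤ σ) (x : ℝ) :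
    oracleT p gμ x σ ≤ 1 := by
  have h1 : 0 ≤ (1 - p) * phi σ x := mul_nonneg (by linarith) (phi_nonneg hσ _)
  have h2 : 0 ≤ p * f1 gμ σ x := mul_nonneg hp0 (f1_nonneg hσ _)
  exact div_le_one_of_le₀ (by unfold fMix f0; linarith) (by unfold fMix f0; linarith)

lemma oracleT_mul_fMix {σ : ℝ} (hσ : 0 < σ) (x : ℝ) :
    oracleT p gμ x σ * fMix p gμ σ x = (1 - p) * f0 σ x :=
  div_mul_cancel₀ _ (fMix_pos hp0 hp1 hσ x).ne'

lemma one_sub_oracleT_mul_fMix {σ : ℝ} (hσ : 0 < σ) (x : ℝ) :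
    (1 - oracleT p gμ x σ) * fMix p gμ σ x = p * f1 gμ σ x := by
  rw [sub_mul, oracleT_mul_fMix hp0 hp1 hσ, fMix]; ring

omit hp0 hp1 in
lemma continuous_f1 {σ : ℝ} (hσ : 0 < σ) : Continuous (f1 gμ σ) := by
  refine (LipschitzWith.of_dist_le_mul (K := (3 / σ ^ 2).toNNReal) fun x y => ?_).continuous
  rw [Real.dist_eq, Real.dist_eq, Real.coe_toNNReal _ (by positivity)]
  simpa using abs_f1_sub_f1_le (gμ := gμ) hσ le_rfl le_rfl x y

lemma continuous_oracleT {σ : ℝ} (hσ : 0 < σ) : Continuous fun x => oracleT p gμ x σ := by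
  have h0 : Continuous (f0 σ) := by unfold f0 phi; fun_prop
  have h1 := continuous_f1 (gμ := gμ) hσ
  refine Continuous.div (by fun_prop) (by unfold fMix; fun_prop) fun x =>
    (fMix_pos hp0 hp1 hσ x).ne'

/-! ### The likelihood ratio -/

omit hp0 hp1

/-- The likelihood ratio of the alternative and the null density. -/
def likelihoodRatio (gμ : Measure ℝ) (σ x : ℝ) : ℝ :=
  ∫ u, Real.exp ((2 * x * u - u ^ 2) / (2 * σ ^ 2)) ∂gμ

lemma integrable_exp_likelihood {σ : ℝ} (hσ : 0 < σ) (x : ℝ) :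
    Integrable (fun u => Real.exp ((2 * x * u - u ^ 2) / (2 * σ ^ 2))) gμ := by
  refine Integrable.of_bound (C := Real.exp (x ^ 2 / (2 * σ ^ 2)))
    (Measurable.aestronglyMeasurable (by fun_prop)) (Eventually.of_forall fun u => ?_)
  rw [Real.norm_of_nonneg (Real.exp_pos _).le]
  gcongr
  nlinarith [sq_nonneg (x - u)]

omit [IsProbabilityMeasure gμ] in
lemma likelihoodRatio_nonneg (σ x : ℝ) : 0 ≤ likelihoodRatio gμ σ x :=
  integral_nonneg fun _ => (Real.exp_pos _).le

omit [IsProbabilityMeasure gμ] in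
lemma f1_eq_mul_likelihoodRatio {σ : ℝ} (hσ : 0 < σ) (x : ℝ) :
    f1 gμ σ x = f0 σ x * likelihoodRatio gμ σ x := by
  rw [f1, likelihoodRatio, ← integral_const_mul]
  congr 1 with u
  rw [f0, phi, phi, mul_assoc, ← Real.exp_add]
  congr 2
  field_simp
  ring

omit [IsProbabilityMeasure gμ] in
lemma oracleT_eq_likelihoodRatio {σ : ℝ} (hσ : 0 < σ) (x : ℝ) :
    oracleT p gμ x σ = (1 - p) / ((1 - p) + p * likelihoodRatio gμ σ x) := by
  have h0 : f0 σ x ≠ 0 := (phi_pos hσ x).ne'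
  rw [oracleT, fMix, f1_eq_mul_likelihoodRatio hσ,
    show (1 - p) * f0 σ x + p * (f0 σ x * likelihoodRatio gμ σ x)
      = ((1 - p) + p * likelihoodRatio gμ σ x) * f0 σ x by ring, mul_div_mul_right _ _ h0]

/-- The exponent is affine in x with slope u/σ², which is nonzero for almost every u because `gμ`
does not charge 0; strict convexity of exp therefore survives integration. -/
lemma strictConvexOn_likelihoodRatio (hg : gμ {0} = 0) {σ : ℝ} (hσ : 0 < σ) :
    StrictConvexOn ℝ Set.univ (likelihoodRatio gμ σ) := by
  refine ⟨convex_univ, fun x _ y _ hxy a b ha hb hab => ?_⟩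
  have ix := integrable_exp_likelihood (gμ := gμ) hσ x
  have iy := integrable_exp_likelihood (gμ := gμ) hσ y
  have iz := integrable_exp_likelihood (gμ := gμ) hσ (a • x + b • y)
  have key : ∀ u, u ≠ 0 → Real.exp ((2 * (a • x + b • y) * u - u ^ 2) / (2 * σ ^ 2))
      < a * Real.exp ((2 * x * u - u ^ 2) / (2 * σ ^ 2))
        + b * Real.exp ((2 * y * u - u ^ 2) / (2 * σ ^ 2)) := by
    intro u hu
    have hne : (2 * x * u - u ^ 2) / (2 * σ ^ 2) ≠ (2 * y * u - u ^ 2) / (2 * σ ^ 2) := by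
      intro h
      rw [div_left_inj' (by positivity)] at h
      exact hxy (mul_right_cancel₀ hu (by linarith))
    have := strictConvexOn_exp.2 (Set.mem_univ _) (Set.mem_univ _) hne ha hb hab
    simp only [smul_eq_mul] at this ⊢
    refine lt_of_eq_of_lt (congrArg Real.exp ?_) this
    rw [← mul_div_assoc, ← mul_div_assoc, ← add_div]
    congr 1
    linear_combination (u ^ 2) * hab
  have hle : ∀ u, 0 ≤ a * Real.exp ((2 * x * u - u ^ 2) / (2 * σ ^ 2))
        + b * Real.exp ((2 * y * u - u ^ 2) / (2 * σ ^ 2))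
        - Real.exp ((2 * (a • x + b • y) * u - u ^ 2) / (2 * σ ^ 2)) := by
    intro u
    by_cases hu : u = 0
    · simp [hu, hab]
    · exact (sub_pos.2 (key u hu)).le
  have hpos : 0 < ∫ u, (a * Real.exp ((2 * x * u - u ^ 2) / (2 * σ ^ 2))
        + b * Real.exp ((2 * y * u - u ^ 2) / (2 * σ ^ 2))
        - Real.exp ((2 * (a • x + b • y) * u - u ^ 2) / (2 * σ ^ 2))) ∂gμ := by
    refine (integral_pos_iff_support_of_nonneg hle
      (((ix.const_mul a).add (iy.const_mul b)).sub iz)).2 ?_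
    have h1 : gμ ({0}ᶜ : Set ℝ) = 1 := (prob_compl_eq_one_iff (measurableSet_singleton 0)).2 hg
    refine lt_of_lt_of_le (by rw [h1]; exact zero_lt_one) (measure_mono fun u hu => ?_)
    exact (sub_pos.2 (key u hu)).ne'
  rw [integral_sub ((ix.const_mul a).fun_add (iy.const_mul b)) iz, integral_add (ix.const_mul a) (iy.const_mul b),
    integral_const_mul, integral_const_mul] at hpos
  simp only [likelihoodRatio, smul_eq_mul] at hpos ⊢
  linarith

include hp0 hp1

omit [IsProbabilityMeasure gμ] in
lemma likelihoodRatio_eq_of_oracleT_eq {σ : ℝ} (hσ : 0 < σ) {x y : ℝ}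
    (h : oracleT p gμ x σ = oracleT p gμ y σ) :
    likelihoodRatio gμ σ x = likelihoodRatio gμ σ y := by
  rw [oracleT_eq_likelihoodRatio hσ, oracleT_eq_likelihoodRatio hσ] at h
  have hx := mul_nonneg hp0.le (likelihoodRatio_nonneg (gμ := gμ) σ x)
  have hy := mul_nonneg hp0.le (likelihoodRatio_nonneg (gμ := gμ) σ y)
  have h1 : (0 : ℝ) < 1 - p := by linarith
  rw [div_eq_div_iff (by linarith) (by linarith)] at h
  exact mul_left_cancel₀ hp0.ne' (by linarith [mul_left_cancel₀ h1.ne' h])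

/-- T is an injective function of the likelihood ratio, and a strictly convex function takes no
value three times, so every level set of T has at most two points. -/
lemma volume_oracleT_eq (hg : gμ {0} = 0) {σ : ℝ} (hσ : 0 < σ) (t : ℝ) :
    volume {x | oracleT p gμ x σ = t} = 0 := by
  set S := {x | oracleT p gμ x σ = t} with hS
  have hno : ∀ x ∈ S, ∀ y ∈ S, ∀ z ∈ S, x < y → ¬ y < z := by
    intro x hx y hy z hz hxy hyz
    have e1 := likelihoodRatio_eq_of_oracleT_eq hp0 hp1 (gμ := gμ) hσ (hx.trans hy.symm)
    have e2 := likelihoodRatio_eq_of_oracleT_eq hp0 hp1 (gμ := gμ) hσ (hz.trans hy.symm)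
    have hd : 0 < z - x := by linarith
    have := (strictConvexOn_likelihoodRatio hg hσ).2 (Set.mem_univ x) (Set.mem_univ z)
      (hxy.trans hyz).ne (show 0 < (z - y) / (z - x) from div_pos (by linarith) hd)
      (show 0 < (y - x) / (z - x) from div_pos (by linarith) hd) (by field_simp; ring)
    have e3 : ((z - y) / (z - x)) • x + ((y - x) / (z - x)) • z = y := by
      simp only [smul_eq_mul]; field_simp; ring
    rw [e3, e1, e2, ← add_smul, show (z - y) / (z - x) + (y - x) / (z - x) = 1 by
      field_simp; ring, one_smul] at this
    exact lt_irrefl _ this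
  rcases S.eq_empty_or_nonempty with h | ⟨y, hy⟩
  · simp [h]
  have h1 : (S ∩ Set.Ioi y).Subsingleton := fun a ha b hb => by
    by_contra hab
    rcases lt_or_gt_of_ne hab with h | h
    · exact hno y hy a ha.1 b hb.1 ha.2 h
    · exact hno y hy b hb.1 a ha.1 hb.2 h
  have h2 : (S ∩ Set.Iio y).Subsingleton := fun a ha b hb => by
    by_contra hab
    rcases lt_or_gt_of_ne hab with h | h
    · exact hno a ha.1 b hb.1 y hy h hb.2
    · exact hno b hb.1 a ha.1 y hy h ha.2
  have hsub : S ⊆ (S ∩ Set.Ioi y) ∪ (S ∩ Set.Iio y) ∪ {y} := fun a ha => by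
    rcases lt_trichotomy a y with h | h | h
    · exact Or.inl (Or.inr ⟨ha, h⟩)
    · exact Or.inr h
    · exact Or.inl (Or.inl ⟨ha, h⟩)
  exact measure_mono_null hsub (measure_union_null (measure_union_null
    (h1.measure_zero _) (h2.measure_zero _)) (measure_singleton _))

/-- A bounded convex function on the line is constant, which strict convexity excludes. So the
likelihood ratio is unbounded and T comes arbitrarily close to 0. -/
lemma exists_oracleT_lt (hg : gμ {0} = 0) {σ : ℝ} (hσ : 0 < σ) {s : ℝ} (hs : 0 < s) :
    ∃ x, oracleT p gμ x σ < s := by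
  by_contra! hcon
  have h1p : (0 : ℝ) < 1 - p := by linarith
  set c := (1 - p) / s / p with hc
  have hc0 : 0 ≤ c := by positivity
  have hb : ∀ x, likelihoodRatio gμ σ x ≤ c := fun x => by
    have h := hcon x
    have h0 := mul_nonneg hp0.le (likelihoodRatio_nonneg (gμ := gμ) σ x)
    rw [oracleT_eq_likelihoodRatio hσ, le_div_iff₀ (by linarith)] at h
    rw [hc, le_div_iff₀ hp0, le_div_iff₀ hs]
    nlinarith
  have hconv := strictConvexOn_likelihoodRatio hg hσ
  -- Here y lies on the segment from 0 to the remote point y/t, and convexity bounds the value at y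
  -- by (1 - t) times the value at 0 plus t c. Letting t tend to 0 makes 0 a maximum, against strict
  -- convexity at the midpoint of -1 and 1.
  have hle : ∀ y, likelihoodRatio gμ σ y ≤ likelihoodRatio gμ σ 0 := fun y => by
    refine le_of_forall_pos_le_add fun ε hε => ?_
    set t := min 1 (ε / (c + 1)) with ht
    have ht0 : 0 < t := lt_min one_pos (by positivity)
    have ht1 : t ≤ 1 := min_le_left _ _
    have htε : t * c ≤ ε := by
      calc t * c ≤ ε / (c + 1) * (c + 1) := by gcongr; exacts [min_le_right _ _, by linarith]
        _ = ε := by field_simp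
    have := hconv.convexOn.2 (Set.mem_univ 0) (Set.mem_univ (y / t))
      (show 0 ≤ 1 - t by linarith) ht0.le (by ring)
    have e : (1 - t) • (0 : ℝ) + t • (y / t) = y := by simp; field_simp
    rw [e] at this
    simp only [smul_eq_mul] at this
    nlinarith [hb (y / t), likelihoodRatio_nonneg (gμ := gμ) σ 0]
  have := hconv.2 (Set.mem_univ 1) (Set.mem_univ (-1)) (by norm_num)
    (show (0 : ℝ) < 1 / 2 by norm_num) (show (0 : ℝ) < 1 / 2 by norm_num) (by norm_num)
  simp only [smul_eq_mul] at this
  norm_num at this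
  linarith [hle 1, hle (-1)]

end Densities

/-! ### The kernel weights -/

section Weights

variable {m : ℕ}

/-- The weight of the `j`-th unit in the kernel estimates at the `i`-th unit. -/
def kernelWeight (h : ℝ) (s : Fin m → ℝ) (i j : Fin m) : ℝ :=
  phi h (s i - s j) / ∑ k, phi h (s i - s k)

variable {h : ℝ} (hh : 0 < h) (s : Fin m → ℝ)
include hh

lemma sum_phi_pos (i : Fin m) : 0 < ∑ k, phi h (s i - s k) :=
  Finset.sum_pos (fun _ _ => phi_pos hh _) ⟨i, Finset.mem_univ i⟩

lemma kernelWeight_pos (i j : Fin m) : 0 < kernelWeight h s i j :=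
  div_pos (phi_pos hh _) (sum_phi_pos hh s i)

lemma kernelWeight_nonneg (i j : Fin m) : 0 ≤ kernelWeight h s i j :=
  (kernelWeight_pos hh s i j).le

lemma sum_kernelWeight (i : Fin m) : ∑ j, kernelWeight h s i j = 1 := by
  simp only [kernelWeight]
  rw [← Finset.sum_div, div_self (sum_phi_pos hh s i).ne']

omit hh in
lemma phi_eq_phi_zero_mul (z : ℝ) : phi h z = phi h 0 * Real.exp (-z ^ 2 / (2 * h ^ 2)) := by
  simp [phi]

lemma kernelWeight_le_diag (i j : Fin m) : kernelWeight h s i j ≤ kernelWeight h s i i := by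
  unfold kernelWeight
  have := (sum_phi_pos hh s i).le
  gcongr
  rw [phi_eq_phi_zero_mul, sub_self]
  refine mul_le_of_le_one_right (phi_nonneg hh.le _) (Real.exp_le_one_iff.2 ?_)
  exact div_nonpos_of_nonpos_of_nonneg (by nlinarith [sq_nonneg (s i - s j)]) (by positivity)

/-- The row sums to 1 and its largest entry is the diagonal one. This reduces the variance of a
kernel average to a diagonal weight. -/
lemma sum_kernelWeight_sq_le (i : Fin m) :
    ∑ j, kernelWeight h s i j ^ 2 ≤ kernelWeight h s i i := by
  calc ∑ j, kernelWeight h s i j ^ 2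
      ≤ ∑ j, kernelWeight h s i i * kernelWeight h s i j := by
        refine Finset.sum_le_sum fun j _ => ?_
        rw [sq]
        exact mul_le_mul_of_nonneg_right (kernelWeight_le_diag hh s i j)
          (kernelWeight_nonneg hh s i j)
    _ = kernelWeight h s i i := by rw [← Finset.mul_sum, sum_kernelWeight hh, mul_one]

/-- Units in the same bin of length `h` contribute to the normalizing sum. -/
lemma phi_zero_mul_card_le (i : Fin m) :
    phi h 0 * (Finset.univ.filter fun k => ⌊s k / h⌋ = ⌊s i / h⌋).card
      ≤ 2 * ∑ k, phi h (s i - s k) := by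
  set F := Finset.univ.filter fun k => ⌊s k / h⌋ = ⌊s i / h⌋
  have h0 := phi_pos hh 0
  have key : ∀ k ∈ F, phi h 0 ≤ 2 * phi h (s i - s k) := fun k hk => by
    have hk' : ⌊s k / h⌋ = ⌊s i / h⌋ := (Finset.mem_filter.1 hk).2
    have hd : |s k / h - s i / h| < 1 := Int.abs_sub_lt_one_of_floor_eq_floor hk'
    have hd2 : (s i - s k) ^ 2 / h ^ 2 ≤ 1 := by
      rw [← sub_div] at hd
      have : (s i - s k) ^ 2 / h ^ 2 = ((s k - s i) / h) ^ 2 := by rw [div_pow]; ring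
      rw [this, ← sq_abs]
      nlinarith [abs_nonneg ((s k - s i) / h)]
    -- Within a bin the exponent is at least -1/2, and exp t ≥ 1 + t.
    have he : (1 : ℝ) / 2 ≤ Real.exp (-(s i - s k) ^ 2 / (2 * h ^ 2)) := by
      refine le_trans ?_ (Real.add_one_le_exp _)
      have : -(s i - s k) ^ 2 / (2 * h ^ 2) = -((s i - s k) ^ 2 / h ^ 2) / 2 := by
        field_simp
      rw [this]; linarith
    rw [phi_eq_phi_zero_mul (s i - s k)]
    nlinarith
  calc phi h 0 * F.card = ∑ _k ∈ F, phi h 0 := by simp [mul_comm]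
    _ ≤ ∑ k ∈ F, 2 * phi h (s i - s k) := Finset.sum_le_sum key
    _ ≤ ∑ k, 2 * phi h (s i - s k) :=
        Finset.sum_le_sum_of_subset_of_nonneg (Finset.subset_univ _)
          fun k _ _ => mul_nonneg zero_le_two (phi_nonneg hh.le _)
    _ = _ := by rw [Finset.mul_sum]

/-- If a bin holds n units, each of their normalizing sums is at least n φ(0)/2, so together they
contribute at most twice the bound c of that bin. The number of units cancels, hence no assumption
on the spread of the points is needed. -/
lemma sum_div_sum_phi_le (ψ : Fin m → ℝ) (c : ℤ → ℝ) (hc : ∀ l, 0 ≤ c l)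
    (hψ : ∀ i, ψ i ≤ c ⌊s i / h⌋) :
    ∑ i, phi h 0 * ψ i / ∑ k, phi h (s i - s k)
      ≤ 2 * ∑ l ∈ Finset.univ.image (fun i => ⌊s i / h⌋), c l := by
  have h0 := phi_pos hh 0
  set n : ℤ → ℝ := fun l => (Finset.univ.filter fun k => ⌊s k / h⌋ = l).card with hn
  have hnpos : ∀ i, 0 < n ⌊s i / h⌋ := fun i => by
    simp only [hn, Nat.cast_pos]
    exact Finset.card_pos.2 ⟨i, by simp⟩
  calc ∑ i, phi h 0 * ψ i / ∑ k, phi h (s i - s k)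
      ≤ ∑ i, 2 * (c ⌊s i / h⌋ / n ⌊s i / h⌋) := by
        refine Finset.sum_le_sum fun i _ => ?_
        rw [div_le_iff₀ (sum_phi_pos hh s i)]
        have h1 := phi_zero_mul_card_le hh s i
        have h2 : phi h 0 ≤ 2 * (∑ k, phi h (s i - s k)) / n ⌊s i / h⌋ := by
          rw [le_div_iff₀ (hnpos i)]; exact h1
        calc phi h 0 * ψ i ≤ phi h 0 * c ⌊s i / h⌋ := by gcongr; exact hψ i
          _ ≤ 2 * (∑ k, phi h (s i - s k)) / n ⌊s i / h⌋ * c ⌊s i / h⌋ := by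
              gcongr; exact hc _
          _ = _ := by ring
    _ = 2 * ∑ i, (fun l => c l / n l) ⌊s i / h⌋ := by rw [Finset.mul_sum]
    _ = 2 * ∑ l ∈ Finset.univ.image (fun i => ⌊s i / h⌋), c l := by
        congr 1
        rw [Finset.sum_comp (fun l => c l / n l) (fun i => ⌊s i / h⌋)]
        refine Finset.sum_congr rfl fun l hl => ?_
        obtain ⟨i, -, rfl⟩ := Finset.mem_image.1 hl
        rw [nsmul_eq_mul]
        exact mul_div_cancel₀ _ (hnpos i).ne'

/-- With ψ = c = 1 the binning bound counts the occupied bins, of which an interval of length b - a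
meets at most (b - a)/h + 2. -/
lemma sum_kernelWeight_diag_le {a b : ℝ} (hs : ∀ i, s i ∈ Set.Icc a b) (hab : a ≤ b) :
    ∑ i, kernelWeight h s i i ≤ 2 * ((b - a) / h + 2) := by
  have := sum_div_sum_phi_le hh s (fun _ => 1) (fun _ => 1) (fun _ => zero_le_one)
    (fun _ => le_rfl)
  simp only [kernelWeight, sub_self]
  simp only [mul_one] at this
  refine this.trans ?_
  gcongr
  rw [Finset.sum_const, nsmul_one]
  have hsub : Finset.univ.image (fun i => ⌊s i / h⌋) ⊆ Finset.Icc ⌊a / h⌋ ⌊b / h⌋ := by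
    intro l hl
    obtain ⟨i, -, rfl⟩ := Finset.mem_image.1 hl
    rw [Finset.mem_Icc]
    exact ⟨Int.floor_le_floor (by gcongr; exact (hs i).1),
      Int.floor_le_floor (by gcongr; exact (hs i).2)⟩
  have hcard := Finset.card_le_card hsub
  rw [Int.card_Icc] at hcard
  have h1 : ⌊a / h⌋ ≤ ⌊b / h⌋ := Int.floor_le_floor (by gcongr)
  have h2 : ((⌊b / h⌋ + 1 - ⌊a / h⌋).toNat : ℝ) = ⌊b / h⌋ + 1 - ⌊a / h⌋ := by
    have : ((⌊b / h⌋ + 1 - ⌊a / h⌋).toNat : ℤ) = ⌊b / h⌋ + 1 - ⌊a / h⌋ :=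
      Int.toNat_of_nonneg (by linarith)
    exact_mod_cast this
  have h3 : ((Finset.univ.image (fun i => ⌊s i / h⌋)).card : ℝ) ≤ ⌊b / h⌋ + 1 - ⌊a / h⌋ := by
    rw [← h2]; exact_mod_cast hcard
  rw [sub_div]
  linarith [Int.floor_le (b / h), Int.lt_floor_add_one (a / h)]

omit hh in
lemma summable_one_div_one_add_int_sq : Summable fun n : ℤ => 1 / (1 + (n : ℝ) ^ 2) := by
  refine Summable.of_norm_bounded_eventually (Real.summable_one_div_int_pow.2 one_lt_two) ?_
  filter_upwards [(Set.finite_singleton (0 : ℤ)).compl_mem_cofinite] with n hn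
  have : (n : ℝ) ≠ 0 := by exact_mod_cast hn
  rw [Real.norm_of_nonneg (by positivity)]
  gcongr
  linarith

/-- A bound for the column sums of the kernel weights. -/
def columnBound : ℝ := 20 * ∑' n : ℤ, 1 / (1 + (n : ℝ) ^ 2)

omit hh in
lemma columnBound_nonneg : 0 ≤ columnBound :=
  mul_nonneg (by norm_num) (tsum_nonneg fun _ => by positivity)

omit hh in
-- The denominator is chosen to dominate 1 + (t + 1)²: passing from a scaled distance to a
-- difference of bin indices costs at most 1.
lemma one_add_mul_exp_le (t : ℝ) :
    (1 + t) * Real.exp (-t ^ 2 / 2) ≤ 10 / (3 + 2 * t ^ 2) := by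
  rw [le_div_iff₀ (by positivity)]
  have h1 := Real.quadratic_le_exp_of_nonneg (show 0 ≤ t ^ 2 / 2 by positivity)
  have h2 : (1 + t) * (3 + 2 * t ^ 2) ≤ 10 * Real.exp (t ^ 2 / 2) := by
    nlinarith [sq_nonneg (t - 1), mul_nonneg (sq_nonneg t) (sq_nonneg (t - 1)), sq_nonneg t,
      mul_nonneg (sq_nonneg t) (sq_nonneg t)]
  calc (1 + t) * Real.exp (-t ^ 2 / 2) * (3 + 2 * t ^ 2)
      = (1 + t) * (3 + 2 * t ^ 2) * Real.exp (-t ^ 2 / 2) := by ring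
    _ ≤ 10 * Real.exp (t ^ 2 / 2) * Real.exp (-t ^ 2 / 2) := by gcongr
    _ = 10 := by rw [mul_assoc, ← Real.exp_add]; ring_nf; simp

/-- Only the rows are normalized, yet the columns are bounded too: binning leaves a profile of order
1/(1 + n²) in the bin distance n from unit j, which is summable over ℤ. The factor 1 + |s i - s j|/h
serves the plain and the distance-weighted column sums at once. -/
lemma sum_kernelWeight_column_le (j : Fin m) :
    ∑ i, kernelWeight h s i j * (1 + |s i - s j| / h) ≤ columnBound := by
  set c : ℤ → ℝ := fun l => 10 * (1 / (1 + ((l - ⌊s j / h⌋ : ℤ) : ℝ) ^ 2)) with hc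
  have key := sum_div_sum_phi_le hh s
    (fun i => (1 + |s i - s j| / h) * Real.exp (-(s i - s j) ^ 2 / (2 * h ^ 2))) c
    (fun l => by positivity) (fun i => by
      set t := |s i - s j| / h with ht
      have ht0 : 0 ≤ t := by positivity
      have e1 : -(s i - s j) ^ 2 / (2 * h ^ 2) = -t ^ 2 / 2 := by
        rw [ht, div_pow, sq_abs]; field_simp
      rw [e1]
      refine (one_add_mul_exp_le t).trans ?_
      simp only [hc, mul_one_div]
      have hd : |((⌊s i / h⌋ - ⌊s j / h⌋ : ℤ) : ℝ)| ≤ t + 1 := by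
        have : t = |s i / h - s j / h| := by rw [ht, ← sub_div, abs_div, abs_of_pos hh]
        rw [this]
        push_cast
        have := Int.floor_le (s i / h)
        have := Int.lt_floor_add_one (s i / h)
        have := Int.floor_le (s j / h)
        have := Int.lt_floor_add_one (s j / h)
        have := neg_abs_le (s i / h - s j / h)
        have := le_abs_self (s i / h - s j / h)
        rw [abs_le]; constructor <;> linarith
      refine div_le_div_of_nonneg_left (by norm_num) (by positivity) ?_
      rw [← sq_abs ((⌊s i / h⌋ - ⌊s j / h⌋ : ℤ) : ℝ)]
      nlinarith [abs_nonneg ((⌊s i / h⌋ - ⌊s j / h⌋ : ℤ) : ℝ), sq_nonneg (t - 1)])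
  calc ∑ i, kernelWeight h s i j * (1 + |s i - s j| / h)
      = ∑ i, phi h 0 * ((1 + |s i - s j| / h) * Real.exp (-(s i - s j) ^ 2 / (2 * h ^ 2))) /
          ∑ k, phi h (s i - s k) := by
        refine Finset.sum_congr rfl fun i _ => ?_
        rw [kernelWeight, phi_eq_phi_zero_mul (s i - s j)]; ring
    _ ≤ 2 * ∑ l ∈ Finset.univ.image (fun i => ⌊s i / h⌋), c l := key
    _ ≤ 2 * ∑' l, c l := by
        gcongr
        have hsum : Summable c := (((Equiv.subRight ⌊s j / h⌋).summable_iff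
          (f := fun n : ℤ => 1 / (1 + (n : ℝ) ^ 2))).2 summable_one_div_one_add_int_sq).mul_left 10
        exact hsum.sum_le_tsum _ fun l _ => by positivity
    _ = columnBound := by
        have := (Equiv.subRight ⌊s j / h⌋).tsum_eq (fun n : ℤ => 1 / (1 + (n : ℝ) ^ 2))
        simp only [Equiv.subRight_apply] at this
        rw [columnBound, hc, tsum_mul_left, this]
        ring

lemma sum_kernelWeight_left_le (j : Fin m) : ∑ i, kernelWeight h s i j ≤ columnBound := by
  refine le_trans (Finset.sum_le_sum fun i _ => ?_) (sum_kernelWeight_column_le hh s j)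
  refine le_mul_of_one_le_right (kernelWeight_nonneg hh s i j) ?_
  have : 0 ≤ |s i - s j| / h := by positivity
  linarith

lemma sum_kernelWeight_mul_dist_le (j : Fin m) :
    ∑ i, kernelWeight h s i j * |s i - s j| ≤ columnBound * h := by
  refine le_trans ?_ (mul_le_mul_of_nonneg_right (sum_kernelWeight_column_le hh s j) hh.le)
  rw [Finset.sum_mul]
  refine Finset.sum_le_sum fun i _ => ?_
  rw [mul_assoc, add_mul, div_mul_cancel₀ _ hh.ne']
  exact mul_le_mul_of_nonneg_left (by linarith) (kernelWeight_nonneg hh s i j)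

end Weights

/-! ### The law of the data -/

section Law

variable {gμ gσ : Measure ℝ} [IsProbabilityMeasure gμ] [IsProbabilityMeasure gσ] {p : ℝ}
  (hp0 : 0 < p) (hp1 : p < 1)

lemma lintegral_effectPrior {F : ℝ → ENNReal} (hF : Measurable F) :
    ∫⁻ u, F u ∂(effectPrior p gμ)
      = ENNReal.ofReal (1 - p) * F 0 + ENNReal.ofReal p * ∫⁻ u, F u ∂gμ := by
  rw [effectPrior, lintegral_add_measure, lintegral_smul_measure, lintegral_smul_measure,
    lintegral_dirac' _ hF, smul_eq_mul, smul_eq_mul]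

instance : IsFiniteMeasure (effectPrior p gμ) := by
  refine ⟨?_⟩
  simp [effectPrior]

include hp0 hp1 in
lemma isProbabilityMeasure_effectPrior : IsProbabilityMeasure (effectPrior p gμ) := by
  refine ⟨?_⟩
  have := lintegral_effectPrior (gμ := gμ) (p := p) (F := fun _ => 1) measurable_const
  rw [lintegral_one] at this
  rw [this, lintegral_one, measure_univ, mul_one, mul_one, ← ENNReal.ofReal_add (by linarith)
    hp0.le]
  simp

instance : IsMarkovKernel normalKernel :=
  ⟨fun q => by
    change IsProbabilityMeasure (gaussianReal q.1 q.2.toNNReal); infer_instance⟩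

lemma lintegral_unitLaw {F : (ℝ × ℝ) × ℝ → ENNReal} (hF : Measurable F) :
    ∫⁻ q, F q ∂(unitLaw p gμ gσ)
      = ∫⁻ v, ∫⁻ u, ∫⁻ x, F ((u, v), x) ∂(gaussianReal u v.toNNReal) ∂(effectPrior p gμ) ∂gσ := by
  rw [unitLaw, Measure.lintegral_compProd hF,
    lintegral_prod_symm _ (Measurable.aemeasurable hF.lintegral_kernel_prod_right')]
  rfl

lemma gaussianReal_eq_map (u v : ℝ) :
    gaussianReal u v.toNNReal = (gaussianReal 0 1).map fun z => u + √v * z := by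
  have : (fun z : ℝ => u + √v * z) = (fun y => u + y) ∘ fun z => √v * z := rfl
  rw [this, ← Measure.map_map (by fun_prop) (by fun_prop), gaussianReal_map_const_mul,
    gaussianReal_map_const_add]
  simp only [mul_zero, zero_add, mul_one]
  congr 1
  ext
  rcases le_total 0 v with h | h
  · simp [Real.sq_sqrt h, h]
  · simp [Real.sqrt_eq_zero_of_nonpos h, h]

/-- The law of the effect and of the standardized noise of a unit. -/
def noiseLaw (p : ℝ) (gμ : Measure ℝ) : Measure (ℝ × ℝ) :=
  (effectPrior p gμ).prod (gaussianReal 0 1)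

instance : SFinite (noiseLaw p gμ) := by unfold noiseLaw; infer_instance

include hp0 hp1 in
lemma isProbabilityMeasure_noiseLaw : IsProbabilityMeasure (noiseLaw p gμ) := by
  have := isProbabilityMeasure_effectPrior (gμ := gμ) hp0 hp1
  unfold noiseLaw; infer_instance

/-- The law of an observation with variance `v`. -/
def obsLaw (p : ℝ) (gμ : Measure ℝ) (v : ℝ) : Measure ℝ :=
  (noiseLaw p gμ).map fun e => e.1 + √v * e.2

include hp0 hp1 in
lemma isProbabilityMeasure_obsLaw (v : ℝ) : IsProbabilityMeasure (obsLaw p gμ v) := by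
  have := isProbabilityMeasure_noiseLaw (gμ := gμ) hp0 hp1
  exact Measure.isProbabilityMeasure_map (by fun_prop)

lemma lintegral_obsLaw (v : ℝ) {F : ℝ → ENNReal} (hF : Measurable F) :
    ∫⁻ x, F x ∂(obsLaw p gμ v)
      = ∫⁻ u, ∫⁻ x, F x ∂(gaussianReal u v.toNNReal) ∂(effectPrior p gμ) := by
  rw [obsLaw, lintegral_map hF (by fun_prop), noiseLaw, lintegral_prod _
    (Measurable.aemeasurable (by fun_prop))]
  refine lintegral_congr fun u => ?_
  rw [gaussianReal_eq_map, lintegral_map hF (by fun_prop)]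

lemma lintegral_gaussianReal {v : ℝ} (hv : 0 < v) (u : ℝ) {F : ℝ → ENNReal} (hF : Measurable F) :
    ∫⁻ x, F x ∂(gaussianReal u v.toNNReal) = ∫⁻ x, ENNReal.ofReal (phi √v (x - u)) * F x := by
  have hv' : v.toNNReal ≠ 0 := by simpa using hv
  rw [gaussianReal_of_var_ne_zero _ hv',
    lintegral_withDensity_eq_lintegral_mul _ (measurable_gaussianPDF _ _) hF]
  refine lintegral_congr fun x => ?_
  rw [Pi.mul_apply, gaussianPDF, phi_eq_gaussianPDFReal (Real.sqrt_pos.2 hv), Real.sq_sqrt hv.le]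

include hp0 hp1 in
lemma obsLaw_eq_withDensity {v : ℝ} (hv : 0 < v) :
    obsLaw p gμ v = volume.withDensity fun x => ENNReal.ofReal (fMix p gμ √v x) := by
  have hs := Real.sqrt_pos.2 hv
  refine Measure.ext_of_lintegral _ fun F hF => ?_
  rw [lintegral_obsLaw v hF, lintegral_withDensity_eq_lintegral_mul _ (by fun_prop) hF]
  simp_rw [lintegral_gaussianReal hv _ hF]
  rw [lintegral_lintegral_swap (Measurable.aemeasurable (by fun_prop))]
  refine lintegral_congr fun x => ?_
  rw [lintegral_mul_const _ (by fun_prop), Pi.mul_apply,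
    lintegral_effectPrior (by fun_prop), sub_zero,
    ← ofReal_integral_eq_lintegral_ofReal (integrable_phi_sub hs x)
      (Eventually.of_forall fun u => phi_nonneg hs.le _),
    ← ENNReal.ofReal_mul (by linarith), ← ENNReal.ofReal_mul hp0.le, ← ENNReal.ofReal_add
      (mul_nonneg (by linarith) (phi_nonneg hs.le _))
      (mul_nonneg hp0.le (integral_nonneg fun _ => phi_nonneg hs.le _))]
  rfl

/-- Writing X = μ + √V Z with (μ, Z) independent of V turns the compound law into the image of a
product measure, so that conditioning on the variances is Tonelli's theorem. -/
lemma map_unitLaw_eq :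
    (unitLaw p gμ gσ).map (fun q => (q.1.2, q.2))
      = (gσ.prod (noiseLaw p gμ)).map (fun w => (w.1, w.2.1 + √w.1 * w.2.2)) := by
  refine Measure.ext_of_lintegral _ fun F hF => ?_
  rw [lintegral_map hF (by fun_prop), lintegral_map hF (by fun_prop),
    lintegral_unitLaw (by fun_prop), lintegral_prod _ (Measurable.aemeasurable (by fun_prop))]
  refine lintegral_congr fun v => ?_
  rw [← lintegral_obsLaw v (F := fun x => F (v, x)) (by fun_prop), obsLaw,
    lintegral_map (f := fun x => F (v, x)) (by fun_prop) (by fun_prop)]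

include hp0 hp1 in
/-- The posterior probability of the null is the oracle statistic. -/
lemma lintegral_unitLaw_null (hg : gμ {0} = 0) (hpos : ∀ᵐ v ∂gσ, 0 < v)
    {F : ℝ × ℝ → ENNReal} (hF : Measurable F) :
    ∫⁻ q, Set.indicator {q | q.1.1 = 0} (fun q => F (q.1.2, q.2)) q ∂(unitLaw p gμ gσ)
      = ∫⁻ q, ENNReal.ofReal (oracleT p gμ q.2 √q.1.2) * F (q.1.2, q.2) ∂(unitLaw p gμ gσ) := by
  have hmeas : Measurable (Set.indicator {q : (ℝ × ℝ) × ℝ | q.1.1 = 0}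
      (fun q => F (q.1.2, q.2))) :=
    Measurable.indicator (by fun_prop) ((measurableSet_singleton (0 : ℝ)).preimage (by fun_prop))
  rw [lintegral_unitLaw hmeas, lintegral_unitLaw (by fun_prop)]
  refine lintegral_congr_ae (hpos.mono fun v hv => ?_)
  have hs := Real.sqrt_pos.2 hv
  dsimp only
  have hm2 : Measurable fun u : ℝ => ∫⁻ x, Set.indicator {q : (ℝ × ℝ) × ℝ | q.1.1 = 0}
      (fun q => F (q.1.2, q.2)) ((u, v), x) ∂(gaussianReal u v.toNNReal) := by
    have e := funext fun u => lintegral_gaussianReal hv u (hmeas.comp (by fun_prop :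
      Measurable fun x : ℝ => ((u, v), x)))
    simp only [Function.comp_def] at e
    rw [e]
    refine Measurable.lintegral_prod_right' (f := fun q : ℝ × ℝ =>
      ENNReal.ofReal (phi √v (q.2 - q.1)) * Set.indicator {q : (ℝ × ℝ) × ℝ | q.1.1 = 0}
      (fun q => F (q.1.2, q.2)) ((q.1, v), q.2)) ?_
    have := hmeas.comp (by fun_prop : Measurable fun q : ℝ × ℝ => ((q.1, v), q.2))
    simp only [Function.comp_def] at this
    fun_prop
  rw [lintegral_effectPrior hm2, ← lintegral_obsLaw v (F := fun x =>
    ENNReal.ofReal (oracleT p gμ x √v) * F (v, x)) (by fun_prop),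
    obsLaw_eq_withDensity hp0 hp1 hv,
    lintegral_withDensity_eq_lintegral_mul _ (by fun_prop) (by fun_prop)]
  have h0 : ∫⁻ u, ∫⁻ x, Set.indicator {q : (ℝ × ℝ) × ℝ | q.1.1 = 0}
      (fun q => F (q.1.2, q.2)) ((u, v), x) ∂(gaussianReal u v.toNNReal) ∂gμ = 0 := by
    rw [lintegral_eq_zero_iff hm2]
    have : ∀ᵐ u ∂gμ, u ≠ 0 := by
      rw [ae_iff]; simpa using hg
    filter_upwards [this] with u hu
    simp [hu]
  rw [h0, mul_zero, add_zero]
  simp only [Set.mem_ofPred_eq, Set.indicator_of_mem]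
  rw [lintegral_gaussianReal hv _ (F := fun x => F (v, x)) (by fun_prop),
    ← lintegral_const_mul _ (by fun_prop)]
  refine lintegral_congr fun x => ?_
  -- Bayes' formula `oracleT_mul_fMix` identifies the two integrands.
  rw [Pi.mul_apply, ← mul_assoc, ← mul_assoc, ← ENNReal.ofReal_mul (by linarith),
    ← ENNReal.ofReal_mul (fMix_pos hp0 hp1 hs x).le, mul_comm (fMix p gμ √v x),
    oracleT_mul_fMix hp0 hp1 hs, sub_zero, f0]

end Law

/-! ### Conditioning the sample on the variances -/

section Transfer

variable {Ω : Type*} [MeasurableSpace Ω] {P : Measure Ω} [IsProbabilityMeasure P]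
  {gμ gσ : Measure ℝ} [IsProbabilityMeasure gμ] [IsProbabilityMeasure gσ] {p : ℝ}
  (hp0 : 0 < p) (hp1 : p < 1) {μ V X : ℕ → Ω → ℝ} (hmodel : IsModel P p gμ gσ μ V X)
include hp0 hp1 hmodel

/-- Given the variances, the observations are independent with laws `obsLaw p gμ (v j)`. -/
lemma lintegral_data (m : ℕ) {F : (Fin m → ℝ) × (Fin m → ℝ) → ENNReal} (hF : Measurable F) :
    ∫⁻ ω, F (fun i => V i ω, fun i => X i ω) ∂P
      = ∫⁻ v, ∫⁻ x, F (v, x) ∂(Measure.pi fun j => obsLaw p gμ (v j))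
          ∂(Measure.pi fun _ : Fin m => gσ) := by
  have := isProbabilityMeasure_noiseLaw (gμ := gμ) hp0 hp1
  have hVm := hmodel.measurable_var
  have hXm := hmodel.measurable_obs
  have hind : iIndepFun (fun (i : Fin m) ω => (V i ω, X i ω)) P :=
    (hmodel.indep.precomp Fin.val_injective).comp (fun _ q => (q.1.2, q.2)) fun _ => by fun_prop
  have hlaw : ∀ i : Fin m, P.map (fun ω => (V i ω, X i ω))
      = (gσ.prod (noiseLaw p gμ)).map (fun w => (w.1, w.2.1 + √w.1 * w.2.2)) := fun i => by
    rw [← map_unitLaw_eq, ← hmodel.law i, Measure.map_map (by fun_prop)]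
    · rfl
    · have := hmodel.measurable_effect i
      fun_prop
  have hmap := hind.map_fun_eq_pi_map fun i => Measurable.aemeasurable (by fun_prop)
  simp_rw [hlaw] at hmap
  rw [← Measure.pi_map_pi (fun i => Measurable.aemeasurable (by fun_prop))] at hmap
  have e1 : ∫⁻ ω, F (fun i => V i ω, fun i => X i ω) ∂P
      = ∫⁻ y : Fin m → ℝ × ℝ, F (fun i => (y i).1, fun i => (y i).2)
        ∂(P.map fun ω (i : Fin m) => (V i ω, X i ω)) := by
    rw [lintegral_map (by fun_prop) (by fun_prop)]
  rw [e1, hmap, lintegral_map (by fun_prop) (by fun_prop)]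
  -- The array of pairs is regrouped as the array of variances and the array of noises, which are
  -- independent.
  have hmp := measurePreserving_arrowProdEquivProdArrow ℝ (ℝ × ℝ) (Fin m) (fun _ => gσ)
    (fun _ => noiseLaw p gμ)
  have e2 := hmp.lintegral_comp (f := fun z : (Fin m → ℝ) × (Fin m → ℝ × ℝ) =>
    F (z.1, fun i => (z.2 i).1 + √(z.1 i) * (z.2 i).2)) (by fun_prop)
  refine e2.trans ?_
  rw [lintegral_prod _ (Measurable.aemeasurable (by fun_prop))]
  refine lintegral_congr fun v => ?_
  have := fun j => isProbabilityMeasure_obsLaw (gμ := gμ) hp0 hp1 (v j)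
  have e3 : (Measure.pi fun j => obsLaw p gμ (v j)) = (Measure.pi fun _ : Fin m =>
      noiseLaw p gμ).map fun e j => (e j).1 + √(v j) * (e j).2 := by
    rw [Measure.pi_map_pi (f := fun j (e : ℝ × ℝ) => e.1 + √(v j) * e.2)
      (fun i => Measurable.aemeasurable (by fun_prop))]
    rfl
  rw [e3, lintegral_map (by fun_prop) (by fun_prop)]

end Transfer

/-! ### Second moments of centered kernel sums -/

section SecondMoment

variable {m : ℕ} {L : Fin m → Measure ℝ} [∀ j, IsProbabilityMeasure (L j)]

lemma integrable_of_abs_le {α : Type*} [MeasurableSpace α] {ν : Measure α} [IsFiniteMeasure ν]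
    {f : α → ℝ} (hf : Measurable f) {C : ℝ} (hC : ∀ a, |f a| ≤ C) : Integrable f ν :=
  Integrable.of_bound hf.aestronglyMeasurable C (Eventually.of_forall hC)

/-- The coordinate j is independent of the pair (i, k), so it can be integrated out first, where A
is centered. -/
lemma integral_pi_cross_eq_zero {i j k : Fin m} (hji : j ≠ i) (hjk : j ≠ k)
    {A B : ℝ → ℝ → ℝ} (hA : Measurable (Function.uncurry A)) (hB : Measurable (Function.uncurry B))
    {D : ℝ} (hAD : ∀ x y, |A x y| ≤ D) (hBD : ∀ x y, |B x y| ≤ D)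
    (hcent : ∀ x, ∫ y, A x y ∂(L j) = 0) :
    ∫ x, A (x i) (x j) * B (x i) (x k) ∂(Measure.pi L) = 0 := by
  have hind : iIndepFun (fun (l : Fin m) (x : Fin m → ℝ) => x l) (Measure.pi L) :=
    iIndepFun_pi (X := fun _ y => y) fun _ => aemeasurable_id
  have h2 := hind.indepFun_prodMk (fun l => measurable_pi_apply l) i k j hji.symm hjk.symm
  rw [indepFun_iff_map_prod_eq_prod_map_map (by fun_prop)
    (measurable_pi_apply j).aemeasurable, (measurePreserving_eval L j).map_eq] at h2
  have hA' : Measurable fun w : (ℝ × ℝ) × ℝ => A w.1.1 w.2 :=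
    hA.comp (by fun_prop : Measurable fun w : (ℝ × ℝ) × ℝ => (w.1.1, w.2))
  have hB' : Measurable fun w : (ℝ × ℝ) × ℝ => B w.1.1 w.1.2 :=
    hB.comp (by fun_prop : Measurable fun w : (ℝ × ℝ) × ℝ => (w.1.1, w.1.2))
  have hm : Measurable fun w : (ℝ × ℝ) × ℝ => A w.1.1 w.2 * B w.1.1 w.1.2 := hA'.mul hB'
  have e1 : ∫ x, A (x i) (x j) * B (x i) (x k) ∂(Measure.pi L)
      = ∫ w, A w.1.1 w.2 * B w.1.1 w.1.2 ∂((Measure.pi L).map fun x => ((x i, x k), x j)) := by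
    rw [integral_map (by fun_prop) hm.aestronglyMeasurable]
  have : IsProbabilityMeasure ((Measure.pi L).map fun x : Fin m → ℝ => (x i, x k)) :=
    Measure.isProbabilityMeasure_map (by fun_prop)
  have hb : ∀ w : (ℝ × ℝ) × ℝ, |A w.1.1 w.2 * B w.1.1 w.1.2| ≤ D * D := fun w => by
    rw [abs_mul]
    exact mul_le_mul (hAD _ _) (hBD _ _) (abs_nonneg _) ((abs_nonneg _).trans (hAD 0 0))
  rw [e1, h2, integral_prod _ (integrable_of_abs_le hm hb)]
  simp only [integral_mul_const, hcent, zero_mul, integral_zero]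

lemma integral_pi_pair_le {i j : Fin m} (hji : j ≠ i) {A : ℝ → ℝ → ℝ}
    (hA : Measurable (Function.uncurry A)) {D E : ℝ} (hAD : ∀ x y, |A x y| ≤ D)
    (hE : ∀ x, ∫ y, A x y ∂(L j) ≤ E) :
    ∫ x, A (x i) (x j) ∂(Measure.pi L) ≤ E := by
  have hind : iIndepFun (fun (l : Fin m) (x : Fin m → ℝ) => x l) (Measure.pi L) :=
    iIndepFun_pi (X := fun _ y => y) fun _ => aemeasurable_id
  have h2 := hind.indepFun hji.symm
  rw [indepFun_iff_map_prod_eq_prod_map_map (measurable_pi_apply i).aemeasurable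
    (measurable_pi_apply j).aemeasurable, (measurePreserving_eval L j).map_eq,
    (measurePreserving_eval L i).map_eq] at h2
  have hm : Measurable fun w : ℝ × ℝ => A w.1 w.2 := hA
  have e1 : ∫ x, A (x i) (x j) ∂(Measure.pi L)
      = ∫ w, A w.1 w.2 ∂((Measure.pi L).map fun x => (x i, x j)) := by
    rw [integral_map (by fun_prop) hm.aestronglyMeasurable]
  have h_int : Integrable (fun w : ℝ × ℝ => A w.1 w.2) ((L i).prod (L j)) :=
    integrable_of_abs_le hm fun w => hAD _ _
  rw [e1, h2, integral_prod _ h_int]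
  calc ∫ x, ∫ y, A x y ∂(L j) ∂(L i) ≤ ∫ _, E ∂(L i) :=
        integral_mono h_int.integral_prod_left (integrable_const _) hE
    _ = E := by simp

/-- A weighted sum of kernels that are centered in their second argument has uncorrelated terms. -/
lemma integral_sq_sum_le (i : Fin m) (c : Fin m → ℝ) {A : Fin m → ℝ → ℝ → ℝ}
    (hA : ∀ j, Measurable (Function.uncurry (A j))) {D E : ℝ} (hAD : ∀ j x y, |A j x y| ≤ D)
    (hcent : ∀ j x, ∫ y, A j x y ∂(L j) = 0) (hvar : ∀ j x, ∫ y, A j x y ^ 2 ∂(L j) ≤ E)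
    (hE : 0 ≤ E) :
    ∫ x, (∑ j ∈ Finset.univ.erase i, c j * A j (x i) (x j)) ^ 2 ∂(Measure.pi L)
      ≤ E * ∑ j, c j ^ 2 := by
  have hAm : ∀ j, Measurable fun x : Fin m → ℝ => A j (x i) (x j) := fun j =>
    (hA j).comp (by fun_prop : Measurable fun x : Fin m → ℝ => (x i, x j))
  have h_int : ∀ j k, Integrable (fun x : Fin m → ℝ => (c j * c k) *
      (A j (x i) (x j) * A k (x i) (x k))) (Measure.pi L) := fun j k => by
    refine (integrable_of_abs_le ((hAm j).mul (hAm k)) (C := D * D) fun x => ?_).const_mul _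
    rw [Pi.mul_apply, abs_mul]
    exact mul_le_mul (hAD _ _ _) (hAD _ _ _) (abs_nonneg _) ((abs_nonneg _).trans (hAD j 0 0))
  have e : ∀ x : Fin m → ℝ, (∑ j ∈ Finset.univ.erase i, c j * A j (x i) (x j)) ^ 2
      = ∑ j ∈ Finset.univ.erase i, ∑ k ∈ Finset.univ.erase i,
        (c j * c k) * (A j (x i) (x j) * A k (x i) (x k)) := fun x => by
    rw [sq, Finset.sum_mul_sum]
    exact Finset.sum_congr rfl fun j _ => Finset.sum_congr rfl fun k _ => by ring
  simp_rw [e]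
  rw [integral_finsetSum _ fun j _ => integrable_finsetSum _ fun k _ => h_int j k]
  calc ∑ j ∈ Finset.univ.erase i, ∫ x, ∑ k ∈ Finset.univ.erase i,
        (c j * c k) * (A j (x i) (x j) * A k (x i) (x k)) ∂(Measure.pi L)
      ≤ ∑ j ∈ Finset.univ.erase i, E * c j ^ 2 := by
        refine Finset.sum_le_sum fun j hj => ?_
        have hji : j ≠ i := (Finset.mem_erase.1 hj).1
        rw [integral_finsetSum _ fun k _ => h_int j k, Finset.sum_eq_single_of_mem j hj]
        · rw [integral_const_mul, mul_comm, ← sq]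
          refine mul_le_mul_of_nonneg_right ?_ (sq_nonneg _)
          refine integral_pi_pair_le (A := fun x y => A j x y * A j x y) hji
            ((hA j).mul (hA j)) (D := D * D) (fun x y => ?_) fun x => ?_
          · rw [abs_mul]
            exact mul_le_mul (hAD _ _ _) (hAD _ _ _) (abs_nonneg _)
              ((abs_nonneg _).trans (hAD j 0 0))
          · simpa only [sq] using hvar j x
        · intro k _ hkj
          rw [integral_const_mul, integral_pi_cross_eq_zero hji hkj.symm (hA j) (hA k) (hAD j)
            (hAD k) (hcent j), mul_zero]
    _ ≤ ∑ j, E * c j ^ 2 := Finset.sum_le_sum_of_subset_of_nonneg (Finset.erase_subset _ _)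
        fun j _ _ => mul_nonneg hE (sq_nonneg _)
    _ = _ := by rw [Finset.mul_sum]

end SecondMoment

/-! ### Centered kernel sums in the model -/

section CenteredSum

variable {gμ gσ : Measure ℝ} [IsProbabilityMeasure gμ] [IsProbabilityMeasure gσ] {p : ℝ}
  (hp0 : 0 < p) (hp1 : p < 1) {m : ℕ}

/-- The conditional mean of `H vᵢ vⱼ xᵢ Xⱼ`. -/
def kernelMean (p : ℝ) (gμ : Measure ℝ) (H : ℝ → ℝ → ℝ → ℝ → ℝ) (u w x : ℝ) : ℝ :=
  ∫ y, H u w x y ∂(obsLaw p gμ w)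

/-- The centered kernel sum at the `i`-th unit. -/
def centeredSum (p : ℝ) (gμ : Measure ℝ) (H : ℝ → ℝ → ℝ → ℝ → ℝ)
    (c : (Fin m → ℝ) → Fin m → Fin m → ℝ) (v x : Fin m → ℝ) (i : Fin m) : ℝ :=
  ∑ j ∈ Finset.univ.erase i,
    c v i j * (H (v i) (v j) (x i) (x j) - kernelMean p gμ H (v i) (v j) (x i))

variable {H : ℝ → ℝ → ℝ → ℝ → ℝ}
  (hH : Measurable fun q : (ℝ × ℝ) × (ℝ × ℝ) => H q.1.1 q.1.2 q.2.1 q.2.2)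
include hH

/-- The measure `obsLaw p gμ w` moves with the parameter; pulling the integral back to the fixed
`noiseLaw` makes joint measurability a Fubini statement. -/
lemma measurable_kernelMean {α : Type*} [MeasurableSpace α] {f g k : α → ℝ} (hf : Measurable f)
    (hg : Measurable g) (hk : Measurable k) :
    Measurable fun a => kernelMean p gμ H (f a) (g a) (k a) := by
  have e : ∀ a, kernelMean p gμ H (f a) (g a) (k a)
      = ∫ e, H (f a) (g a) (k a) (e.1 + √(g a) * e.2) ∂(noiseLaw p gμ) := fun a => by
    rw [kernelMean, obsLaw, integral_map (by fun_prop)]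
    exact (hH.comp (by fun_prop : Measurable fun y : ℝ =>
      ((f a, g a), (k a, y)))).aestronglyMeasurable
  simp_rw [e]
  have : StronglyMeasurable fun q : α × (ℝ × ℝ) =>
      H (f q.1) (g q.1) (k q.1) (q.2.1 + √(g q.1) * q.2.2) :=
    (hH.comp (by fun_prop : Measurable fun q : α × (ℝ × ℝ) =>
      ((f q.1, g q.1), (k q.1, q.2.1 + √(g q.1) * q.2.2)))).stronglyMeasurable
  exact this.integral_prod_right.measurable

lemma measurable_centeredSum {c : (Fin m → ℝ) → Fin m → Fin m → ℝ}
    (hc : ∀ i j, Measurable fun v => c v i j) (i : Fin m) :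
    Measurable fun q : (Fin m → ℝ) × (Fin m → ℝ) => centeredSum p gμ H c q.1 q.2 i := by
  unfold centeredSum
  refine Finset.measurable_sum _ fun j _ => ?_
  refine ((hc i j).comp measurable_fst).mul (Measurable.sub ?_ ?_)
  · exact hH.comp (by fun_prop : Measurable fun q : (Fin m → ℝ) × (Fin m → ℝ) =>
      ((q.1 i, q.1 j), (q.2 i, q.2 j)))
  · exact measurable_kernelMean hH (by fun_prop) (by fun_prop) (by fun_prop)

include hp0 hp1

/-- From 0 ≤ H ≤ D follows H² ≤ D H, so each variance is at most D times a conditional mean. The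
means stay bounded as the bandwidth shrinks, so only one factor D, of order 1/h_x, is lost instead
of D². -/
lemma lintegral_sq_centeredSum_pi_le (c : (Fin m → ℝ) → Fin m → Fin m → ℝ) (v : Fin m → ℝ)
    {D B : ℝ} (hD : ∀ i j x y, H (v i) (v j) x y ∈ Set.Icc 0 D)
    (hB : ∀ i j x, kernelMean p gμ H (v i) (v j) x ≤ B) (hB0 : 0 ≤ B) (hD0 : 0 ≤ D) (i : Fin m) :
    ∫⁻ x, ENNReal.ofReal (centeredSum p gμ H c v x i ^ 2)
        ∂(Measure.pi fun j => obsLaw p gμ (v j))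
      ≤ ENNReal.ofReal (D * B * ∑ j, c v i j ^ 2) := by
  have := fun j => isProbabilityMeasure_obsLaw (gμ := gμ) hp0 hp1 (v j)
  have hHm : ∀ j, Measurable fun q : ℝ × ℝ => H (v i) (v j) q.1 q.2 := fun j =>
    hH.comp (by fun_prop : Measurable fun q : ℝ × ℝ => ((v i, v j), (q.1, q.2)))
  have hHy : ∀ j x, Integrable (fun y => H (v i) (v j) x y) (obsLaw p gμ (v j)) := fun j x =>
    integrable_of_abs_le (C := D) ((hHm j).comp (by fun_prop : Measurable fun y : ℝ => (x, y)))
      fun y => by rw [abs_of_nonneg (hD i j x y).1]; exact (hD i j x y).2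
  have hK : ∀ j x, kernelMean p gμ H (v i) (v j) x ∈ Set.Icc 0 D := fun j x => by
    refine ⟨integral_nonneg fun y => (hD i j x y).1, ?_⟩
    calc kernelMean p gμ H (v i) (v j) x ≤ ∫ _, D ∂(obsLaw p gμ (v j)) :=
          integral_mono (hHy j x) (integrable_const _) fun y => (hD i j x y).2
      _ = D := by simp
  set A : Fin m → ℝ → ℝ → ℝ := fun j x y =>
    H (v i) (v j) x y - kernelMean p gμ H (v i) (v j) x with hAdef
  have hA : ∀ j, Measurable (Function.uncurry (A j)) := fun j =>
    (hHm j).sub (measurable_kernelMean hH (by fun_prop) (by fun_prop) (by fun_prop))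
  have hAD : ∀ j x y, |A j x y| ≤ D := fun j x y => by
    have h1 := hD i j x y
    have h2 := hK j x
    rw [abs_le]
    exact ⟨by linarith [h1.1, h2.2], by linarith [h1.2, h2.1]⟩
  have hcent : ∀ j x, ∫ y, A j x y ∂(obsLaw p gμ (v j)) = 0 := fun j x => by
    simp only [hAdef]
    rw [integral_sub (hHy j x) (integrable_const _)]
    simp [kernelMean]
  have hAy : ∀ j x, Integrable (fun y => A j x y) (obsLaw p gμ (v j)) := fun j x =>
    (hHy j x).sub (integrable_const _)
  have hvar : ∀ j x, ∫ y, A j x y ^ 2 ∂(obsLaw p gμ (v j)) ≤ D * B := fun j x => by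
    set k := kernelMean p gμ H (v i) (v j) x with hk
    have hk0 := hK j x
    calc ∫ y, A j x y ^ 2 ∂(obsLaw p gμ (v j))
        ≤ ∫ y, (D * H (v i) (v j) x y - 2 * k * A j x y) ∂(obsLaw p gμ (v j)) := by
          refine integral_mono_of_nonneg (Eventually.of_forall fun y => sq_nonneg _)
            (((hHy j x).const_mul D).sub ((hAy j x).const_mul (2 * k)))
            (Eventually.of_forall fun y => ?_)
          have h1 := hD i j x y
          simp only [hAdef, ← hk]
          nlinarith [mul_nonneg h1.1 (sub_nonneg.2 h1.2), sq_nonneg k]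
      _ = D * k := by
          rw [integral_sub ((hHy j x).const_mul D) ((hAy j x).const_mul (2 * k)),
            integral_const_mul, integral_const_mul, hcent, mul_zero, sub_zero]
          rfl
      _ ≤ D * B := mul_le_mul_of_nonneg_left (hB i j x) hD0
  have key := integral_sq_sum_le (L := fun j => obsLaw p gμ (v j)) i (c v i) hA hAD hcent hvar
    (mul_nonneg hD0 hB0)
  have hmeas : Measurable fun x : Fin m → ℝ => centeredSum p gμ H c v x i := by
    refine Finset.measurable_sum _ fun j _ => Measurable.const_mul ?_ _
    exact (hA j).comp (by fun_prop : Measurable fun x : Fin m → ℝ => (x i, x j))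
  have h_int : Integrable (fun x : Fin m → ℝ => centeredSum p gμ H c v x i ^ 2)
      (Measure.pi fun j => obsLaw p gμ (v j)) := by
    refine integrable_of_abs_le (hmeas.pow_const 2) (C := (∑ j, |c v i j| * D) ^ 2) fun x => ?_
    rw [abs_pow]
    gcongr
    calc |centeredSum p gμ H c v x i|
        ≤ ∑ j ∈ Finset.univ.erase i, |c v i j * A j (x i) (x j)| := Finset.abs_sum_le_sum_abs _ _
      _ ≤ ∑ j ∈ Finset.univ.erase i, |c v i j| * D := by
          refine Finset.sum_le_sum fun j _ => ?_
          rw [abs_mul]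
          exact mul_le_mul_of_nonneg_left (hAD _ _ _) (abs_nonneg _)
      _ ≤ ∑ j, |c v i j| * D := Finset.sum_le_sum_of_subset_of_nonneg (Finset.erase_subset _ _)
          fun j _ _ => mul_nonneg (abs_nonneg _) hD0
  rw [← ofReal_integral_eq_lintegral_ofReal h_int (Eventually.of_forall fun x => sq_nonneg _)]
  exact ENNReal.ofReal_le_ofReal key

omit hp0 hp1 hH in
lemma ae_pi_of_ae {Q : ℝ → Prop} (h : ∀ᵐ v ∂gσ, Q v) :
    ∀ᵐ v ∂(Measure.pi fun _ : Fin m => gσ), ∀ i, Q (v i) :=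
  ae_all_iff.2 fun i => (measurePreserving_eval (fun _ : Fin m => gσ) i).quasiMeasurePreserving.ae h

variable {Ω : Type*} [MeasurableSpace Ω] {P : Measure Ω} [IsProbabilityMeasure P]
  {μ V X : ℕ → Ω → ℝ} (hmodel : IsModel P p gμ gσ μ V X)
include hmodel

/-- Bound for the second moments of the centered kernel sums, averaged over the units. -/
lemma sum_lintegral_sq_centeredSum_le {c : (Fin m → ℝ) → Fin m → Fin m → ℝ}
    (hc : ∀ i j, Measurable fun v => c v i j) {S : Set ℝ} (hS : ∀ᵐ v ∂gσ, v ∈ S) {D B K : ℝ}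
    (hD : ∀ u ∈ S, ∀ w ∈ S, ∀ x y, H u w x y ∈ Set.Icc 0 D)
    (hB : ∀ u ∈ S, ∀ w ∈ S, ∀ x, kernelMean p gμ H u w x ≤ B) (hB0 : 0 ≤ B) (hD0 : 0 ≤ D)
    (hK : ∀ v : Fin m → ℝ, (∀ i, v i ∈ S) → ∑ i, ∑ j, c v i j ^ 2 ≤ K) :
    ∑ i : Fin m, ∫⁻ ω, ENNReal.ofReal (centeredSum p gμ H c (fun i => V i ω) (fun i => X i ω) i ^ 2)
      ∂P ≤ ENNReal.ofReal (D * B * K) := by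
  have hm : ∀ i, Measurable fun q : (Fin m → ℝ) × (Fin m → ℝ) =>
      ENNReal.ofReal (centeredSum p gμ H c q.1 q.2 i ^ 2) := fun i =>
    ((measurable_centeredSum hH hc i).pow_const 2).ennreal_ofReal
  have hVm := hmodel.measurable_var
  have hXm := hmodel.measurable_obs
  have hm' := fun i => (hm i).comp (by fun_prop :
    Measurable fun ω => ((fun i : Fin m => V i ω), fun i : Fin m => X i ω))
  simp only [Function.comp_def] at hm'
  rw [← lintegral_finsetSum _ fun i _ => hm' i,
    lintegral_data hp0 hp1 hmodel m (F := fun q => ∑ i, ENNReal.ofReal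
    (centeredSum p gμ H c q.1 q.2 i ^ 2)) (Finset.measurable_sum _ fun i _ => hm i)]
  calc _ ≤ ∫⁻ _, ENNReal.ofReal (D * B * K) ∂(Measure.pi fun _ : Fin m => gσ) := by
        refine lintegral_mono_ae ((ae_pi_of_ae hS).mono fun v hv => ?_)
        dsimp only
        have hm' := fun i => (hm i).comp (by fun_prop : Measurable fun x : Fin m → ℝ => (v, x))
        simp only [Function.comp_def] at hm'
        rw [lintegral_finsetSum _ fun i _ => hm' i]
        calc _ ≤ ∑ i, ENNReal.ofReal (D * B * ∑ j, c v i j ^ 2) :=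
              Finset.sum_le_sum fun i _ => lintegral_sq_centeredSum_pi_le hp0 hp1 hH c v
                (fun i j => hD _ (hv i) _ (hv j)) (fun i j => hB _ (hv i) _ (hv j)) hB0 hD0 i
          _ = ENNReal.ofReal (D * B * ∑ i, ∑ j, c v i j ^ 2) := by
              rw [← ENNReal.ofReal_sum_of_nonneg fun i _ => mul_nonneg (mul_nonneg hD0 hB0)
                (Finset.sum_nonneg fun j _ => sq_nonneg _), Finset.mul_sum]
          _ ≤ _ := by
              gcongr
              exact hK v hv
    _ = _ := by simp

end CenteredSum

/-! ### Negligible triangular arrays -/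

section Negligible

variable {Ω : Type*} [MeasurableSpace Ω] {P : Measure Ω} [IsProbabilityMeasure P]

/-- The triangular array `a` tends to zero in probability, on average over the units. -/
def Negligible (P : Measure Ω) (a : (m : ℕ) → Fin m → Ω → ℝ) : Prop :=
  ∀ ε > 0, Tendsto (fun m : ℕ => (∑ i, P.real {ω | ε < a m i ω}) / m) atTop (𝓝 0)

variable {a b : (m : ℕ) → Fin m → Ω → ℝ}

lemma average_nonneg (ε : ℝ) (m : ℕ) : 0 ≤ (∑ i, P.real {ω | ε < a m i ω}) / m :=
  div_nonneg (Finset.sum_nonneg fun _ _ => measureReal_nonneg) (Nat.cast_nonneg m)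

lemma sum_div_le_add {m : ℕ} {f g : Fin m → ℝ} {η : ℝ} (hη : 0 ≤ η) (h : ∀ i, f i ≤ g i + η) :
    (∑ i, f i) / m ≤ (∑ i, g i) / m + η := by
  rcases m.eq_zero_or_pos with rfl | hm
  · simpa using hη
  have hm' : (0 : ℝ) < m := by exact_mod_cast hm
  rw [div_add' _ _ _ hm'.ne', div_le_div_iff_of_pos_right hm']
  calc ∑ i, f i ≤ ∑ i, (g i + η) := Finset.sum_le_sum fun i _ => h i
    _ = ∑ i, g i + η * m := by simp [Finset.sum_add_distrib, mul_comm]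

lemma tendsto_zero_of_le_add {f : ℕ → ℝ} (h0 : ∀ m, 0 ≤ f m)
    (h : ∀ η > 0, ∃ g : ℕ → ℝ, Tendsto g atTop (𝓝 0) ∧ ∀ᶠ m in atTop, f m ≤ g m + η) :
    Tendsto f atTop (𝓝 0) := by
  refine tendsto_order.2 ⟨fun c hc => Eventually.of_forall fun m => hc.trans_le (h0 m),
    fun c hc => ?_⟩
  obtain ⟨g, hg, hle⟩ := h (c / 2) (by linarith)
  filter_upwards [hle, hg.eventually_lt_const (show 0 < c / 2 by linarith)] with m h1 h2
  linarith

/-- The comparison array and δ may depend on ε and η, so at each accuracy an exceptional event of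
probability η may be discarded; tightness and the absence of atoms enter in this form. -/
lemma Negligible.of_approx
    (h : ∀ ε > 0, ∀ η > 0, ∃ b, Negligible P b ∧ ∃ δ > 0, ∀ᶠ m in atTop, ∀ i,
      P.real {ω | ε < a m i ω} ≤ P.real {ω | δ < b m i ω} + η) : Negligible P a := by
  intro ε hε
  refine tendsto_zero_of_le_add (average_nonneg ε) fun η hη => ?_
  obtain ⟨b, hb, δ, hδ, hle⟩ := h ε hε η hη
  exact ⟨_, hb δ hδ, hle.mono fun m hm => sum_div_le_add hη.le hm⟩

lemma Negligible.of_imp (hb : Negligible P b)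
    (h : ∀ ε > 0, ∃ δ > 0, ∀ᶠ m in atTop, ∀ i, ∀ᵐ ω ∂P, b m i ω ≤ δ → a m i ω ≤ ε) :
    Negligible P a := by
  refine Negligible.of_approx fun ε hε η hη => ⟨b, hb, ?_⟩
  obtain ⟨δ, hδ, hle⟩ := h ε hε
  refine ⟨δ, hδ, hle.mono fun m hm i => ?_⟩
  have : P.real {ω | ε < a m i ω} ≤ P.real {ω | δ < b m i ω} := by
    refine ENNReal.toReal_mono (measure_ne_top _ _) (measure_mono_ae ?_)
    filter_upwards [hm i] with ω hω h1
    by_contra h2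
    exact absurd h1 (not_lt.2 (hω (not_lt.1 h2)))
  linarith

lemma Negligible.mono (hb : Negligible P b)
    (h : ∀ᶠ m in atTop, ∀ i, ∀ᵐ ω ∂P, a m i ω ≤ b m i ω) : Negligible P a :=
  hb.of_imp fun ε hε => ⟨ε, hε, h.mono fun _ hm i => (hm i).mono fun _ hω h1 => hω.trans h1⟩

lemma Negligible.add (ha : Negligible P a) (hb : Negligible P b) :
    Negligible P fun m i ω => a m i ω + b m i ω := by
  intro ε hε
  have := (ha (ε / 2) (by linarith)).add (hb (ε / 2) (by linarith))
  rw [add_zero] at this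
  refine squeeze_zero (average_nonneg ε) (fun m => ?_) this
  rw [← add_div, ← Finset.sum_add_distrib]
  gcongr with i
  refine le_trans (measureReal_mono fun ω hω => ?_) (measureReal_union_le _ _)
  simp only [Set.mem_union, Set.mem_ofPred_eq] at hω ⊢
  by_contra! hcon
  linarith

lemma Negligible.const_mul (ha : Negligible P a) {c : ℝ} (hc : 0 < c) :
    Negligible P fun m i ω => c * a m i ω :=
  ha.of_imp fun ε hε => ⟨ε / c, by positivity, Eventually.of_forall fun m i =>
    Eventually.of_forall fun ω h => by rw [le_div_iff₀ hc] at h; linarith⟩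

lemma Negligible.mul_tight (ha : Negligible P a) {c : ℕ → Ω → ℝ}
    (hc0 : ∀ i ω, 0 ≤ c i ω) (hc : ∀ η > 0, ∃ K > 0, ∀ i, P.real {ω | K < c i ω} ≤ η) :
    Negligible P fun m i ω => a m i ω * c i ω := by
  refine Negligible.of_approx fun ε hε η hη => ⟨a, ha, ?_⟩
  obtain ⟨K, hK, hle⟩ := hc η hη
  refine ⟨ε / K, by positivity, Eventually.of_forall fun m i => ?_⟩
  refine le_trans (le_trans (measureReal_mono (s₂ := {ω | ε / K < a m i ω} ∪ {ω | K < c i ω})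
    fun ω hω => ?_) (measureReal_union_le _ _)) (add_le_add_right (hle i) _)
  simp only [Set.mem_union, Set.mem_ofPred_eq] at hω ⊢
  by_contra! hcon
  have : a m i ω * c i ω ≤ ε / K * K := mul_le_mul hcon.1 hcon.2 (hc0 _ _) (by positivity)
  rw [div_mul_cancel₀ _ hK.ne'] at this
  linarith

/-- Markov's inequality for each unit. Extended integrals spare any integrability check for the
array. -/
lemma Negligible.of_lintegral (hm : ∀ m i, Measurable (a m i)) {κ : ℕ → ℝ}
    (hκ : Tendsto κ atTop (𝓝 0))
    (h : ∀ᶠ m : ℕ in atTop, ∑ i, ∫⁻ ω, ENNReal.ofReal (a m i ω) ∂P ≤ ENNReal.ofReal (m * κ m)) :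
    Negligible P a := by
  intro ε hε
  have hκ' : Tendsto (fun m => |κ m| / ε) atTop (𝓝 0) := by
    simpa using (hκ.abs.div_const ε)
  refine squeeze_zero' (Eventually.of_forall (average_nonneg ε)) ?_ hκ'
  filter_upwards [h, eventually_gt_atTop 0] with m hle hm0
  have hm0' : (0 : ℝ) < m := by exact_mod_cast hm0
  rw [div_le_iff₀ hm0']
  have h1 : ∑ i, P {ω | ε < a m i ω} ≤ ENNReal.ofReal (m * κ m) / ENNReal.ofReal ε := by
    refine le_trans (Finset.sum_le_sum fun i _ => ?_)
      (le_trans (le_of_eq (Finset.sum_mul _ _ _).symm)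
      (by rw [div_eq_mul_inv]; exact mul_le_mul_left hle (ENNReal.ofReal ε)⁻¹))
    rw [← div_eq_mul_inv]
    refine le_trans (measure_mono fun ω hω => ?_) (meas_ge_le_lintegral_div
      (hm m i).ennreal_ofReal.aemeasurable (by simpa using hε) ENNReal.ofReal_ne_top)
    exact ENNReal.ofReal_le_ofReal (le_of_lt hω)
  have h2 : ∑ i, P.real {ω | ε < a m i ω} = (∑ i, P {ω | ε < a m i ω}).toReal := by
    rw [ENNReal.toReal_sum fun i _ => measure_ne_top _ _]; rfl
  rw [h2]
  refine le_trans (ENNReal.toReal_mono ?_ h1) ?_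
  · exact ENNReal.div_ne_top ENNReal.ofReal_ne_top (by simpa using hε)
  · rw [ENNReal.toReal_div, ENNReal.toReal_ofReal hε.le, ENNReal.toReal_ofReal']
    rw [div_mul_eq_mul_div]
    gcongr
    exact max_le (by rw [mul_comm]; gcongr; exact le_abs_self _) (by positivity)

lemma Negligible.of_ae_sum_le (hm : ∀ m i, Measurable (a m i))
    (h0 : ∀ m i, ∀ᵐ ω ∂P, 0 ≤ a m i ω) {κ : ℕ → ℝ} (hκ : Tendsto κ atTop (𝓝 0))
    (h : ∀ᶠ m : ℕ in atTop, ∀ᵐ ω ∂P, ∑ i, a m i ω ≤ m * κ m) : Negligible P a := by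
  refine Negligible.of_lintegral hm hκ (h.mono fun m hle => ?_)
  rw [← lintegral_finsetSum _ fun i _ => (hm m i).ennreal_ofReal]
  calc _ ≤ ∫⁻ _, ENNReal.ofReal (m * κ m) ∂P := by
        refine lintegral_mono_ae ?_
        filter_upwards [hle, ae_all_iff.2 (h0 m)] with ω h1 h2
        rw [← ENNReal.ofReal_sum_of_nonneg fun i _ => h2 i]
        exact ENNReal.ofReal_le_ofReal h1
    _ = _ := by simp

lemma Negligible.of_tendstoInMeasure {f : ℕ → Ω → ℝ} {c : ℝ}
    (hf : TendstoInMeasure P f atTop (fun _ => c)) :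
    Negligible P fun m _ ω => |f m ω - c| := by
  intro ε hε
  have h1 : Tendsto (fun m => P.real {ω | ε ≤ |f m ω - c|}) atTop (𝓝 0) := by
    have := tendstoInMeasure_iff_dist.1 hf ε hε
    simpa [Measure.real, Real.dist_eq, Function.comp_def] using (ENNReal.tendsto_toReal ENNReal.zero_ne_top).comp this
  refine squeeze_zero' (Eventually.of_forall fun m => div_nonneg
    (Finset.sum_nonneg fun _ _ => measureReal_nonneg) (Nat.cast_nonneg m)) ?_ h1
  filter_upwards [eventually_gt_atTop 0] with m hm0
  have hm0' : (0 : ℝ) < m := by exact_mod_cast hm0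
  rw [Finset.sum_const, Finset.card_univ, Fintype.card_fin, nsmul_eq_mul,
    mul_div_cancel_left₀ _ hm0'.ne']
  refine measureReal_mono fun ω hω => ?_
  simp only [Set.mem_ofPred_eq] at hω ⊢
  exact hω.le

/-- A negligible array with values in `[0, 1]` is negligible in mean. -/
lemma Negligible.tendsto_integral (ha : Negligible P a) (hm : ∀ m i, Measurable (a m i))
    (h01 : ∀ m i ω, a m i ω ∈ Set.Icc (0 : ℝ) 1) :
    Tendsto (fun m : ℕ => (∑ i, ∫ ω, a m i ω ∂P) / m) atTop (𝓝 0) := by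
  refine tendsto_zero_of_le_add (fun m => div_nonneg (Finset.sum_nonneg fun i _ =>
    integral_nonneg fun ω => (h01 m i ω).1) (Nat.cast_nonneg m)) fun η hη => ?_
  refine ⟨_, ha η hη, Eventually.of_forall fun m => sum_div_le_add hη.le fun i => ?_⟩
  have hset : MeasurableSet {ω | η < a m i ω} := measurableSet_lt measurable_const (hm m i)
  have hind : Integrable (Set.indicator {ω | η < a m i ω} fun _ => (1 : ℝ)) P :=
    (integrable_const 1).indicator hset
  calc ∫ ω, a m i ω ∂P
      ≤ ∫ ω, (Set.indicator {ω | η < a m i ω} (fun _ => (1 : ℝ)) ω + η) ∂P := by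
        refine integral_mono_of_nonneg (Eventually.of_forall fun ω => (h01 m i ω).1)
          (hind.add (integrable_const η)) (Eventually.of_forall fun ω => ?_)
        by_cases h : η < a m i ω
        · simp only [Set.indicator, Set.mem_ofPred_eq, h, if_true]
          linarith [(h01 m i ω).2]
        · simp only [Set.indicator, Set.mem_ofPred_eq, h, if_false]
          linarith
    _ = P.real {ω | η < a m i ω} + η := by
        rw [integral_add hind (integrable_const η), integral_indicator_const _ hset]
        simp

end Negligible

/-! ### Conditional means of the kernels -/

section KernelMean

variable {gμ : Measure ℝ} [IsProbabilityMeasure gμ] {p : ℝ} (hp0 : 0 < p) (hp1 : p < 1)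
include hp0 hp1

lemma integral_obsLaw {v : ℝ} (hv : 0 < v) (F : ℝ → ℝ) :
    ∫ y, F y ∂(obsLaw p gμ v) = ∫ y, fMix p gμ √v y * F y := by
  rw [obsLaw_eq_withDensity hp0 hp1 hv, integral_withDensity_eq_integral_toReal_smul
    (by fun_prop) (Eventually.of_forall fun _ => ENNReal.ofReal_lt_top)]
  refine integral_congr_ae (Eventually.of_forall fun y => ?_)
  dsimp only
  rw [ENNReal.toReal_ofReal (fMix_pos hp0 hp1 (Real.sqrt_pos.2 hv) y).le, smul_eq_mul]

/-- The kernel of the density estimates, with an additional weight `g`. -/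
def smoothingKernel (h : ℝ) (g : ℝ → ℝ → ℝ) (_ w x y : ℝ) : ℝ := g w y * phi (h * √w) (x - y)

/-- The kernel of the density estimates, as a function of the estimation point. -/
def columnKernel (h u _ x y : ℝ) : ℝ := phi (h * √u) (y - x)

/-- Since the kernel integrates to 1, the bias is the integral of R w y - R u x against it; the
Lipschitz bound and the mean absolute deviation h√w of the kernel finish. First order in h is
enough, as no rate is claimed. -/
lemma kernelMean_smoothingKernel_sub_le {h : ℝ} (hh : 0 < h) {g R : ℝ → ℝ → ℝ} {u w C L x : ℝ}
    (hw : 0 < w) (hR : ∀ y, fMix p gμ √w y * g w y = R w y) (hRm : Measurable (R w))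
    (hC : ∀ y, |R w y| ≤ C) (hL0 : 0 ≤ L)
    (hL : ∀ y, |R w y - R u x| ≤ L * (|√u - √w| + |x - y|)) :
    |kernelMean p gμ (smoothingKernel h g) u w x - R u x| ≤ L * (|√u - √w| + h * √w) := by
  have hσ : 0 < h * √w := mul_pos hh (Real.sqrt_pos.2 hw)
  have iφ := integrable_phi hσ x
  obtain ⟨ia, ea⟩ := integral_abs_mul_phi hσ x
  have iR : Integrable fun y => R w y * phi (h * √w) (x - y) := by
    refine (iφ.const_mul C).mono' (Measurable.aestronglyMeasurable (by fun_prop))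
      (Eventually.of_forall fun y => ?_)
    rw [norm_mul, Real.norm_of_nonneg (phi_nonneg hσ.le _)]
    exact mul_le_mul_of_nonneg_right (hC y) (phi_nonneg hσ.le _)
  have e1 : kernelMean p gμ (smoothingKernel h g) u w x - R u x
      = ∫ y, (R w y - R u x) * phi (h * √w) (x - y) := by
    simp_rw [sub_mul]
    rw [integral_sub iR (iφ.const_mul _), integral_const_mul, integral_phi hσ, mul_one,
      kernelMean, integral_obsLaw hp0 hp1 hw]
    congr 1
    refine integral_congr_ae (Eventually.of_forall fun y => ?_)
    simp only [smoothingKernel, ← hR y]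
    ring
  rw [e1]
  have ib : Integrable fun y => L * |√u - √w| * phi (h * √w) (x - y)
      + L * (|x - y| * phi (h * √w) (x - y)) := (iφ.const_mul _).add (ia.const_mul L)
  calc |∫ y, (R w y - R u x) * phi (h * √w) (x - y)|
      ≤ ∫ y, (L * |√u - √w| * phi (h * √w) (x - y)
          + L * (|x - y| * phi (h * √w) (x - y))) := by
        rw [← Real.norm_eq_abs]
        refine norm_integral_le_of_norm_le ib (Eventually.of_forall fun y => ?_)
        rw [norm_mul, Real.norm_of_nonneg (phi_nonneg hσ.le _), Real.norm_eq_abs]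
        refine (mul_le_mul_of_nonneg_right (hL y) (phi_nonneg hσ.le _)).trans (le_of_eq ?_)
        ring
    _ ≤ L * (|√u - √w| + h * √w) := by
        rw [integral_add (iφ.const_mul _) (ia.const_mul L), integral_const_mul, integral_phi hσ,
          integral_const_mul]
        nlinarith

lemma integral_fMix_mul_phi_le {σ h x : ℝ} (hσ : 0 < σ) (hh : 0 < h) {g : ℝ → ℝ}
    (hg : ∀ y, g y ∈ Set.Icc (0 : ℝ) 1) :
    ∫ y, fMix p gμ σ y * (g y * phi h (x - y)) ≤ σ⁻¹ := by
  have iφ := (integrable_phi hh x).const_mul σ⁻¹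
  have hf := fun y => fMix_pos (gμ := gμ) hp0 hp1 hσ y
  calc ∫ y, fMix p gμ σ y * (g y * phi h (x - y)) ≤ ∫ y, σ⁻¹ * phi h (x - y) := by
        refine integral_mono_of_nonneg (Eventually.of_forall fun y => mul_nonneg (hf y).le
          (mul_nonneg (hg y).1 (phi_nonneg hh.le _))) iφ (Eventually.of_forall fun y => ?_)
        refine mul_le_mul (fMix_le_inv hp0 hp1 hσ y) ?_
          (mul_nonneg (hg y).1 (phi_nonneg hh.le _)) (by positivity)
        exact mul_le_of_le_one_left (phi_nonneg hh.le _) (hg y).2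
    _ = σ⁻¹ := by rw [integral_const_mul, integral_phi hh, mul_one]

lemma kernelMean_smoothingKernel_le {h : ℝ} (hh : 0 < h) {g : ℝ → ℝ → ℝ} {u w x : ℝ}
    (hw : 0 < w) (hg : ∀ y, g w y ∈ Set.Icc (0 : ℝ) 1) :
    kernelMean p gμ (smoothingKernel h g) u w x ≤ (√w)⁻¹ := by
  rw [kernelMean, integral_obsLaw hp0 hp1 hw]
  exact integral_fMix_mul_phi_le hp0 hp1 (Real.sqrt_pos.2 hw)
    (mul_pos hh (Real.sqrt_pos.2 hw)) hg

lemma kernelMean_columnKernel_le {h : ℝ} (hh : 0 < h) {u w x : ℝ} (hu : 0 < u) (hw : 0 < w) :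
    kernelMean p gμ (columnKernel h) u w x ≤ (√w)⁻¹ := by
  rw [kernelMean, integral_obsLaw hp0 hp1 hw]
  have := integral_fMix_mul_phi_le (gμ := gμ) hp0 hp1 (Real.sqrt_pos.2 hw)
    (mul_pos hh (Real.sqrt_pos.2 hu)) (g := fun _ => 1) (x := x) fun y => by simp
  refine le_of_eq_of_le (integral_congr_ae (Eventually.of_forall fun y => ?_)) this
  simp only [columnKernel, one_mul]
  rw [phi_eq_phi_zero_mul (y - x), phi_eq_phi_zero_mul (x - y), ← neg_sub x y, neg_sq]

/-- 1 - T is the posterior weight of the component `gμ`, and the effect is independent of the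
variance, so the conditional mean is p for every variance. This is why the normalizer of the
alternative density estimate tends to a constant. -/
lemma integral_one_sub_oracleT {w : ℝ} (hw : 0 < w) :
    ∫ y, (1 - oracleT p gμ y √w) ∂(obsLaw p gμ w) = p := by
  have hσ := Real.sqrt_pos.2 hw
  rw [integral_obsLaw hp0 hp1 hw]
  have e : ∀ y, fMix p gμ √w y * (1 - oracleT p gμ y √w)
      = fMix p gμ √w y - (1 - p) * phi √w (0 - y) := fun y => by
    rw [mul_sub, mul_one, mul_comm _ (oracleT p gμ y √w), oracleT_mul_fMix hp0 hp1 hσ, f0,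
      phi, phi, zero_sub, neg_sq]
  simp_rw [e]
  have h1 : ∫ y, fMix p gμ √w y = 1 := by
    have := isProbabilityMeasure_obsLaw (gμ := gμ) hp0 hp1 w
    have h := integral_obsLaw (gμ := gμ) hp0 hp1 hw fun _ => 1
    simpa using h.symm
  have h_int : Integrable fun y => fMix p gμ √w y := by
    by_contra hn
    rw [integral_undef hn] at h1
    norm_num at h1
  rw [integral_sub h_int ((integrable_phi hσ 0).const_mul _), h1, integral_const_mul,
    integral_phi hσ]
  ring

end KernelMean

/-! ### Kernel averages -/

section KernelAverage

variable {Ω : Type*} [MeasurableSpace Ω] {P : Measure Ω} [IsProbabilityMeasure P]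
  {gμ gσ : Measure ℝ} [IsProbabilityMeasure gμ] [IsProbabilityMeasure gσ] {p : ℝ}
  (hp0 : 0 < p) (hp1 : p < 1) {μ V X : ℕ → Ω → ℝ} (hmodel : IsModel P p gμ gσ μ V X)
  {M₁ M₂ : ℝ} (hM : M₁ ≤ M₂) (hS : ∀ᵐ v ∂gσ, v ∈ Set.Icc M₁ M₂)

@[fun_prop]
lemma measurable_kernelWeight {α : Type*} [MeasurableSpace α] {m : ℕ} (h : ℝ)
    {s : α → Fin m → ℝ} (hs : Measurable s) (i j : Fin m) :
    Measurable fun a => kernelWeight h (s a) i j := by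
  unfold kernelWeight; fun_prop

/-- The kernel weights as functions of the variances. -/
def varWeight (h : ℝ) {m : ℕ} (v : Fin m → ℝ) (i j : Fin m) : ℝ :=
  kernelWeight h (fun k => √(v k)) i j

/-- The bound for the sum of the diagonal weights. -/
def diagBound (M₁ M₂ h : ℝ) : ℝ := 2 * ((√M₂ - √M₁) / h + 2)

@[fun_prop]
lemma measurable_varWeight {α : Type*} [MeasurableSpace α] {m : ℕ} (h : ℝ)
    {v : α → Fin m → ℝ} (hv : Measurable v) (i j : Fin m) :
    Measurable fun a => varWeight h (v a) i j := by
  unfold varWeight; fun_prop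

include hM in
lemma sum_varWeight_diag_le {h : ℝ} (hh : 0 < h) {m : ℕ} {v : Fin m → ℝ}
    (hv : ∀ i, v i ∈ Set.Icc M₁ M₂) : ∑ i, varWeight h v i i ≤ diagBound M₁ M₂ h :=
  sum_kernelWeight_diag_le hh _ (fun i => ⟨Real.sqrt_le_sqrt (hv i).1,
    Real.sqrt_le_sqrt (hv i).2⟩) (Real.sqrt_le_sqrt hM)

include hmodel hS in
lemma ae_forall_var_mem : ∀ᵐ ω ∂P, ∀ i, V i ω ∈ Set.Icc M₁ M₂ := by
  refine ae_all_iff.2 fun i => ?_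
  have hm : Measurable fun ω => ((μ i ω, V i ω), X i ω) := by
    have := hmodel.measurable_effect i
    have := hmodel.measurable_var i
    have := hmodel.measurable_obs i
    fun_prop
  have h : ∀ᵐ q ∂(unitLaw p gμ gσ), q.1.2 ∈ Set.Icc M₁ M₂ := by
    have hms : MeasurableSet {q : (ℝ × ℝ) × ℝ | ¬ q.1.2 ∈ Set.Icc M₁ M₂} :=
      ((measurableSet_Icc (a := M₁) (b := M₂)).preimage (by fun_prop :
        Measurable fun q : (ℝ × ℝ) × ℝ => q.1.2)).compl
    rw [ae_iff, ← lintegral_indicator_one hms, lintegral_unitLaw (measurable_one.indicator hms)]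
    rw [lintegral_congr_ae (g := fun _ => 0), lintegral_zero]
    filter_upwards [hS] with v hv
    simp [Set.indicator, hv.1, hv.2]
  rw [← hmodel.law i] at h
  exact ae_of_ae_map hm.aemeasurable h

include hp0 hp1 hmodel hM hS

lemma negligible_centeredSum {H : ℕ → ℝ → ℝ → ℝ → ℝ → ℝ}
    (hH : ∀ m, Measurable fun q : (ℝ × ℝ) × (ℝ × ℝ) => H m q.1.1 q.1.2 q.2.1 q.2.2)
    {c : (m : ℕ) → (Fin m → ℝ) → Fin m → Fin m → ℝ} (hc : ∀ m i j, Measurable fun v => c m v i j)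
    {D K : ℕ → ℝ} {B : ℝ} (hD0 : ∀ m, 0 ≤ D m) (hB0 : 0 ≤ B)
    (hD : ∀ m, ∀ u ∈ Set.Icc M₁ M₂, ∀ w ∈ Set.Icc M₁ M₂, ∀ x y, H m u w x y ∈ Set.Icc 0 (D m))
    (hB : ∀ m, ∀ u ∈ Set.Icc M₁ M₂, ∀ w ∈ Set.Icc M₁ M₂, ∀ x, kernelMean p gμ (H m) u w x ≤ B)
    (hK : ∀ m v, (∀ i, v i ∈ Set.Icc M₁ M₂) → ∑ i, ∑ j, c m v i j ^ 2 ≤ K m)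
    (hlim : Tendsto (fun m : ℕ => D m * K m / m) atTop (𝓝 0)) :
    Negligible P fun m i ω => |centeredSum p gμ (H m) (c m) (fun i => V i ω) (fun i => X i ω) i| := by
  have hVm := hmodel.measurable_var
  have hXm := hmodel.measurable_obs
  have hZm : ∀ m i, Measurable fun ω =>
      centeredSum p gμ (H m) (c m) (fun i => V i ω) (fun i => X i ω) i := fun m i =>
    (measurable_centeredSum (hH m) (hc m) i).comp (by fun_prop :
      Measurable fun ω => ((fun i : Fin m => V i ω), fun i : Fin m => X i ω))
  have hsq : Negligible P fun m i ω =>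
      centeredSum p gμ (H m) (c m) (fun i => V i ω) (fun i => X i ω) i ^ 2 := by
    refine Negligible.of_lintegral (fun m i => (hZm m i).pow_const 2)
      (κ := fun m => B * (D m * K m / m)) (by simpa using hlim.const_mul B) ?_
    filter_upwards [eventually_gt_atTop 0] with m hm0
    have hm0' : (m : ℝ) ≠ 0 := by exact_mod_cast hm0.ne'
    refine (sum_lintegral_sq_centeredSum_le hp0 hp1 (hH m) hmodel (hc m) hS (hD m) (hB m) hB0
      (hD0 m) (hK m)).trans (le_of_eq ?_)
    congr 1
    field_simp
  refine hsq.of_imp fun ε hε => ⟨ε ^ 2, by positivity, Eventually.of_forall fun m i =>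
    Eventually.of_forall fun ω h => abs_le_of_sq_le_sq h hε.le⟩

variable {hs : ℕ → ℝ} (hs0 : ∀ m, 0 < hs m) (hslim : Tendsto hs atTop (𝓝 0))
include hs0 hslim

/-- Consistency of kernel averages: they approach the conditional means at the unit itself. -/
lemma negligible_kernelAverage_sub {H : ℕ → ℝ → ℝ → ℝ → ℝ → ℝ}
    (hH : ∀ m, Measurable fun q : (ℝ × ℝ) × (ℝ × ℝ) => H m q.1.1 q.1.2 q.2.1 q.2.2)
    {D τ : ℕ → ℝ} {B L : ℝ} {R : ℝ → ℝ → ℝ} (hD0 : ∀ m, 0 ≤ D m) (hB0 : 0 ≤ B) (hL0 : 0 ≤ L)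
    (hτ0 : ∀ m, 0 ≤ τ m) (hτ : Tendsto τ atTop (𝓝 0))
    (hD : ∀ m, ∀ u ∈ Set.Icc M₁ M₂, ∀ w ∈ Set.Icc M₁ M₂, ∀ x y, H m u w x y ∈ Set.Icc 0 (D m))
    (hB : ∀ m, ∀ u ∈ Set.Icc M₁ M₂, ∀ w ∈ Set.Icc M₁ M₂, ∀ x, kernelMean p gμ (H m) u w x ≤ B)
    (hR : ∀ u ∈ Set.Icc M₁ M₂, ∀ x, |R u x| ≤ B)
    (hL : ∀ m, ∀ u ∈ Set.Icc M₁ M₂, ∀ w ∈ Set.Icc M₁ M₂, ∀ x,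
      |kernelMean p gμ (H m) u w x - R u x| ≤ L * (|√u - √w| + τ m))
    (hlimD : Tendsto (fun m : ℕ => D m * diagBound M₁ M₂ (hs m) / m) atTop (𝓝 0))
    (hlim : Tendsto (fun m : ℕ => diagBound M₁ M₂ (hs m) / m) atTop (𝓝 0)) :
    Negligible P fun m i ω => |∑ j : Fin m, varWeight (hs m) (fun k : Fin m => V k ω) i j *
      H m (V i ω) (V j ω) (X i ω) (X j ω) - R (V i ω) (X i ω)| := by
  have hVm := hmodel.measurable_var
  have hVS := ae_forall_var_mem hmodel hS
  have hZ := negligible_centeredSum hp0 hp1 hmodel hM hS hH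
    (c := fun m v i j => varWeight (hs m) v i j) (fun m i j => by fun_prop)
    (K := fun m => diagBound M₁ M₂ (hs m)) hD0 hB0 hD hB (fun m v hv =>
      (Finset.sum_le_sum fun i _ => sum_kernelWeight_sq_le (hs0 m) _ i).trans
        (sum_varWeight_diag_le hM (hs0 m) hv)) hlimD
  have hdiag : Negligible P fun m i ω => varWeight (hs m) (fun k : Fin m => V k ω) i i *
      (D m + B) := by
    refine Negligible.of_ae_sum_le (fun m i => by fun_prop) (fun m i => Eventually.of_forall
      fun ω => mul_nonneg (kernelWeight_nonneg (hs0 m) _ i i) (add_nonneg (hD0 m) hB0))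
      (κ := fun m => D m * diagBound M₁ M₂ (hs m) / m + B * (diagBound M₁ M₂ (hs m) / m))
      (by simpa using hlimD.add (hlim.const_mul B)) ?_
    filter_upwards [eventually_gt_atTop 0] with m hm0
    have hm0' : (m : ℝ) ≠ 0 := by exact_mod_cast hm0.ne'
    filter_upwards [hVS] with ω hω
    rw [← Finset.sum_mul]
    refine (mul_le_mul_of_nonneg_right (sum_varWeight_diag_le hM (hs0 m) fun i => hω i)
      (add_nonneg (hD0 m) hB0)).trans (le_of_eq ?_)
    field_simp
  have hbias : Negligible P fun m i ω => ∑ j, varWeight (hs m) (fun k : Fin m => V k ω) i j *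
      (L * (|√(V i ω) - √(V j ω)| + τ m)) := by
    refine Negligible.of_ae_sum_le (fun m i => by fun_prop) (fun m i => Eventually.of_forall
      fun ω => Finset.sum_nonneg fun j _ => mul_nonneg (kernelWeight_nonneg (hs0 m) _ i j)
        (mul_nonneg hL0 (add_nonneg (abs_nonneg _) (hτ0 m))))
      (κ := fun m => L * (columnBound * hs m) + L * τ m)
      (by simpa using ((hslim.const_mul columnBound).const_mul L).add (hτ.const_mul L)) ?_
    refine Eventually.of_forall fun m => Eventually.of_forall fun ω => ?_
    have e : ∀ i : Fin m, ∑ j, varWeight (hs m) (fun k : Fin m => V k ω) i j *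
        (L * (|√(V i ω) - √(V j ω)| + τ m)) = L * ∑ j, varWeight (hs m)
          (fun k : Fin m => V k ω) i j * |√(V i ω) - √(V j ω)| + L * τ m := fun i => by
      have h1 : ∑ j, varWeight (hs m) (fun k : Fin m => V k ω) i j = 1 :=
        sum_kernelWeight (hs0 m) _ i
      calc _ = ∑ j, (L * (varWeight (hs m) (fun k : Fin m => V k ω) i j *
            |√(V i ω) - √(V j ω)|) + L * τ m * varWeight (hs m) (fun k : Fin m => V k ω) i j) :=
            Finset.sum_congr rfl fun j _ => by ring
        _ = _ := by rw [Finset.sum_add_distrib, ← Finset.mul_sum, ← Finset.mul_sum, h1, mul_one]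
    simp_rw [e]
    -- The bias is not controlled row by row; the total over all rows is bounded by summing the
    -- columns.
    rw [Finset.sum_add_distrib, ← Finset.mul_sum, Finset.sum_comm]
    have h2 : ∑ j : Fin m, ∑ i : Fin m, varWeight (hs m) (fun k : Fin m => V k ω) i j *
        |√(V i ω) - √(V j ω)| ≤ m * (columnBound * hs m) := by
      refine (Finset.sum_le_sum fun j _ => sum_kernelWeight_mul_dist_le (hs0 m)
        (fun k : Fin m => √(V k ω)) j).trans (le_of_eq ?_)
      simp
    have h3 : ∑ _i : Fin m, L * τ m = m * (L * τ m) := by simp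
    rw [h3]
    nlinarith
  refine ((hZ.add hdiag).add hbias).mono (Eventually.of_forall fun m i => ?_)
  filter_upwards [hVS] with ω hω
  set w := varWeight (hs m) (fun k : Fin m => V k ω) with hw
  have hw0 : ∀ j, 0 ≤ w i j := fun j => kernelWeight_nonneg (hs0 m) _ i j
  have hw1 : ∑ j, w i j = 1 := sum_kernelWeight (hs0 m) _ i
  set Hi : Fin m → ℝ := fun j => H m (V i ω) (V j ω) (X i ω) (X j ω) with hHi
  set k : Fin m → ℝ := fun j => kernelMean p gμ (H m) (V i ω) (V j ω) (X i ω) with hk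
  set r := R (V i ω) (X i ω) with hr
  -- Centered sum, own term, bias. The own term is split off because for j = i the observation is
  -- the evaluation point itself and the conditional mean says nothing about it.
  have hdec : ∑ j, w i j * Hi j - r = (∑ j ∈ Finset.univ.erase i, w i j * (Hi j - k j)) +
      w i i * (Hi i - r) + ∑ j ∈ Finset.univ.erase i, w i j * (k j - r) := by
    have e1 : r = ∑ j, w i j * r := by rw [← Finset.sum_mul, hw1, one_mul]
    nth_rw 1 [e1]
    rw [← Finset.sum_sub_distrib, ← Finset.add_sum_erase _ _ (Finset.mem_univ i),
      add_right_comm, ← Finset.sum_add_distrib, add_comm]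
    congr 1
    · exact Finset.sum_congr rfl fun j _ => by ring
    · ring
  have hHD := hD m _ (hω i) _ (hω i) (X i ω) (X i ω)
  have h1 : |w i i * (Hi i - r)| ≤ w i i * (D m + B) := by
    rw [abs_mul, abs_of_nonneg (hw0 i)]
    refine mul_le_mul_of_nonneg_left ?_ (hw0 i)
    refine (abs_sub _ _).trans (add_le_add ?_ (hR _ (hω i) _))
    rw [abs_of_nonneg hHD.1]; exact hHD.2
  have h2 : |∑ j ∈ Finset.univ.erase i, w i j * (k j - r)|
      ≤ ∑ j, w i j * (L * (|√(V i ω) - √(V j ω)| + τ m)) := by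
    refine (Finset.abs_sum_le_sum_abs _ _).trans ?_
    refine (Finset.sum_le_sum fun j _ => ?_).trans (Finset.sum_le_sum_of_subset_of_nonneg
      (Finset.erase_subset i _) fun j _ _ => mul_nonneg (hw0 j)
        (mul_nonneg hL0 (add_nonneg (abs_nonneg _) (hτ0 m))))
    rw [abs_mul, abs_of_nonneg (hw0 j)]
    exact mul_le_mul_of_nonneg_left (hL m _ (hω i) _ (hω j) _) (hw0 j)
  rw [hdec]
  refine (abs_add_le _ _).trans (add_le_add ((abs_add_le _ _).trans (add_le_add le_rfl h1)) h2)

end KernelAverage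

/-! ### Kernel averages of negligible arrays -/

section Weighted

variable {Ω : Type*} [MeasurableSpace Ω] {P : Measure Ω} [IsProbabilityMeasure P]
  {gμ gσ : Measure ℝ} [IsProbabilityMeasure gμ] [IsProbabilityMeasure gσ] {p : ℝ}
  (hp0 : 0 < p) (hp1 : p < 1) {μ V X : ℕ → Ω → ℝ} (hmodel : IsModel P p gμ gσ μ V X)
  {M₁ M₂ : ℝ} (hM₁ : 0 < M₁) (hM : M₁ ≤ M₂) (hS : ∀ᵐ v ∂gσ, v ∈ Set.Icc M₁ M₂)
  {hs : ℕ → ℝ} (hs0 : ∀ m, 0 < hs m)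

omit [IsProbabilityMeasure P] in
-- The inequality |z| ≤ η + z²/η plays the part of Cauchy–Schwarz: with η of order √κ it turns a
-- second moment bound κ into an L¹ bound of order √κ.
lemma sum_lintegral_abs_le {m : ℕ} {Z : Fin m → Ω → ℝ} [IsProbabilityMeasure P]
    (hZ : ∀ i, Measurable (Z i)) {κ η : ℝ} (hη : 0 < η) (hκ : 0 ≤ κ)
    (h : ∑ i, ∫⁻ ω, ENNReal.ofReal (Z i ω ^ 2) ∂P ≤ ENNReal.ofReal (m * κ)) :
    ∑ i, ∫⁻ ω, ENNReal.ofReal |Z i ω| ∂P ≤ ENNReal.ofReal (m * (η + κ / η)) := by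
  have hpt : ∀ z : ℝ, |z| ≤ η + η⁻¹ * z ^ 2 := fun z => by
    have : η + η⁻¹ * z ^ 2 - |z| = ((η - |z|) ^ 2 + η * |z|) / η := by
      field_simp; rw [← sq_abs z]; ring
    have : 0 ≤ ((η - |z|) ^ 2 + η * |z|) / η := by positivity
    linarith
  calc ∑ i, ∫⁻ ω, ENNReal.ofReal |Z i ω| ∂P
      ≤ ∑ i, (ENNReal.ofReal η + ENNReal.ofReal η⁻¹ * ∫⁻ ω, ENNReal.ofReal (Z i ω ^ 2) ∂P) := by
        refine Finset.sum_le_sum fun i _ => ?_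
        have hm : Measurable fun ω => ENNReal.ofReal (Z i ω ^ 2) :=
          ((hZ i).pow_const 2).ennreal_ofReal
        rw [← lintegral_const_mul _ hm]
        calc _ ≤ ∫⁻ ω, (ENNReal.ofReal η + ENNReal.ofReal η⁻¹ * ENNReal.ofReal (Z i ω ^ 2)) ∂P := by
              refine lintegral_mono fun ω => ?_
              rw [← ENNReal.ofReal_mul (by positivity), ← ENNReal.ofReal_add hη.le (by positivity)]
              exact ENNReal.ofReal_le_ofReal (hpt _)
          _ = _ := by rw [lintegral_add_left measurable_const]; simp
    _ = m * ENNReal.ofReal η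
        + ENNReal.ofReal η⁻¹ * ∑ i, ∫⁻ ω, ENNReal.ofReal (Z i ω ^ 2) ∂P := by
        rw [Finset.sum_add_distrib, Finset.mul_sum]; simp
    _ ≤ m * ENNReal.ofReal η + ENNReal.ofReal η⁻¹ * ENNReal.ofReal (m * κ) := by gcongr
    _ = ENNReal.ofReal (m * (η + κ / η)) := by
        rw [← ENNReal.ofReal_mul (by positivity), ← ENNReal.ofReal_natCast,
          ← ENNReal.ofReal_mul (by positivity), ← ENNReal.ofReal_add (by positivity)
          (by positivity)]
        congr 1; field_simp

lemma sum_lintegral_ofReal_eq {m : ℕ} {e : Fin m → Ω → ℝ} (he : ∀ i, Measurable (e i))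
    (h01 : ∀ i ω, e i ω ∈ Set.Icc (0 : ℝ) 1) :
    ∑ i, ∫⁻ ω, ENNReal.ofReal (e i ω) ∂P = ENNReal.ofReal (∑ i, ∫ ω, e i ω ∂P) := by
  rw [ENNReal.ofReal_sum_of_nonneg fun i _ => integral_nonneg fun ω => (h01 i ω).1]
  refine Finset.sum_congr rfl fun i _ => (ofReal_integral_eq_lintegral_ofReal
    (integrable_of_abs_le (he i) (C := 1) fun ω => ?_)
    (Eventually.of_forall fun ω => (h01 i ω).1)).symm
  rw [abs_of_nonneg (h01 i ω).1]; exact (h01 i ω).2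

lemma varWeight_nonneg {h : ℝ} (hh : 0 < h) {m : ℕ} (v : Fin m → ℝ) (i j : Fin m) :
    0 ≤ varWeight h v i j := kernelWeight_nonneg hh _ i j

/-- The centered sum of the kernels in a column of the weight matrix. -/
def columnSum (p : ℝ) (gμ : Measure ℝ) (h hx : ℝ) {m : ℕ} (v x : Fin m → ℝ) (j : Fin m) : ℝ :=
  centeredSum p gμ (columnKernel hx) (fun v j i => varWeight h v i j) v x j

omit [MeasurableSpace Ω] hM in
lemma phi_mul_sqrt_le (hM₁ : 0 < M₁) {h : ℝ} (hh : 0 < h) {v : ℝ} (hv : v ∈ Set.Icc M₁ M₂)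
    (z : ℝ) : phi (h * √v) z ≤ (h * √M₁)⁻¹ := by
  have ha : 0 < √M₁ := Real.sqrt_pos.2 hM₁
  have h1 : 0 < √v := Real.sqrt_pos.2 (hM₁.trans_le hv.1)
  refine (phi_le_inv (mul_pos hh h1) z).trans ?_
  gcongr
  exact hv.1

include hp0 hp1 hM₁ in
lemma kernelMean_columnKernel_le_of_mem {h : ℝ} (hh : 0 < h) {u w : ℝ}
    (hu : u ∈ Set.Icc M₁ M₂) (hw : w ∈ Set.Icc M₁ M₂) (x : ℝ) :
    kernelMean p gμ (columnKernel h) u w x ≤ (√M₁)⁻¹ := by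
  have ha : 0 < √M₁ := Real.sqrt_pos.2 hM₁
  refine (kernelMean_columnKernel_le hp0 hp1 hh (hM₁.trans_le hu.1)
    (hM₁.trans_le hw.1)).trans ?_
  gcongr
  exact hw.1

include hp0 hp1 hM₁ hM in
-- The errors e j may depend on the whole sample and cannot be conditioned upon. In column j the
-- coefficient of e j is the own term plus the centered `columnSum` plus a conditional mean bounded
-- by (√M₁)⁻¹ `columnBound`. For the first two parts e j ≤ 1 suffices; only the bounded part keeps
-- the factor e j.
lemma sum_sum_varWeight_mul_phi_le {h hx : ℝ} (hh : 0 < h) (hx0 : 0 < hx) {m : ℕ}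
    {v x e : Fin m → ℝ} (hv : ∀ i, v i ∈ Set.Icc M₁ M₂) (he : ∀ i, e i ∈ Set.Icc (0 : ℝ) 1) :
    ∑ i, ∑ j, varWeight h v i j * phi (hx * √(v j)) (x i - x j) * e j
      ≤ (hx * √M₁)⁻¹ * diagBound M₁ M₂ h + ∑ j, |columnSum p gμ h hx v x j|
        + (√M₁)⁻¹ * columnBound * ∑ j, e j := by
  have ha : 0 < √M₁ := Real.sqrt_pos.2 hM₁
  have hw : ∀ i j, 0 ≤ varWeight h v i j := fun i j => kernelWeight_nonneg hh _ i j
  have hφ0 : ∀ i j, 0 ≤ phi (hx * √(v j)) (x i - x j) := fun i j =>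
    phi_nonneg (mul_nonneg hx0.le (Real.sqrt_nonneg _)) _
  have hB0 : 0 ≤ (√M₁)⁻¹ := by positivity
  have hD0 : 0 ≤ (hx * √M₁)⁻¹ := by positivity
  rw [Finset.sum_comm]
  have hcol : ∀ j, ∑ i, varWeight h v i j * phi (hx * √(v j)) (x i - x j) * e j
      ≤ (hx * √M₁)⁻¹ * varWeight h v j j + |columnSum p gμ h hx v x j|
        + (√M₁)⁻¹ * columnBound * e j := fun j => by
    have he0 := (he j).1
    have he1 := (he j).2
    rw [← Finset.sum_mul, ← Finset.add_sum_erase _ _ (Finset.mem_univ j), add_mul]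
    have hsplit : ∑ i ∈ Finset.univ.erase j, varWeight h v i j * phi (hx * √(v j)) (x i - x j)
        = columnSum p gμ h hx v x j + ∑ i ∈ Finset.univ.erase j, varWeight h v i j *
          kernelMean p gμ (columnKernel hx) (v j) (v i) (x j) := by
      rw [columnSum, centeredSum, ← Finset.sum_add_distrib]
      refine Finset.sum_congr rfl fun i _ => ?_
      rw [← mul_add, sub_add_cancel, columnKernel]
    have hk1 : ∑ i ∈ Finset.univ.erase j, varWeight h v i j *
        kernelMean p gμ (columnKernel hx) (v j) (v i) (x j) ≤ (√M₁)⁻¹ * columnBound := by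
      calc _ ≤ ∑ i ∈ Finset.univ.erase j, varWeight h v i j * (√M₁)⁻¹ :=
            Finset.sum_le_sum fun i _ => mul_le_mul_of_nonneg_left
              (kernelMean_columnKernel_le_of_mem hp0 hp1 hM₁ hx0 (hv j) (hv i) _) (hw i j)
        _ ≤ ∑ i, varWeight h v i j * (√M₁)⁻¹ := Finset.sum_le_sum_of_subset_of_nonneg
            (Finset.erase_subset _ _) fun i _ _ => mul_nonneg (hw i j) hB0
        _ ≤ (√M₁)⁻¹ * columnBound := by
            rw [← Finset.sum_mul, mul_comm]
            exact mul_le_mul_of_nonneg_left (sum_kernelWeight_left_le hh _ j) hB0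
    have hd : varWeight h v j j * phi (hx * √(v j)) (x j - x j) * e j
        ≤ (hx * √M₁)⁻¹ * varWeight h v j j := by
      have h1 : varWeight h v j j * phi (hx * √(v j)) (x j - x j)
          ≤ (hx * √M₁)⁻¹ * varWeight h v j j := by
        rw [mul_comm]
        exact mul_le_mul_of_nonneg_right (phi_mul_sqrt_le hM₁ hx0 (hv j) _) (hw j j)
      exact (mul_le_of_le_one_right (mul_nonneg (hw j j) (hφ0 j j)) he1).trans h1
    rw [hsplit, add_mul]
    have h3 : columnSum p gμ h hx v x j * e j ≤ |columnSum p gμ h hx v x j| :=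
      (mul_le_mul_of_nonneg_right (le_abs_self _) he0).trans
        (mul_le_of_le_one_right (abs_nonneg _) he1)
    have h4 := mul_le_mul_of_nonneg_right hk1 he0
    linarith
  refine (Finset.sum_le_sum fun j _ => hcol j).trans ?_
  rw [Finset.sum_add_distrib, Finset.sum_add_distrib, ← Finset.mul_sum, ← Finset.mul_sum]
  have := mul_le_mul_of_nonneg_left (sum_varWeight_diag_le hM hh hv) hD0
  linarith

lemma measurable_columnKernel (hx : ℝ) : Measurable fun q : (ℝ × ℝ) × (ℝ × ℝ) =>
    columnKernel hx q.1.1 q.1.2 q.2.1 q.2.2 := by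
  unfold columnKernel; fun_prop

lemma measurable_columnSum {α : Type*} [MeasurableSpace α] (h hx : ℝ) {m : ℕ}
    {v x : α → Fin m → ℝ} (hv : Measurable v) (hxm : Measurable x) (j : Fin m) :
    Measurable fun a => columnSum p gμ h hx (v a) (x a) j := by
  have h1 := measurable_centeredSum (p := p) (gμ := gμ) (H := columnKernel hx)
    (measurable_columnKernel hx) (c := fun v j i => varWeight h v i j)
    (fun i j => measurable_varWeight h measurable_id j i) j
  exact h1.comp (f := fun a => (v a, x a)) (hv.prodMk hxm)

include hp0 hp1 hM₁ hM hS hmodel in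
lemma sum_lintegral_sq_columnSum_le {h hx : ℝ} (hh : 0 < h) (hx0 : 0 < hx) (m : ℕ) :
    ∑ j : Fin m, ∫⁻ ω, ENNReal.ofReal
        (columnSum p gμ h hx (fun i => V i ω) (fun i => X i ω) j ^ 2) ∂P
      ≤ ENNReal.ofReal ((hx * √M₁)⁻¹ * (√M₁)⁻¹ * diagBound M₁ M₂ h) := by
  have ha : 0 < √M₁ := Real.sqrt_pos.2 hM₁
  refine sum_lintegral_sq_centeredSum_le hp0 hp1 (measurable_columnKernel hx) hmodel
    (c := fun v j i => varWeight h v i j) (fun i j => by fun_prop) hS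
    (fun u hu w hw x y => ⟨phi_nonneg (mul_nonneg hx0.le (Real.sqrt_nonneg _)) _,
      phi_mul_sqrt_le hM₁ hx0 hu _⟩)
    (fun u hu w hw x => kernelMean_columnKernel_le_of_mem hp0 hp1 hM₁ hx0 hu hw x)
    (by positivity) (by positivity) fun v hv => ?_
  rw [Finset.sum_comm]
  exact (Finset.sum_le_sum fun i _ => sum_kernelWeight_sq_le hh _ i).trans
    (sum_varWeight_diag_le hM hh hv)

variable {e : (m : ℕ) → Fin m → Ω → ℝ} (he : ∀ m i, Measurable (e m i))
  (h01 : ∀ m i ω, e m i ω ∈ Set.Icc (0 : ℝ) 1) (hneg : Negligible P e)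
include hmodel hs0 he h01 hneg

/-- Column sums are bounded, so the total of the kernel averages is at most a constant times the
total of e, whatever the dependence between e and the weights. -/
lemma negligible_sum_varWeight_mul :
    Negligible P fun m i ω => ∑ j, varWeight (hs m) (fun k : Fin m => V k ω) i j * e m j ω := by
  have hVm := hmodel.measurable_var
  have hmeas : ∀ (m : ℕ) (i : Fin m), Measurable fun ω =>
      ∑ j, varWeight (hs m) (fun k : Fin m => V k ω) i j * e m j ω := fun m i => by fun_prop
  refine Negligible.of_lintegral hmeas
    (κ := fun m => columnBound * ((∑ i, ∫ ω, e m i ω ∂P) / m))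
    (by simpa using (hneg.tendsto_integral he h01).const_mul columnBound) ?_
  filter_upwards [eventually_gt_atTop 0] with m hm0
  have hm0' : (m : ℝ) ≠ 0 := by exact_mod_cast hm0.ne'
  have hw : ∀ ω (i j : Fin m), 0 ≤ varWeight (hs m) (fun k : Fin m => V k ω) i j := fun ω i j =>
    kernelWeight_nonneg (hs0 m) _ i j
  rw [← lintegral_finsetSum _ fun i _ => (hmeas m i).ennreal_ofReal]
  calc _ ≤ ∫⁻ ω, ENNReal.ofReal columnBound * ∑ j, ENNReal.ofReal (e m j ω) ∂P := by
        refine lintegral_mono fun ω => ?_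
        rw [← ENNReal.ofReal_sum_of_nonneg fun i _ => Finset.sum_nonneg fun j _ =>
          mul_nonneg (hw ω i j) (h01 m j ω).1, ← ENNReal.ofReal_sum_of_nonneg
          fun j _ => (h01 m j ω).1, ← ENNReal.ofReal_mul columnBound_nonneg, Finset.sum_comm]
        refine ENNReal.ofReal_le_ofReal ?_
        rw [Finset.mul_sum]
        refine Finset.sum_le_sum fun j _ => ?_
        rw [← Finset.sum_mul]
        exact mul_le_mul_of_nonneg_right (sum_kernelWeight_left_le (hs0 m) _ j) (h01 m j ω).1
    _ = ENNReal.ofReal columnBound * ENNReal.ofReal (∑ j, ∫ ω, e m j ω ∂P) := by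
        rw [lintegral_const_mul _ (Finset.measurable_sum _ fun j _ => (he m j).ennreal_ofReal),
          lintegral_finsetSum _ fun j _ => (he m j).ennreal_ofReal,
          sum_lintegral_ofReal_eq (he m) (h01 m)]
    _ = _ := by
        rw [← ENNReal.ofReal_mul columnBound_nonneg]; congr 1; field_simp

include hp0 hp1 hM₁ hM hS

lemma negligible_sum_varWeight_mul_phi {hx : ℕ → ℝ} (hx0 : ∀ m, 0 < hx m)
    (hlim : Tendsto (fun m : ℕ => (hx m * √M₁)⁻¹ * diagBound M₁ M₂ (hs m) / m) atTop (𝓝 0)) :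
    Negligible P fun m i ω => ∑ j, varWeight (hs m) (fun k : Fin m => V k ω) i j *
      phi (hx m * √(V j ω)) (X i ω - X j ω) * e m j ω := by
  have hVm := hmodel.measurable_var
  have hXm := hmodel.measurable_obs
  have hVS := ae_forall_var_mem hmodel hS
  have ha : 0 < √M₁ := Real.sqrt_pos.2 hM₁
  have hB0 : 0 ≤ (√M₁)⁻¹ := by positivity
  have hcB : 0 ≤ (√M₁)⁻¹ * columnBound := mul_nonneg hB0 columnBound_nonneg
  have hmeas : ∀ (m : ℕ) (i : Fin m), Measurable fun ω =>
      ∑ j, varWeight (hs m) (fun k : Fin m => V k ω) i j *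
        phi (hx m * √(V j ω)) (X i ω - X j ω) * e m j ω := fun m i => by fun_prop
  have hZm : ∀ (m : ℕ) (j : Fin m), Measurable fun ω =>
      columnSum p gμ (hs m) (hx m) (fun i => V i ω) (fun i => X i ω) j := fun m j =>
    measurable_columnSum _ _ (by fun_prop) (by fun_prop) j
  obtain ⟨u, hu⟩ : ∃ u : ℕ → ℝ, u = fun m : ℕ =>
    (hx m * √M₁)⁻¹ * diagBound M₁ M₂ (hs m) / m := ⟨_, rfl⟩
  rw [← hu] at hlim
  have hsqrt : Tendsto (fun m => √(u m)) atTop (𝓝 0) := by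
    simpa using hlim.sqrt
  refine Negligible.of_lintegral hmeas
    (κ := fun m => u m + (√(u m) + (√M₁)⁻¹ * √(u m)) +
      (√M₁)⁻¹ * columnBound * ((∑ i, ∫ ω, e m i ω ∂P) / m)) ?_ ?_
  · simpa using (hlim.add (hsqrt.add (hsqrt.const_mul _))).add
      ((hneg.tendsto_integral he h01).const_mul _)
  filter_upwards [eventually_gt_atTop 0] with m hm0
  have hm0' : (0 : ℝ) < m := by exact_mod_cast hm0
  have hmu : (m : ℝ) * u m = (hx m * √M₁)⁻¹ * diagBound M₁ M₂ (hs m) := by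
    rw [hu]; field_simp
  have hu0 : 0 < u m := by
    have h1 := sub_nonneg.2 (Real.sqrt_le_sqrt hM)
    have h2 := hs0 m
    have h3 := hx0 m
    have h4 : 0 < diagBound M₁ M₂ (hs m) := by unfold diagBound; positivity
    rw [hu]; positivity
  have hZabs : ∀ j : Fin m, Measurable fun ω => ENNReal.ofReal
      |columnSum p gμ (hs m) (hx m) (fun i => V i ω) (fun i => X i ω) j| := fun j =>
    (hZm m j).abs.ennreal_ofReal
  rw [← lintegral_finsetSum _ fun i _ => (hmeas m i).ennreal_ofReal]
  calc _ ≤ ∫⁻ ω, (ENNReal.ofReal (m * u m) + (∑ j : Fin m, ENNReal.ofReal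
          |columnSum p gμ (hs m) (hx m) (fun i => V i ω) (fun i => X i ω) j| +
          ENNReal.ofReal ((√M₁)⁻¹ * columnBound) * ∑ j, ENNReal.ofReal (e m j ω))) ∂P := by
        refine lintegral_mono_ae (hVS.mono fun ω hω => ?_)
        have hE := Finset.sum_nonneg fun j (_ : j ∈ Finset.univ) => (h01 m j ω).1
        have hA : 0 ≤ ∑ j : Fin m,
            |columnSum p gμ (hs m) (hx m) (fun i => V i ω) (fun i => X i ω) j| :=
          Finset.sum_nonneg fun j _ => abs_nonneg _
        rw [← ENNReal.ofReal_sum_of_nonneg fun i _ => Finset.sum_nonneg fun j _ =>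
          mul_nonneg (mul_nonneg (varWeight_nonneg (hs0 m) _ i j)
            (phi_nonneg (mul_nonneg (hx0 m).le (Real.sqrt_nonneg _)) _)) (h01 m j ω).1,
          ← ENNReal.ofReal_sum_of_nonneg fun j _ => (h01 m j ω).1,
          ← ENNReal.ofReal_sum_of_nonneg fun j _ => abs_nonneg _, ← ENNReal.ofReal_mul hcB,
          ← ENNReal.ofReal_add hA (mul_nonneg hcB hE),
          ← ENNReal.ofReal_add (mul_nonneg hm0'.le hu0.le) (add_nonneg hA (mul_nonneg hcB hE)),
          hmu, ← add_assoc]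
        exact ENNReal.ofReal_le_ofReal (sum_sum_varWeight_mul_phi_le hp0 hp1 hM₁ hM (hs0 m)
          (hx0 m) (fun i => hω i) fun i => h01 m i ω)
    _ = ENNReal.ofReal (m * u m) + (∑ j : Fin m, ∫⁻ ω, ENNReal.ofReal
          |columnSum p gμ (hs m) (hx m) (fun i => V i ω) (fun i => X i ω) j| ∂P +
          ENNReal.ofReal ((√M₁)⁻¹ * columnBound) * ENNReal.ofReal (∑ j, ∫ ω, e m j ω ∂P)) := by
        rw [lintegral_add_left measurable_const, lintegral_add_left
          (Finset.measurable_sum _ fun j _ => hZabs j), lintegral_finsetSum _ fun j _ => hZabs j,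
          lintegral_const_mul _ (Finset.measurable_sum _ fun j _ => (he m j).ennreal_ofReal),
          lintegral_finsetSum _ fun j _ => (he m j).ennreal_ofReal,
          sum_lintegral_ofReal_eq (he m) (h01 m), lintegral_const, measure_univ, mul_one]
    _ ≤ ENNReal.ofReal (m * u m)
          + (ENNReal.ofReal (m * (√(u m) + (√M₁)⁻¹ * u m / √(u m))) +
          ENNReal.ofReal ((√M₁)⁻¹ * columnBound) * ENNReal.ofReal (∑ j, ∫ ω, e m j ω ∂P)) := by
        have := sum_lintegral_sq_columnSum_le (gμ := gμ) hp0 hp1 hmodel hM₁ hM hS (hs0 m)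
          (hx0 m) m
        rw [show (hx m * √M₁)⁻¹ * (√M₁)⁻¹ * diagBound M₁ M₂ (hs m) = m * ((√M₁)⁻¹ * u m) by
          rw [mul_left_comm, hmu]; ring] at this
        -- The choice η = √(u m) balances η against κ/η, since κ is a multiple of u m.
        have := sum_lintegral_abs_le (hZm m) (Real.sqrt_pos.2 hu0) (mul_nonneg hB0 hu0.le) this
        exact add_le_add_right (add_le_add_left this _) _
    _ = _ := by
        have hE0 : 0 ≤ ∑ j, ∫ ω, e m j ω ∂P :=
          Finset.sum_nonneg fun j _ => integral_nonneg fun ω => (h01 m j ω).1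
        have hs1 := Real.sqrt_nonneg (u m)
        rw [mul_div_assoc, Real.div_sqrt, ← ENNReal.ofReal_mul hcB,
          ← ENNReal.ofReal_add (mul_nonneg hm0'.le (add_nonneg hs1 (mul_nonneg hB0 hs1)))
            (mul_nonneg hcB hE0),
          ← ENNReal.ofReal_add (mul_nonneg hm0'.le hu0.le) (add_nonneg
            (mul_nonneg hm0'.le (add_nonneg hs1 (mul_nonneg hB0 hs1))) (mul_nonneg hcB hE0))]
        congr 1
        have hEm : (∑ i, ∫ ω, e m i ω ∂P) = m * ((∑ i, ∫ ω, e m i ω ∂P) / m) := by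
          field_simp
        generalize (∑ i, ∫ ω, e m i ω ∂P) / m = E at *
        rw [hEm]; ring

end Weighted

/-! ### Consistency of the data-driven statistics -/

section Elementary

/-- Only the limiting denominator A + B appears, so no lower bound for the estimated denominator is
needed; the degenerate case A' + B' = 0 is covered by 0/0 = 0. -/
lemma abs_ratio_sub_ratio_le {A B A' B' : ℝ} (hA : 0 ≤ A) (hB : 0 ≤ B) (hA' : 0 ≤ A')
    (hB' : 0 ≤ B') (hAB : 0 < A + B) :
    |A' / (A' + B') - A / (A + B)| ≤ (|A' - A| + |B' - B|) / (A + B) := by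
  rcases (add_nonneg hA' hB').eq_or_lt with h0 | h0
  · have h1 : A' = 0 := by linarith
    have h2 : B' = 0 := by linarith
    simp only [h1, h2, add_zero, div_zero, zero_sub, abs_neg]
    rw [abs_of_nonneg (div_nonneg hA hAB.le), abs_of_nonneg hA, abs_of_nonneg hB]
    gcongr; linarith
  rw [div_sub_div _ _ h0.ne' hAB.ne', abs_div, abs_of_pos (mul_pos h0 hAB),
    div_le_div_iff₀ (mul_pos h0 hAB) hAB]
  have e : A' * (A + B) - (A' + B') * A = A' * (B - B') + B' * (A' - A) := by ring
  rw [e]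
  have h1 : |A' * (B - B') + B' * (A' - A)| ≤ A' * |B' - B| + B' * |A' - A| := by
    refine (abs_add_le _ _).trans (le_of_eq ?_)
    rw [abs_mul, abs_mul, abs_of_nonneg hA', abs_of_nonneg hB', abs_sub_comm B B']
  calc _ ≤ (A' * |B' - B| + B' * |A' - A|) * (A + B) := by gcongr
    _ ≤ ((|A' - A| + |B' - B|) * (A' + B')) * (A + B) := by
        gcongr
        nlinarith [mul_nonneg hA' (abs_nonneg (A' - A)), mul_nonneg hB' (abs_nonneg (B' - B))]
    _ = _ := by ring

/-- Truncating the ratio at 1 amounts to replacing the implied alternative part F' - A' by its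
positive part, which brings it to the form A'/(A' + B'). -/
lemma abs_min_ratio_sub_ratio_le {A B A' F' : ℝ} (hA : 0 ≤ A) (hB : 0 ≤ B) (hA' : 0 < A')
    (hF' : 0 < F') (hAB : 0 < A + B) :
    |min (A' / F') 1 - A / (A + B)| ≤ (2 * |A' - A| + |F' - (A + B)|) / (A + B) := by
  have e : min (A' / F') 1 = A' / (A' + max (F' - A') 0) := by
    rcases le_total A' F' with h | h
    · rw [min_eq_left ((div_le_one hF').2 h), max_eq_left (by linarith)]; congr 1; ring
    · rw [min_eq_right ((one_le_div hF').2 h), max_eq_right (by linarith), add_zero,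
        div_self hA'.ne']
  rw [e]
  refine (abs_ratio_sub_ratio_le hA hB hA'.le (le_max_right _ _) hAB).trans ?_
  refine div_le_div_of_nonneg_right ?_ hAB.le
  have h1 : |max (F' - A') 0 - B| ≤ |F' - A' - B| := by
    have := abs_max_sub_max_le_abs (F' - A') B 0
    rwa [max_eq_left hB] at this
  have h2 : |F' - A' - B| ≤ |F' - (A + B)| + |A' - A| := by
    have : F' - A' - B = (F' - (A + B)) - (A' - A) := by ring
    rw [this]; exact abs_sub _ _
  linarith

/-- The condition δ ≤ p/2 keeps B above p/2, whence the factor 2/p. The estimated normalizer B and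
the estimated proportion q both tend to p and cancel in the limit. -/
lemma abs_mul_div_sub_le {p q A B f c δ : ℝ} (hp0 : 0 < p) (hq : |q - p| ≤ δ)
    (hq1 : q ≤ 1) (hq0 : 0 ≤ q) (hA : |A - p * f| ≤ δ) (hB : |B - p| ≤ δ) (hδ : δ ≤ p / 2)
    (hp1 : p ≤ 1) (hf0 : 0 ≤ f) (hf : f ≤ c) :
    |q * (A / B) - p * f| ≤ 2 * (1 + 2 * c) / p * δ := by
  have hδ0 : 0 ≤ δ := (abs_nonneg _).trans hq
  have hB1 : p / 2 ≤ B := by linarith [(abs_le.1 hB).1]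
  have hB0 : 0 < B := by linarith
  have e : q * (A / B) - p * f = (q * (A - p * f) + p * f * (q - B)) / B := by
    field_simp; ring
  have hqB : |q - B| ≤ 2 * δ := by
    have : q - B = (q - p) - (B - p) := by ring
    rw [this]; refine (abs_sub _ _).trans (by linarith)
  have hnum : |q * (A - p * f) + p * f * (q - B)| ≤ (1 + 2 * c) * δ := by
    refine (abs_add_le _ _).trans ?_
    rw [abs_mul, abs_mul (p * f), abs_of_nonneg hq0, abs_of_nonneg (mul_nonneg hp0.le hf0)]
    have h1 : q * |A - p * f| ≤ 1 * δ := mul_le_mul hq1 hA (abs_nonneg _) zero_le_one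
    have h2 : p * f * |q - B| ≤ 1 * c * (2 * δ) :=
      mul_le_mul (mul_le_mul hp1 hf hf0 zero_le_one) hqB (abs_nonneg _) (by linarith)
    linarith
  rw [e, abs_div, abs_of_pos hB0, div_le_iff₀ hB0]
  have hc0 : 0 ≤ c := hf0.trans hf
  calc _ ≤ (1 + 2 * c) * δ := hnum
    _ = 2 * (1 + 2 * c) / p * δ * (p / 2) := by field_simp
    _ ≤ _ := by gcongr

end Elementary

/-! ### Limits of the kernel averages in the estimates -/

section Consistency

variable {Ω : Type*} [MeasurableSpace Ω] {P : Measure Ω} [IsProbabilityMeasure P]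
  {gμ gσ : Measure ℝ} [IsProbabilityMeasure gμ] [IsProbabilityMeasure gσ] {p : ℝ}
  (hp0 : 0 < p) (hp1 : p < 1) {μ V X : ℕ → Ω → ℝ} (hmodel : IsModel P p gμ gσ μ V X)
  {M₁ M₂ : ℝ} (hM₁ : 0 < M₁) (hM : M₁ ≤ M₂) (hS : ∀ᵐ v ∂gσ, v ∈ Set.Icc M₁ M₂)
  {hx hs : ℕ → ℝ} (hx0 : ∀ m, 0 < hx m) (hs0 : ∀ m, 0 < hs m)
  (hxlim : Tendsto hx atTop (𝓝 0)) (hslim : Tendsto hs atTop (𝓝 0))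
  (hlimD : Tendsto (fun m : ℕ => (hx m * √M₁)⁻¹ * diagBound M₁ M₂ (hs m) / m) atTop (𝓝 0))
  (hlim : Tendsto (fun m : ℕ => diagBound M₁ M₂ (hs m) / m) atTop (𝓝 0))

/-- The oracle statistic of the `i`-th unit. -/
def unitT (p : ℝ) (gμ : Measure ℝ) (V X : ℕ → Ω → ℝ) (i : ℕ) (ω : Ω) : ℝ :=
  oracleT p gμ (X i ω) √(V i ω)

include hp0 hp1 in
lemma unitT_mem_Icc (i : ℕ) (ω : Ω) : unitT p gμ V X i ω ∈ Set.Icc (0 : ℝ) 1 :=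
  ⟨oracleT_nonneg hp0.le hp1.le (Real.sqrt_nonneg _) _,
    oracleT_le_one hp0.le hp1.le (Real.sqrt_nonneg _) _⟩

include hmodel in
@[fun_prop]
lemma measurable_unitT (i : ℕ) : Measurable (unitT p gμ V X i) := by
  have := hmodel.measurable_var i
  have := hmodel.measurable_obs i
  unfold unitT; fun_prop

include hp0 hp1 hmodel hM₁ hM hS hx0 hs0 hxlim hslim hlimD hlim

/-- Serves both density estimates: g = 1 with limit `fMix`, and g = 1 - T with limit p f₁. The
constant 3/M₁ is the Lipschitz constant of the Gaussian density for standard deviations at least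
√M₁. -/
lemma negligible_smoothing_sub {g R : ℝ → ℝ → ℝ} (hg : Measurable fun q : ℝ × ℝ => g q.1 q.2)
    (hg01 : ∀ w ∈ Set.Icc M₁ M₂, ∀ y, g w y ∈ Set.Icc (0 : ℝ) 1)
    (hRm : ∀ w, Measurable (R w)) (hR : ∀ w ∈ Set.Icc M₁ M₂, ∀ y, fMix p gμ √w y * g w y = R w y)
    (hRB : ∀ w ∈ Set.Icc M₁ M₂, ∀ y, |R w y| ≤ (√M₁)⁻¹)
    (hRL : ∀ u ∈ Set.Icc M₁ M₂, ∀ w ∈ Set.Icc M₁ M₂, ∀ x y,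
      |R w y - R u x| ≤ 3 / M₁ * (|√u - √w| + |x - y|)) :
    Negligible P fun m i ω => |∑ j : Fin m, varWeight (hs m) (fun k : Fin m => V k ω) i j *
      (g (V j ω) (X j ω) * phi (hx m * √(V j ω)) (X i ω - X j ω)) - R (V i ω) (X i ω)| := by
  have ha : 0 < √M₁ := Real.sqrt_pos.2 hM₁
  have hpos : ∀ {v}, v ∈ Set.Icc M₁ M₂ → 0 < v := fun hv => hM₁.trans_le hv.1
  refine negligible_kernelAverage_sub hp0 hp1 hmodel hM hS hs0 hslim
    (H := fun m => smoothingKernel (hx m) g) (D := fun m => (hx m * √M₁)⁻¹)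
    (τ := fun m => hx m * √M₂) (B := (√M₁)⁻¹) (L := 3 / M₁) (R := R) (fun m => ?_)
    (fun m => inv_nonneg.2 (mul_nonneg (hx0 m).le ha.le)) (by positivity) (by positivity)
    (fun m => mul_nonneg (hx0 m).le (Real.sqrt_nonneg _)) (by simpa using hxlim.mul_const √M₂)
    (fun m u hu w hw x y => ⟨?_, ?_⟩) (fun m u hu w hw x => ?_) hRB (fun m u hu w hw x => ?_)
    hlimD hlim
  · unfold smoothingKernel
    have := hg.comp (by fun_prop : Measurable fun q : (ℝ × ℝ) × (ℝ × ℝ) => (q.1.2, q.2.2))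
    simp only [Function.comp_def] at this
    fun_prop
  · exact mul_nonneg (hg01 w hw y).1 (phi_nonneg (mul_nonneg (hx0 m).le (Real.sqrt_nonneg _)) _)
  · exact (mul_le_of_le_one_left (phi_nonneg (mul_nonneg (hx0 m).le (Real.sqrt_nonneg _)) _)
      (hg01 w hw y).2).trans (phi_mul_sqrt_le hM₁ (hx0 m) hw _)
  · refine (kernelMean_smoothingKernel_le hp0 hp1 (hx0 m) (hpos hw) (hg01 w hw)).trans ?_
    gcongr
    exact hw.1
  · refine (kernelMean_smoothingKernel_sub_le hp0 hp1 (hx0 m) (hpos hw) (hR w hw) (hRm w)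
      (hRB w hw) (by positivity) (fun y => hRL u hu w hw x y)).trans ?_
    have := (hx0 m).le
    gcongr
    exact hw.2

lemma negligible_fStarHat_sub :
    Negligible P fun m i ω => |fStarHat (hx m) (hs m) (fun k : Fin m => X k ω)
      (fun k : Fin m => √(V k ω)) √(V i ω) (X i ω) - fMix p gμ √(V i ω) (X i ω)| := by
  have ha : 0 < √M₁ := Real.sqrt_pos.2 hM₁
  have hσ : ∀ {v}, v ∈ Set.Icc M₁ M₂ → √M₁ ≤ √v := fun hv => Real.sqrt_le_sqrt hv.1
  refine (negligible_smoothing_sub hp0 hp1 hmodel hM₁ hM hS hx0 hs0 hxlim hslim hlimD hlim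
    (g := fun _ _ => 1) (R := fun w y => fMix p gμ √w y) (by fun_prop) (fun _ _ _ => by simp)
    (fun w => by fun_prop) (fun _ _ _ => mul_one _) (fun w hw y => ?_)
    (fun u hu w hw x y => ?_)).mono (Eventually.of_forall fun m i => Eventually.of_forall
      fun ω => ?_)
  · rw [abs_of_pos (fMix_pos hp0 hp1 (ha.trans_le (hσ hw)) y)]
    refine (fMix_le_inv hp0 hp1 (ha.trans_le (hσ hw)) y).trans ?_
    gcongr
    exact hw.1
  · have := abs_fMix_sub_fMix_le (gμ := gμ) hp0 hp1 ha (hσ hw) (hσ hu) y x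
    rwa [Real.sq_sqrt hM₁.le, abs_sub_comm (√w), abs_sub_comm y] at this
  · simp only [fStarHat, one_mul]
    exact le_rfl

lemma negligible_weighted_phi_sub :
    Negligible P fun m i ω => |∑ j : Fin m, varWeight (hs m) (fun k : Fin m => V k ω) i j *
      ((1 - unitT p gμ V X j ω) * phi (hx m * √(V j ω)) (X i ω - X j ω))
        - p * f1 gμ √(V i ω) (X i ω)| := by
  have ha : 0 < √M₁ := Real.sqrt_pos.2 hM₁
  have hσ : ∀ {v}, v ∈ Set.Icc M₁ M₂ → √M₁ ≤ √v := fun hv => Real.sqrt_le_sqrt hv.1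
  refine negligible_smoothing_sub hp0 hp1 hmodel hM₁ hM hS hx0 hs0 hxlim hslim hlimD hlim
    (g := fun w y => 1 - oracleT p gμ y √w) (R := fun w y => p * f1 gμ √w y) (by fun_prop)
    (fun w _ y => ⟨?_, ?_⟩) (fun w => by fun_prop) (fun w hw y => ?_) (fun w hw y => ?_)
    (fun u hu w hw x y => ?_)
  · linarith [oracleT_le_one (gμ := gμ) hp0.le hp1.le (Real.sqrt_nonneg w) y]
  · linarith [oracleT_nonneg (gμ := gμ) hp0.le hp1.le (Real.sqrt_nonneg w) y]
  · rw [mul_comm]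
    exact one_sub_oracleT_mul_fMix hp0 hp1 (ha.trans_le (hσ hw)) y
  · have h0 := f1_nonneg (gμ := gμ) (Real.sqrt_nonneg w) y
    rw [abs_of_nonneg (mul_nonneg hp0.le h0)]
    refine (mul_le_of_le_one_left h0 hp1.le).trans ((f1_le_inv (ha.trans_le (hσ hw)) y).trans ?_)
    gcongr
    exact hw.1
  · have := abs_f1_sub_f1_le (gμ := gμ) ha (hσ hw) (hσ hu) y x
    rw [Real.sq_sqrt hM₁.le, abs_sub_comm (√w), abs_sub_comm y] at this
    rw [← mul_sub, abs_mul, abs_of_pos hp0]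
    exact (mul_le_of_le_one_left (abs_nonneg _) hp1.le).trans this

omit hx0 hxlim hlimD hM₁ in
lemma negligible_weighted_sub (hM₁ : 0 < M₁) :
    Negligible P fun m i ω => |∑ j : Fin m, varWeight (hs m) (fun k : Fin m => V k ω) i j *
      (1 - unitT p gμ V X j ω) - p| := by
  refine negligible_kernelAverage_sub hp0 hp1 hmodel hM hS hs0 hslim
    (H := fun _ _ w _ y => 1 - oracleT p gμ y √w) (D := fun _ => 1)
    (τ := fun _ => 0) (B := 1) (L := 0) (R := fun _ _ => p) (fun m => by fun_prop)
    (fun m => zero_le_one) zero_le_one le_rfl (fun m => le_rfl) tendsto_const_nhds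
    (fun m u hu w hw x y => ⟨?_, ?_⟩) (fun m u hu w hw x => ?_) (fun u hu x => ?_)
    (fun m u hu w hw x => ?_) (by simpa using hlim) hlim
  · linarith [oracleT_le_one (gμ := gμ) hp0.le hp1.le (Real.sqrt_nonneg w) y]
  · linarith [oracleT_nonneg (gμ := gμ) hp0.le hp1.le (Real.sqrt_nonneg w) y]
  · rw [kernelMean, integral_one_sub_oracleT hp0 hp1 (hM₁.trans_le hw.1)]
    exact hp1.le
  · rw [abs_of_pos hp0]; exact hp1.le
  · rw [kernelMean, integral_one_sub_oracleT hp0 hp1 (hM₁.trans_le hw.1)]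
    simp

omit hx0 hs0 hxlim hslim hlimD hlim hM₁ hM hS in
-- All the pairs (V i, X i) have the same law, and a real function of one law is tight; so the bound
-- K is uniform in i.
lemma tight_of_law {Ψ : ℝ × ℝ → ℝ} (hΨ : Measurable Ψ) :
    ∀ η > 0, ∃ K > 0, ∀ i, P.real {ω | K < Ψ (V i ω, X i ω)} ≤ η := by
  intro η hη
  have hm : ∀ i, Measurable fun ω => ((μ i ω, V i ω), X i ω) := fun i => by
    have := hmodel.measurable_effect i
    have := hmodel.measurable_var i
    have := hmodel.measurable_obs i
    fun_prop
  have hset : ∀ K, MeasurableSet {q : (ℝ × ℝ) × ℝ | K < Ψ (q.1.2, q.2)} := fun K =>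
    measurableSet_lt measurable_const (by fun_prop)
  have hlaw : ∀ i K, P {ω | K < Ψ (V i ω, X i ω)}
      = unitLaw p gμ gσ {q | K < Ψ (q.1.2, q.2)} := fun i K => by
    rw [← hmodel.law i, Measure.map_apply (hm i) (hset K)]; rfl
  have hfin : IsProbabilityMeasure (unitLaw p gμ gσ) := by
    rw [← hmodel.law 0]; exact Measure.isProbabilityMeasure_map (hm 0).aemeasurable
  have htend : Tendsto (fun n : ℕ => unitLaw p gμ gσ {q | (n : ℝ) < Ψ (q.1.2, q.2)}) atTop
      (𝓝 (unitLaw p gμ gσ (⋂ n : ℕ, {q | (n : ℝ) < Ψ (q.1.2, q.2)}))) := by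
    refine tendsto_measure_iInter_atTop (fun n => (hset n).nullMeasurableSet) ?_
      ⟨0, measure_ne_top _ _⟩
    intro a b hab q hq
    simp only [Set.mem_ofPred_eq] at hq ⊢
    exact lt_of_le_of_lt (by exact_mod_cast hab) hq
  have hempty : (⋂ n : ℕ, {q : (ℝ × ℝ) × ℝ | (n : ℝ) < Ψ (q.1.2, q.2)}) = ∅ := by
    refine Set.eq_empty_of_forall_notMem fun q hq => ?_
    obtain ⟨n, hn⟩ := exists_nat_ge (Ψ (q.1.2, q.2))
    have := Set.mem_iInter.1 hq n
    simp only [Set.mem_ofPred_eq] at this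
    linarith
  rw [hempty, measure_empty] at htend
  obtain ⟨n, hn1, hn0⟩ := ((htend.eventually_lt_const (ENNReal.ofReal_pos.2 hη)).and
    (eventually_gt_atTop 0)).exists
  refine ⟨n, by exact_mod_cast hn0, fun i => ?_⟩
  rw [Measure.real, hlaw i]
  exact ENNReal.toReal_le_of_le_ofReal hη.le hn1.le

end Consistency

/-! ### Ranges, kernel-average form and measurability of the statistics -/

section Statistics

variable {m : ℕ} {hx hs : ℝ} (hx0 : 0 < hx) (hs0 : 0 < hs) {x s : Fin m → ℝ}

include hx0 hs0 in
lemma fStarHat_nonneg (hsj : ∀ j, 0 ≤ s j) (σ y : ℝ) : 0 ≤ fStarHat hx hs x s σ y :=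
  Finset.sum_nonneg fun j _ => mul_nonneg (div_nonneg (phi_nonneg hs0.le _)
    (Finset.sum_nonneg fun _ _ => phi_nonneg hs0.le _))
    (phi_nonneg (mul_nonneg hx0.le (hsj j)) _)

include hx0 hs0 in
lemma fStarHat_pos (hsj : ∀ j, 0 < s j) (i : Fin m) (y : ℝ) :
    0 < fStarHat hx hs x s (s i) y :=
  Finset.sum_pos (fun j _ => mul_pos (kernelWeight_pos hs0 s i j)
    (phi_pos (mul_pos hx0 (hsj j)) _)) ⟨i, Finset.mem_univ i⟩

include hx0 hs0 in
lemma f1Hat_nonneg (hsj : ∀ j, 0 ≤ s j) {w : Fin m → ℝ} (hw : ∀ j, 0 ≤ w j) (σ y : ℝ) :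
    0 ≤ f1Hat hx hs x s w σ y :=
  Finset.sum_nonneg fun j _ => mul_nonneg (div_nonneg (mul_nonneg (hw j) (phi_nonneg hs0.le _))
    (Finset.sum_nonneg fun k _ => mul_nonneg (hw k) (phi_nonneg hs0.le _)))
    (phi_nonneg (mul_nonneg hx0.le (hsj j)) _)

include hs0 in
-- The estimate becomes a quotient of two kernel averages with the same unweighted kernel weights,
-- to which the limit theorems apply separately.
lemma f1Hat_eq_div (w : Fin m → ℝ) (i : Fin m) (y : ℝ) :
    f1Hat hx hs x s w (s i) y = (∑ j, kernelWeight hs s i j * (w j * phi (hx * s j) (y - x j))) /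
      ∑ j, kernelWeight hs s i j * w j := by
  have h0 := (sum_phi_pos hs0 s i).ne'
  have e1 : ∑ j, kernelWeight hs s i j * (w j * phi (hx * s j) (y - x j))
      = (∑ j, w j * phi hs (s i - s j) * phi (hx * s j) (y - x j)) /
        ∑ k, phi hs (s i - s k) := by
    rw [Finset.sum_div]
    exact Finset.sum_congr rfl fun j _ => by rw [kernelWeight]; ring
  have e2 : ∑ j, kernelWeight hs s i j * w j
      = (∑ j, w j * phi hs (s i - s j)) / ∑ k, phi hs (s i - s k) := by
    rw [Finset.sum_div]
    exact Finset.sum_congr rfl fun j _ => by rw [kernelWeight]; ring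
  rw [e1, e2, div_div_div_cancel_right₀ h0, f1Hat, Finset.sum_div]
  exact Finset.sum_congr rfl fun j _ => by ring

include hx0 hs0

lemma That0_mem_Icc (hsj : ∀ j, 0 ≤ s j) {q : ℝ} (hq : q ≤ 1) (j : Fin m) :
    That0 hx hs q x s j ∈ Set.Icc (0 : ℝ) 1 :=
  ⟨le_min (div_nonneg (mul_nonneg (by linarith) (phi_nonneg (hsj j) _))
    (fStarHat_nonneg hx0 hs0 hsj _ _)) zero_le_one, min_le_right _ _⟩

lemma updateT_mem_Icc (hsj : ∀ j, 0 ≤ s j) {q : ℝ} (hq0 : 0 ≤ q) (hq : q ≤ 1) {T : Fin m → ℝ}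
    (hT : ∀ j, T j ≤ 1) (j : Fin m) : updateT hx hs q x s T j ∈ Set.Icc (0 : ℝ) 1 := by
  have h1 : 0 ≤ (1 - q) * f0 (s j) (x j) := mul_nonneg (by linarith) (phi_nonneg (hsj j) _)
  have h2 : 0 ≤ q * f1Hat hx hs x s (fun k => 1 - T k) (s j) (x j) :=
    mul_nonneg hq0 (f1Hat_nonneg hx0 hs0 hsj (fun k => by linarith [hT k]) _ _)
  exact ⟨div_nonneg h1 (add_nonneg h1 h2), div_le_one_of_le₀ (by linarith) (add_nonneg h1 h2)⟩

omit hx0 hs0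

variable {α : Type*} [MeasurableSpace α] {q : α → ℝ} {X S T : α → Fin m → ℝ}

lemma measurable_That0 (hq : Measurable q) (hX : Measurable X) (hS : Measurable S) (j : Fin m) :
    Measurable fun a => That0 hx hs (q a) (X a) (S a) j := by
  unfold That0 fStarHat; fun_prop

lemma measurable_updateT (hq : Measurable q) (hX : Measurable X) (hS : Measurable S)
    (hT : Measurable T) (j : Fin m) :
    Measurable fun a => updateT hx hs (q a) (X a) (S a) (T a) j := by
  unfold updateT f1Hat; fun_prop

lemma measurable_That (hq : Measurable q) (hX : Measurable X) (hS : Measurable S) :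
    Measurable fun a => That hx hs (q a) (X a) (S a) := by
  unfold That
  refine measurable_pi_lambda _ fun j => measurable_updateT hq hX hS ?_ j
  refine measurable_pi_lambda _ fun j => measurable_updateT hq hX hS ?_ j
  exact measurable_pi_lambda _ fun j => measurable_That0 hq hX hS j

end Statistics

/-! ### Consistency of the initial statistics and of the updates -/

section Consistency

variable {Ω : Type*} [MeasurableSpace Ω] {P : Measure Ω} [IsProbabilityMeasure P]
  {gμ gσ : Measure ℝ} [IsProbabilityMeasure gμ] [IsProbabilityMeasure gσ] {p : ℝ}
  (hp0 : 0 < p) (hp1 : p < 1) {μ V X : ℕ → Ω → ℝ} (hmodel : IsModel P p gμ gσ μ V X)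
  {M₁ M₂ : ℝ} (hM₁ : 0 < M₁) (hM : M₁ ≤ M₂) (hS : ∀ᵐ v ∂gσ, v ∈ Set.Icc M₁ M₂)
  {hx hs : ℕ → ℝ} (hx0 : ∀ m, 0 < hx m) (hs0 : ∀ m, 0 < hs m)
  (hxlim : Tendsto hx atTop (𝓝 0)) (hslim : Tendsto hs atTop (𝓝 0))
  (hlimD : Tendsto (fun m : ℕ => (hx m * √M₁)⁻¹ * diagBound M₁ M₂ (hs m) / m) atTop (𝓝 0))
  (hlim : Tendsto (fun m : ℕ => diagBound M₁ M₂ (hs m) / m) atTop (𝓝 0))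
  {phat : ℕ → Ω → ℝ} (hphat_meas : ∀ m, Measurable (phat m))
  (hphat : TendstoInMeasure P phat atTop (fun _ => p))

include hp0 hp1 hmodel hM₁ hS in
/-- An array is negligible if its product with the marginal densities is. -/
lemma Negligible.of_mul_fMix {a : (m : ℕ) → Fin m → Ω → ℝ}
    (h : Negligible P fun m i ω => a m i ω * fMix p gμ √(V i ω) (X i ω)) : Negligible P a := by
  have hVS := ae_forall_var_mem hmodel hS
  have hf0 : ∀ v x, 0 ≤ fMix p gμ √v x := fun v x => add_nonneg (mul_nonneg (by linarith)
    (phi_nonneg (Real.sqrt_nonneg v) x)) (mul_nonneg hp0.le (f1_nonneg (Real.sqrt_nonneg v) x))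
  have ht := tight_of_law hp0 hp1 hmodel (Ψ := fun q => (fMix p gμ √q.1 q.2)⁻¹) (by fun_prop)
  refine (h.mul_tight (c := fun i ω => (fMix p gμ √(V i ω) (X i ω))⁻¹)
    (fun i ω => inv_nonneg.2 (hf0 _ _)) ht).mono (Eventually.of_forall fun m i => ?_)
  filter_upwards [hVS] with ω hω
  have := fMix_pos (gμ := gμ) hp0 hp1 (Real.sqrt_pos.2 (hM₁.trans_le (hω i).1)) (X i ω)
  rw [mul_assoc, mul_inv_cancel₀ this.ne', mul_one]

include hp0 hp1 hmodel hM₁ hM hS hx0 hs0 hxlim hslim hlimD hlim hphat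

lemma negligible_That0_sub :
    Negligible P fun m i ω => |That0 (hx m) (hs m) (phat m ω) (fun k : Fin m => X k ω)
      (fun k : Fin m => √(V k ω)) i - unitT p gμ V X i ω| := by
  have hVS := ae_forall_var_mem hmodel hS
  have ha : 0 < √M₁ := Real.sqrt_pos.2 hM₁
  refine Negligible.of_mul_fMix hp0 hp1 hmodel hM₁ hS ?_
  have hF := negligible_fStarHat_sub hp0 hp1 hmodel hM₁ hM hS hx0 hs0 hxlim hslim hlimD hlim
  have hq := Negligible.of_tendstoInMeasure hphat
  refine (hq.add hF).of_imp fun ε hε => ?_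
  -- C collects 2|A' - A| + |F' - f|, where |A' - A| is at most the error of `phat` times the bound
  -- (√M₁)⁻¹ for `f0`. The bound (1 - p)/2 below keeps `phat` under 1, so that A' > 0.
  obtain ⟨C, hC⟩ : ∃ C, C = 2 * (√M₁)⁻¹ + 1 := ⟨_, rfl⟩
  have hC0 : 0 < C := by rw [hC]; positivity
  refine ⟨min ((1 - p) / 2) (ε / C), lt_min (by linarith) (by positivity),
    Eventually.of_forall fun m i => ?_⟩
  filter_upwards [hVS] with ω hω hle
  have hσ : ∀ k, 0 < √(V k ω) := fun k => Real.sqrt_pos.2 (hM₁.trans_le (hω k).1)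
  have hq1 : |phat m ω - p| ≤ min ((1 - p) / 2) (ε / C) := by
    linarith [abs_nonneg (fStarHat (hx m) (hs m) (fun k : Fin m => X k ω)
      (fun k : Fin m => √(V k ω)) √(V i ω) (X i ω) - fMix p gμ √(V i ω) (X i ω))]
  have hF1 : |fStarHat (hx m) (hs m) (fun k : Fin m => X k ω)
      (fun k : Fin m => √(V k ω)) √(V i ω) (X i ω) - fMix p gμ √(V i ω) (X i ω)|
        ≤ min ((1 - p) / 2) (ε / C) := by
    linarith [abs_nonneg (phat m ω - p)]
  have hqlt : phat m ω < 1 := by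
    linarith [(abs_le.1 (hq1.trans (min_le_left _ _))).2]
  have hf0 : 0 < f0 √(V i ω) (X i ω) := phi_pos (hσ i) _
  have hfm := fMix_pos (gμ := gμ) hp0 hp1 (hσ i) (X i ω)
  have hf0le : f0 √(V i ω) (X i ω) ≤ (√M₁)⁻¹ := by
    refine (phi_le_inv (hσ i) _).trans ?_
    gcongr
    exact (hω i).1
  have key := abs_min_ratio_sub_ratio_le (A := (1 - p) * f0 √(V i ω) (X i ω))
    (B := p * f1 gμ √(V i ω) (X i ω)) (A' := (1 - phat m ω) * f0 √(V i ω) (X i ω))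
    (mul_nonneg (by linarith) hf0.le) (mul_nonneg hp0.le (f1_nonneg (hσ i).le _))
    (mul_pos (by linarith) hf0) (fStarHat_pos (x := fun k : Fin m => X k ω)
      (s := fun k : Fin m => √(V k ω)) (hx0 m) (hs0 m) (fun j => hσ j) i (X i ω)) hfm
  change |That0 (hx m) (hs m) (phat m ω) (fun k : Fin m => X k ω)
      (fun k : Fin m => √(V k ω)) i - unitT p gμ V X i ω| ≤ _ / fMix p gμ √(V i ω) (X i ω) at key
  rw [le_div_iff₀ hfm] at key
  refine key.trans ?_
  have e1 : |(1 - phat m ω) * f0 √(V i ω) (X i ω) - (1 - p) * f0 √(V i ω) (X i ω)|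
      ≤ ε / C * (√M₁)⁻¹ := by
    rw [← sub_mul, abs_mul, abs_of_pos hf0]
    refine mul_le_mul ?_ hf0le hf0.le (by positivity)
    rw [show 1 - phat m ω - (1 - p) = -(phat m ω - p) by ring, abs_neg]
    exact hq1.trans (min_le_right _ _)
  have e2 := hF1.trans (min_le_right _ _)
  have e3 : ε / C * C = ε := div_mul_cancel₀ _ hC0.ne'
  rw [hC] at e1 e2 e3
  change 2 * _ + |_ - fMix p gμ √(V i ω) (X i ω)| ≤ ε
  nlinarith

include hphat_meas

/-- One update of consistent statistics gives consistent statistics. -/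
lemma negligible_updateT_sub {T : (m : ℕ) → Ω → Fin m → ℝ} (hTm : ∀ m, Measurable (T m))
    (hT01 : ∀ m ω i, phat m ω ∈ Set.Ioo (0 : ℝ) 1 → T m ω i ∈ Set.Icc (0 : ℝ) 1)
    (hT : Negligible P fun m i ω => |T m ω i - unitT p gμ V X i ω|) :
    Negligible P fun m i ω => |updateT (hx m) (hs m) (phat m ω) (fun k : Fin m => X k ω)
      (fun k : Fin m => √(V k ω)) (T m ω) i - unitT p gμ V X i ω| := by
  have hVS := ae_forall_var_mem hmodel hS
  have hUm := fun i => measurable_unitT (p := p) (gμ := gμ) hmodel i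
  have ha : 0 < √M₁ := Real.sqrt_pos.2 hM₁
  have hU01 := fun i ω => unitT_mem_Icc (gμ := gμ) (V := V) (X := X) hp0 hp1 i ω
  -- The statistics are known to lie in [0, 1] only when `phat` is in (0, 1). Truncating the errors
  -- at 1 gives an array in [0, 1] everywhere; on the event used below the truncation is void
  -- (`hemin`).
  have hem : ∀ (m : ℕ) (i : Fin m), Measurable fun ω => min |T m ω i - unitT p gμ V X i ω| 1 :=
    fun m i => by
      have h1 := (measurable_pi_apply i).comp (hTm m)
      exact ((h1.sub (hUm i)).abs).min measurable_const
  have he01 : ∀ (m : ℕ) (i : Fin m) ω, min |T m ω i - unitT p gμ V X i ω| 1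
      ∈ Set.Icc (0 : ℝ) 1 := fun m i ω => ⟨le_min (abs_nonneg _) zero_le_one, min_le_right _ _⟩
  have heN : Negligible P fun (m : ℕ) (i : Fin m) ω => min |T m ω i - unitT p gμ V X i ω| 1 :=
    hT.mono (Eventually.of_forall fun m i => Eventually.of_forall fun ω => min_le_left _ _)
  have n1 := negligible_sum_varWeight_mul hmodel hs0 hem he01 heN
  have n2 := negligible_sum_varWeight_mul_phi hp0 hp1 hmodel hM₁ hM hS hs0 hem he01 heN hx0 hlimD
  have n3 := negligible_weighted_phi_sub hp0 hp1 hmodel hM₁ hM hS hx0 hs0 hxlim hslim hlimD hlim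
  have n4 := negligible_weighted_sub hp0 hp1 hmodel hM hS hs0 hslim hlim hM₁
  have n5 := Negligible.of_tendstoInMeasure hphat
  refine Negligible.of_mul_fMix hp0 hp1 hmodel hM₁ hS ?_
  refine ((((n1.add n4).add (n2.add n3)).add n5)).of_imp fun ε hε => ?_
  -- The first summand bounds the null part; the second is the constant of `abs_mul_div_sub_le` with
  -- f₁ ≤ (√M₁)⁻¹. The bounds (1 - p)/2 and p/2 on δ force `phat` into (0, 1).
  obtain ⟨C, hC⟩ : ∃ C, C = (√M₁)⁻¹ + 2 * (1 + 2 * (√M₁)⁻¹) / p := ⟨_, rfl⟩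
  have hC0 : 0 < C := by rw [hC]; positivity
  obtain ⟨δ, hδ⟩ : ∃ δ, δ = min (min ((1 - p) / 2) (p / 2)) (ε / C) := ⟨_, rfl⟩
  have hδ1 : δ ≤ (1 - p) / 2 := hδ ▸ (min_le_left _ _).trans (min_le_left _ _)
  have hδ2 : δ ≤ p / 2 := hδ ▸ (min_le_left _ _).trans (min_le_right _ _)
  have hδ3 : δ ≤ ε / C := hδ ▸ min_le_right _ _
  refine ⟨δ, hδ ▸ lt_min (lt_min (by linarith) (by linarith)) (by positivity),
    Eventually.of_forall fun m i => ?_⟩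
  filter_upwards [hVS] with ω hω hle
  have hσ : ∀ k, 0 < √(V k ω) := fun k => Real.sqrt_pos.2 (hM₁.trans_le (hω k).1)
  have hw0 : ∀ j, 0 ≤ varWeight (hs m) (fun k : Fin m => V k ω) i j := fun j =>
    varWeight_nonneg (hs0 m) _ i j
  have hφ0 : ∀ j : Fin m, 0 ≤ phi (hx m * √(V j ω)) (X i ω - X j ω) := fun j =>
    (phi_pos (mul_pos (hx0 m) (hσ j)) _).le
  have hn1 : 0 ≤ ∑ j, varWeight (hs m) (fun k : Fin m => V k ω) i j *
      min |T m ω j - unitT p gμ V X j ω| 1 :=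
    Finset.sum_nonneg fun j _ => mul_nonneg (hw0 j) (he01 m j ω).1
  have hn2 : 0 ≤ ∑ j, varWeight (hs m) (fun k : Fin m => V k ω) i j *
      phi (hx m * √(V j ω)) (X i ω - X j ω) * min |T m ω j - unitT p gμ V X j ω| 1 :=
    Finset.sum_nonneg fun j _ => mul_nonneg (mul_nonneg (hw0 j) (hφ0 j)) (he01 m j ω).1
  have hn3 := abs_nonneg (∑ j : Fin m, varWeight (hs m) (fun k : Fin m => V k ω) i j *
      ((1 - unitT p gμ V X j ω) * phi (hx m * √(V j ω)) (X i ω - X j ω))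
        - p * f1 gμ √(V i ω) (X i ω))
  have hn4 := abs_nonneg (∑ j : Fin m, varWeight (hs m) (fun k : Fin m => V k ω) i j *
      (1 - unitT p gμ V X j ω) - p)
  have hq1 : |phat m ω - p| ≤ δ := by linarith
  have hn5 := abs_nonneg (phat m ω - p)
  have hq := abs_le.1 hq1
  have hqlt : phat m ω < 1 := by linarith
  have hqpos : 0 < phat m ω := by linarith
  have hT' := fun j => hT01 m ω j ⟨hqpos, hqlt⟩
  have hemin : ∀ j : Fin m, min |T m ω j - unitT p gμ V X j ω| 1
      = |T m ω j - unitT p gμ V X j ω| := fun j => by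
    refine min_eq_left (abs_le.2 ⟨?_, ?_⟩) <;>
      linarith [(hT' j).1, (hT' j).2, (hU01 j ω).1, (hU01 j ω).2]
  have hA : |∑ j : Fin m, varWeight (hs m) (fun k : Fin m => V k ω) i j *
      ((1 - T m ω j) * phi (hx m * √(V j ω)) (X i ω - X j ω)) - p * f1 gμ √(V i ω) (X i ω)|
      ≤ δ := by
    have e1 : |∑ j : Fin m, varWeight (hs m) (fun k : Fin m => V k ω) i j *
        ((1 - T m ω j) * phi (hx m * √(V j ω)) (X i ω - X j ω)) -
        ∑ j : Fin m, varWeight (hs m) (fun k : Fin m => V k ω) i j *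
          ((1 - unitT p gμ V X j ω) * phi (hx m * √(V j ω)) (X i ω - X j ω))|
        ≤ ∑ j, varWeight (hs m) (fun k : Fin m => V k ω) i j *
          phi (hx m * √(V j ω)) (X i ω - X j ω) * min |T m ω j - unitT p gμ V X j ω| 1 := by
      rw [← Finset.sum_sub_distrib]
      refine (Finset.abs_sum_le_sum_abs _ _).trans (Finset.sum_le_sum fun j _ => le_of_eq ?_)
      rw [hemin j, show varWeight (hs m) (fun k : Fin m => V k ω) i j *
          ((1 - T m ω j) * phi (hx m * √(V j ω)) (X i ω - X j ω)) -
          varWeight (hs m) (fun k : Fin m => V k ω) i j *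
          ((1 - unitT p gμ V X j ω) * phi (hx m * √(V j ω)) (X i ω - X j ω))
          = -(varWeight (hs m) (fun k : Fin m => V k ω) i j *
          phi (hx m * √(V j ω)) (X i ω - X j ω) * (T m ω j - unitT p gμ V X j ω)) by ring,
        abs_neg, abs_mul, abs_of_nonneg (mul_nonneg (hw0 j) (hφ0 j))]
    refine (abs_sub_le _ _ _).trans ((add_le_add_left e1 _).trans ?_)
    linarith
  have hB : |∑ j : Fin m, varWeight (hs m) (fun k : Fin m => V k ω) i j * (1 - T m ω j) - p|
      ≤ δ := by
    have e1 : |∑ j : Fin m, varWeight (hs m) (fun k : Fin m => V k ω) i j * (1 - T m ω j) -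
        ∑ j : Fin m, varWeight (hs m) (fun k : Fin m => V k ω) i j * (1 - unitT p gμ V X j ω)|
        ≤ ∑ j, varWeight (hs m) (fun k : Fin m => V k ω) i j *
          min |T m ω j - unitT p gμ V X j ω| 1 := by
      rw [← Finset.sum_sub_distrib]
      refine (Finset.abs_sum_le_sum_abs _ _).trans (Finset.sum_le_sum fun j _ => le_of_eq ?_)
      rw [hemin j, show varWeight (hs m) (fun k : Fin m => V k ω) i j * (1 - T m ω j) -
          varWeight (hs m) (fun k : Fin m => V k ω) i j * (1 - unitT p gμ V X j ω)
          = -(varWeight (hs m) (fun k : Fin m => V k ω) i j *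
            (T m ω j - unitT p gμ V X j ω)) by ring, abs_neg, abs_mul, abs_of_nonneg (hw0 j)]
    refine (abs_sub_le _ _ _).trans ((add_le_add_left e1 _).trans ?_)
    linarith
  have hf0 : 0 < f0 √(V i ω) (X i ω) := phi_pos (hσ i) _
  have hf1 : 0 ≤ f1 gμ √(V i ω) (X i ω) := f1_nonneg (hσ i).le _
  have hinv : (√(V i ω))⁻¹ ≤ (√M₁)⁻¹ := by
    gcongr
    exact (hω i).1
  have hfm := fMix_pos (gμ := gμ) hp0 hp1 (hσ i) (X i ω)
  have hf1le : f1 gμ √(V i ω) (X i ω) ≤ (√M₁)⁻¹ := (f1_le_inv (hσ i) _).trans hinv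
  have hf0le : f0 √(V i ω) (X i ω) ≤ (√M₁)⁻¹ := (phi_le_inv (hσ i) _).trans hinv
  have hratio := abs_mul_div_sub_le hp0 hq1 hqlt.le hqpos.le hA hB hδ2 hp1.le hf1 hf1le
  have ef : f1Hat (hx m) (hs m) (fun k : Fin m => X k ω) (fun k : Fin m => √(V k ω))
      (fun k => 1 - T m ω k) √(V i ω) (X i ω)
      = (∑ j : Fin m, varWeight (hs m) (fun k : Fin m => V k ω) i j *
      ((1 - T m ω j) * phi (hx m * √(V j ω)) (X i ω - X j ω))) /
      ∑ j : Fin m, varWeight (hs m) (fun k : Fin m => V k ω) i j * (1 - T m ω j) :=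
    f1Hat_eq_div (hs0 m) (x := fun k : Fin m => X k ω) (s := fun k : Fin m => √(V k ω))
      (fun k => 1 - T m ω k) i (X i ω)
  rw [← ef] at hratio
  have key := abs_ratio_sub_ratio_le (A := (1 - p) * f0 √(V i ω) (X i ω))
    (B := p * f1 gμ √(V i ω) (X i ω)) (A' := (1 - phat m ω) * f0 √(V i ω) (X i ω))
    (B' := phat m ω * f1Hat (hx m) (hs m) (fun k : Fin m => X k ω) (fun k : Fin m => √(V k ω))
      (fun k => 1 - T m ω k) √(V i ω) (X i ω))
    (mul_nonneg (by linarith) hf0.le) (mul_nonneg hp0.le hf1)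
    (mul_nonneg (by linarith) hf0.le) (mul_nonneg hqpos.le (f1Hat_nonneg (hx0 m) (hs0 m)
      (fun j => (hσ j).le) (fun j => by linarith [(hT' j).2]) _ _)) hfm
  change |updateT (hx m) (hs m) (phat m ω) (fun k : Fin m => X k ω)
      (fun k : Fin m => √(V k ω)) (T m ω) i - unitT p gμ V X i ω|
      ≤ _ / fMix p gμ √(V i ω) (X i ω) at key
  rw [le_div_iff₀ hfm] at key
  refine key.trans ?_
  have e1 : |(1 - phat m ω) * f0 √(V i ω) (X i ω) - (1 - p) * f0 √(V i ω) (X i ω)|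
      ≤ δ * (√M₁)⁻¹ := by
    rw [← sub_mul, abs_mul, abs_of_pos hf0]
    refine mul_le_mul ?_ hf0le hf0.le (hn5.trans hq1)
    rw [show 1 - phat m ω - (1 - p) = -(phat m ω - p) by ring, abs_neg]
    exact hq1
  calc _ ≤ δ * (√M₁)⁻¹ + 2 * (1 + 2 * (√M₁)⁻¹) / p * δ := add_le_add e1 hratio
    _ = δ * C := by rw [hC]; ring
    _ ≤ ε / C * C := by gcongr
    _ = ε := div_mul_cancel₀ _ hC0.ne'

/-- The data-driven statistics are consistent for the oracle statistics. -/
theorem negligible_dataT_sub :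
    Negligible P fun m i ω => |dataT hx hs phat V X m ω i - unitT p gμ V X i ω| := by
  have hVm := hmodel.measurable_var
  have hXm := hmodel.measurable_obs
  have hsm : ∀ m : ℕ, Measurable fun ω => fun k : Fin m => √(V k ω) := fun m => by fun_prop
  have hxm : ∀ m : ℕ, Measurable fun ω => fun k : Fin m => X k ω := fun m => by fun_prop
  have h0m : ∀ m : ℕ, Measurable fun ω => That0 (hx m) (hs m) (phat m ω)
      (fun k : Fin m => X k ω) (fun k : Fin m => √(V k ω)) := fun m =>
    measurable_pi_lambda _ fun j => measurable_That0 (hphat_meas m) (hxm m) (hsm m) j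
  have h0 := negligible_That0_sub hp0 hp1 hmodel hM₁ hM hS hx0 hs0 hxlim hslim hlimD hlim hphat
  have h1 := negligible_updateT_sub hp0 hp1 hmodel hM₁ hM hS hx0 hs0 hxlim hslim hlimD hlim
    hphat_meas hphat h0m (fun m ω i hq => That0_mem_Icc (hx0 m) (hs0 m)
      (fun j => Real.sqrt_nonneg _) hq.2.le i) h0
  refine negligible_updateT_sub hp0 hp1 hmodel hM₁ hM hS hx0 hs0 hxlim hslim hlimD hlim
    hphat_meas hphat (fun m => measurable_pi_lambda _ fun j =>
      measurable_updateT (hphat_meas m) (hxm m) (hsm m) (h0m m) j)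
    (fun m ω i hq => updateT_mem_Icc (hx0 m) (hs0 m) (fun j => Real.sqrt_nonneg _) hq.1.le
      hq.2.le (fun j => (That0_mem_Icc (hx0 m) (hs0 m)
      (fun j => Real.sqrt_nonneg _) hq.2.le j).2) i) h1

end Consistency

/-! ### Consequences of the bandwidth conditions -/

section Bandwidth

variable {hx hs : ℕ → ℝ} (hbw : BandwidthCondition hx hs)
include hbw

lemma BandwidthCondition.tendsto_x : Tendsto hx atTop (𝓝 0) :=
  hbw.isLittleO_x.trans_tendsto
    (tendsto_inv_atTop_zero.comp (Real.tendsto_log_atTop.comp tendsto_natCast_atTop_atTop))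

/-- `diagBound` is of order 1/h_σ, so the quantity is of order 1/(m h_x h_σ) = h_σ/(m h_x h_σ²). -/
lemma BandwidthCondition.tendsto_inv_mul_diagBound (M₁ M₂ : ℝ) :
    Tendsto (fun m : ℕ => (hx m * √M₁)⁻¹ * diagBound M₁ M₂ (hs m) / m) atTop (𝓝 0) := by
  have h1 := hbw.tendsto_mul.inv_tendsto_atTop
  have h2 := (h1.mul hbw.tendsto_s).const_mul (2 * (√M₂ - √M₁) * (√M₁)⁻¹)
  have h3 := (h1.mul (hbw.tendsto_s.pow 2)).const_mul (4 * (√M₁)⁻¹)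
  have h4 := h2.add h3
  simp only [mul_zero, add_zero, ne_eq, OfNat.ofNat_ne_zero, not_false_eq_true, zero_pow] at h4
  refine h4.congr' ?_
  filter_upwards [eventually_gt_atTop 0] with m hm
  have hm' : (m : ℝ) ≠ 0 := by exact_mod_cast hm.ne'
  have hx0 := (hbw.pos_x m).ne'
  have hs0 := (hbw.pos_s m).ne'
  simp only [Pi.inv_apply, diagBound, mul_inv]
  field_simp
  ring

lemma BandwidthCondition.tendsto_diagBound {M₁ : ℝ} (hM₁ : 0 < M₁) (M₂ : ℝ) :
    Tendsto (fun m : ℕ => diagBound M₁ M₂ (hs m) / m) atTop (𝓝 0) := by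
  have ha : √M₁ ≠ 0 := (Real.sqrt_pos.2 hM₁).ne'
  have h := (hbw.tendsto_inv_mul_diagBound M₁ M₂).mul (hbw.tendsto_x.mul_const √M₁)
  rw [zero_mul] at h
  refine h.congr fun m => ?_
  have hx0 := (hbw.pos_x m).ne'
  field_simp

end Bandwidth

/-! ### The step-wise threshold -/

section Threshold

variable {m : ℕ} {α : ℝ} {T : Fin m → ℝ}

lemma monotone_orderStat : Monotone (orderStat T) := Tuple.monotone_sort T

lemma sum_comp_orderStat (F : ℝ → ℝ) : ∑ i, F (orderStat T i) = ∑ i, F (T i) :=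
  Equiv.sum_comp (Tuple.sort T) fun i => F (T i)

lemma mem_admissible_iff (j : Fin m) :
    j ∈ admissible α T ↔ ∑ i ∈ Finset.Iic j, (orderStat T i - α) ≤ 0 := by
  have hj : (0 : ℝ) < (j : ℝ) + 1 := by positivity
  rw [admissible, Finset.mem_filter, div_le_iff₀ hj, Finset.sum_sub_distrib, Finset.sum_const,
    Fin.card_Iic, nsmul_eq_mul, sub_nonpos, mul_comm α]
  simp

/-- The excess of the statistics up to `t` over the level `α`. -/
def excess (α : ℝ) (T : Fin m → ℝ) (t : ℝ) : ℝ :=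
  ∑ i, Set.indicator (Set.Iic t) (fun u => u - α) (T i)

/-- Were the threshold above t, the maximal admissible prefix would contain every statistic up to t,
and its further entries beyond t ≥ α would add only nonnegative terms; its excess would then be
positive. -/
lemma stepThreshold_le_of_excess_pos {t : ℝ} (ht : α ≤ t) (ht0 : 0 ≤ t) (h : 0 < excess α T t) :
    stepThreshold α T ≤ t := by
  by_contra! hlt
  rw [stepThreshold] at hlt
  split_ifs at hlt with hne
  · set k := (admissible α T).max' hne with hk
    have hadm := (mem_admissible_iff k).1 (Finset.max'_mem _ hne)
    have hle : excess α T t ≤ ∑ i ∈ Finset.Iic k, (orderStat T i - α) := by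
      rw [excess, ← sum_comp_orderStat, ← Finset.sum_subset (Finset.subset_univ (Finset.Iic k))]
      · refine Finset.sum_le_sum fun i _ => ?_
        by_cases hi : orderStat T i ≤ t
        · rw [Set.indicator_of_mem (by simpa using hi)]
        · rw [Set.indicator_of_notMem (by simpa using hi)]
          linarith
      · intro i _ hi
        have hki : k ≤ i := by
          rw [Finset.mem_Iic, not_le] at hi
          exact hi.le
        have := monotone_orderStat (T := T) hki
        rw [Set.indicator_of_notMem]
        simp only [Set.mem_Iic, not_le]
        linarith
    linarith
  · linarith

/-- The statistics up to t form a prefix of the ordered sample whose excess is that at t, so the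
prefix is admissible and the threshold reaches its last entry. -/
lemma le_stepThreshold_of_excess_nonpos {t : ℝ} (h : excess α T t ≤ 0) {j : Fin m}
    (hj : T j ≤ t) : T j ≤ stepThreshold α T := by
  have hjo : ∃ i, orderStat T i = T j := ⟨(Tuple.sort T).symm j, by simp [orderStat]⟩
  obtain ⟨i₀, hi₀⟩ := hjo
  have hne : (Finset.univ.filter fun i => orderStat T i ≤ t).Nonempty :=
    ⟨i₀, by simp [hi₀, hj]⟩
  set k := (Finset.univ.filter fun i => orderStat T i ≤ t).max' hne with hk
  have hkt : orderStat T k ≤ t := (Finset.mem_filter.1 (Finset.max'_mem _ hne)).2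
  have hkmax : ∀ i, orderStat T i ≤ t → i ≤ k := fun i hi =>
    Finset.le_max' _ _ (by simp [hi])
  have hadm : k ∈ admissible α T := by
    rw [mem_admissible_iff]
    refine le_trans (le_of_eq ?_) h
    rw [excess, ← sum_comp_orderStat, ← Finset.sum_subset (Finset.subset_univ (Finset.Iic k))]
    · refine Finset.sum_congr rfl fun i hi => ?_
      rw [Set.indicator_of_mem]
      exact (monotone_orderStat (Finset.mem_Iic.1 hi)).trans hkt
    · intro i _ hi
      rw [Set.indicator_of_notMem]
      intro hit
      exact hi (Finset.mem_Iic.2 (hkmax i hit))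
  have hne' : (admissible α T).Nonempty := ⟨k, hadm⟩
  rw [stepThreshold, dif_pos hne', ← hi₀]
  exact monotone_orderStat ((hkmax i₀ (hi₀ ▸ hj)).trans (Finset.le_max' _ _ hadm))

/-- The sorting permutation breaks ties by index, so it is determined by finitely many comparisons.
This reduces measurability of the order statistics and of the threshold to finitely many cases. -/
lemma measurableSet_sort_eq (π : Equiv.Perm (Fin m)) :
    MeasurableSet {T : Fin m → ℝ | Tuple.sort T = π} := by
  have e : {T : Fin m → ℝ | Tuple.sort T = π}
      = ⋂ i, ⋂ j, {T : Fin m → ℝ | (i ≤ j → T (π i) ≤ T (π j)) ∧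
        (i < j → T (π i) = T (π j) → π i < π j)} := by
    ext T
    simp only [Set.mem_iInter, Set.mem_ofPred_eq]
    rw [eq_comm, Tuple.eq_sort_iff]
    constructor
    · rintro ⟨h1, h2⟩ i j
      exact ⟨fun hij => h1 hij, h2 i j⟩
    · intro h
      exact ⟨fun i j hij => (h i j).1 hij, fun i j => (h i j).2⟩
  rw [e]
  refine MeasurableSet.iInter fun i => MeasurableSet.iInter fun j => ?_
  by_cases h1 : i ≤ j <;> by_cases h2 : i < j <;> by_cases h3 : π i < π j <;>
    simp only [h1, h2, h3, true_implies, false_implies, imp_true_iff, and_true, true_and,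
      imp_false] <;> measurability

lemma measurable_choose {β ι : Type*} [MeasurableSpace β] [Countable ι] {N : β → ι}
    (hN : ∀ i, MeasurableSet {b | N b = i}) {f : ι → β → ℝ} (hf : ∀ i, Measurable (f i)) :
    Measurable fun b => f (N b) b := by
  let : MeasurableSpace ι := ⊤
  have hN' : Measurable N := measurable_to_countable' hN
  have : Measurable fun q : ι × β => f q.1 q.2 := measurable_from_prod_countable_right hf
  exact this.comp (hN'.prodMk measurable_id)

lemma measurable_orderStat (i : Fin m) : Measurable fun T : Fin m → ℝ => orderStat T i :=
  measurable_choose (N := fun T : Fin m → ℝ => Tuple.sort T) measurableSet_sort_eq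
    (f := fun π T => T (π i)) fun π => measurable_pi_apply (π i)

lemma measurable_stepThreshold : Measurable (stepThreshold α : (Fin m → ℝ) → ℝ) := by
  classical
  refine measurable_choose (N := fun T : Fin m → ℝ => admissible α T) (fun s => ?_)
    (f := fun s T => if h : s.Nonempty then orderStat T (s.max' h) else 0) fun s => ?_
  · have e : {T : Fin m → ℝ | admissible α T = s}
        = ⋂ j, {T : Fin m → ℝ | ∑ i ∈ Finset.Iic j, (orderStat T i - α) ≤ 0 ↔ j ∈ s} := by
      ext T
      simp only [Set.mem_iInter, Set.mem_ofPred_eq, Finset.ext_iff, mem_admissible_iff]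
    rw [e]
    refine MeasurableSet.iInter fun j => ?_
    have hm : MeasurableSet {T : Fin m → ℝ | ∑ i ∈ Finset.Iic j, (orderStat T i - α) ≤ 0} :=
      measurableSet_le (Finset.measurable_sum _ fun i _ => (measurable_orderStat i).sub_const α)
        measurable_const
    by_cases hj : j ∈ s
    · simpa [hj] using hm
    · simp only [hj, iff_false]
      exact hm.compl
  · split_ifs with h
    · exact measurable_orderStat _
    · exact measurable_const

end Threshold

/-! ### The law of the oracle statistic -/

section OracleLaw

variable {gμ gσ : Measure ℝ} [IsProbabilityMeasure gμ] [IsProbabilityMeasure gσ] {p : ℝ}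
  (hp0 : 0 < p) (hp1 : p < 1) (hg : gμ {0} = 0) (hpos : ∀ᵐ v ∂gσ, 0 < v)

/-- The law of the oracle statistic. -/
def oracleLaw (p : ℝ) (gμ gσ : Measure ℝ) : Measure ℝ :=
  (unitLaw p gμ gσ).map fun q => oracleT p gμ q.2 √q.1.2

include hp0 hp1 in
lemma isProbabilityMeasure_oracleLaw : IsProbabilityMeasure (oracleLaw p gμ gσ) := by
  have := isProbabilityMeasure_effectPrior (gμ := gμ) hp0 hp1
  have : IsProbabilityMeasure (unitLaw p gμ gσ) := by unfold unitLaw; infer_instance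
  exact Measure.isProbabilityMeasure_map (by fun_prop)

lemma oracleLaw_apply {A : Set ℝ} (hA : MeasurableSet A) :
    oracleLaw p gμ gσ A = ∫⁻ v, obsLaw p gμ v {x | oracleT p gμ x √v ∈ A} ∂gσ := by
  have hm : Measurable (Set.indicator A fun _ => (1 : ENNReal)) := measurable_const.indicator hA
  rw [← lintegral_indicator_one hA, oracleLaw]
  change ∫⁻ a, Set.indicator A (fun _ => (1 : ENNReal)) a ∂_ = _
  rw [lintegral_map hm (by fun_prop), lintegral_unitLaw (by fun_prop)]
  refine lintegral_congr fun v => ?_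
  rw [← lintegral_obsLaw v (F := fun x => Set.indicator A (fun _ => (1 : ENNReal))
    (oracleT p gμ x √v)) (by fun_prop)]
  have hA' : MeasurableSet {x | oracleT p gμ x √v ∈ A} := hA.preimage (by fun_prop)
  rw [← lintegral_indicator_one hA']
  rfl

lemma measurable_obsLaw_apply {A : Set ℝ} (hA : MeasurableSet A) :
    Measurable fun v => obsLaw p gμ v {x | oracleT p gμ x √v ∈ A} := by
  have e : ∀ v, obsLaw p gμ v {x | oracleT p gμ x √v ∈ A}
      = noiseLaw p gμ (Prod.mk v ⁻¹' {w : ℝ × (ℝ × ℝ) |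
        oracleT p gμ (w.2.1 + √w.1 * w.2.2) √w.1 ∈ A}) := fun v => by
    have hA' : MeasurableSet {x | oracleT p gμ x √v ∈ A} := hA.preimage (by fun_prop)
    rw [obsLaw, Measure.map_apply (by fun_prop) hA']
    rfl
  simp_rw [e]
  exact measurable_measure_prodMk_left (hA.preimage (by fun_prop))

include hp0 hp1 in
lemma volume_eq_zero_of_obsLaw {v : ℝ} (hv : 0 < v) {A : Set ℝ} (hA : MeasurableSet A)
    (h : obsLaw p gμ v A = 0) : volume A = 0 := by
  rw [obsLaw_eq_withDensity hp0 hp1 hv, withDensity_apply _ hA,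
    lintegral_eq_zero_iff (by fun_prop)] at h
  have : ∀ᵐ x ∂(volume.restrict A), False := h.mono fun x hx => by
    have := fMix_pos (gμ := gμ) hp0 hp1 (Real.sqrt_pos.2 hv) x
    simp only [Pi.zero_apply, ENNReal.ofReal_eq_zero] at hx
    linarith
  simpa [ae_iff] using this

include hp0 hp1 hpos in
/-- A set of values that is null for the oracle law, whose preimage is open, is not attained. -/
lemma ae_forall_notMem_of_oracleLaw_eq_zero {A : Set ℝ} (hA : IsOpen A)
    (h : oracleLaw p gμ gσ A = 0) : ∀ᵐ v ∂gσ, ∀ x, oracleT p gμ x √v ∉ A := by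
  rw [oracleLaw_apply hA.measurableSet, lintegral_eq_zero_iff
    (measurable_obsLaw_apply hA.measurableSet)] at h
  filter_upwards [h, hpos] with v h1 hv x hx
  have hs := Real.sqrt_pos.2 hv
  have hopen : IsOpen {x | oracleT p gμ x √v ∈ A} :=
    hA.preimage (continuous_oracleT hp0 hp1 hs)
  have := volume_eq_zero_of_obsLaw hp0 hp1 hv hopen.measurableSet h1
  exact (hopen.measure_pos volume ⟨x, hx⟩).ne' this

include hp0 hp1 hg hpos

/-- For each fixed variance the observation has a density and the level set of T is Lebesgue null.
Continuity comes from X alone, so `gσ` may have atoms. -/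
lemma nullSingletonClass_oracleLaw : NullSingletonClass (oracleLaw p gμ gσ) := by
  refine ⟨fun t => ?_⟩
  rw [oracleLaw_apply (measurableSet_singleton t)]
  refine (lintegral_congr_ae (hpos.mono fun v hv => ?_)).trans lintegral_zero
  have hac : obsLaw p gμ v ≪ volume := by
    rw [obsLaw_eq_withDensity hp0 hp1 hv]; exact withDensity_absolutelyContinuous _ _
  exact hac (volume_oracleT_eq hp0 hp1 hg (Real.sqrt_pos.2 hv) t)

lemma oracleLaw_Iio_pos {t : ℝ} (ht : 0 < t) : 0 < oracleLaw p gμ gσ (Set.Iio t) := by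
  refine pos_iff_ne_zero.2 fun h => ?_
  obtain ⟨v, h1, hv⟩ :=
    ((ae_forall_notMem_of_oracleLaw_eq_zero hp0 hp1 hpos isOpen_Iio h).and hpos).exists
  obtain ⟨x, hx⟩ := exists_oracleT_lt (gμ := gμ) hp0 hp1 hg (Real.sqrt_pos.2 hv) ht
  exact h1 x hx

/-- The support of the oracle law is an interval starting at `0`. -/
lemma oracleLaw_Ioo_pos {s t : ℝ} (hs : 0 < s) (hst : s < t)
    (ht : 0 < oracleLaw p gμ gσ (Set.Ici t)) : 0 < oracleLaw p gμ gσ (Set.Ioo s t) := by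
  refine pos_iff_ne_zero.2 fun h => ht.ne' ?_
  rw [oracleLaw_apply measurableSet_Ici]
  refine (lintegral_congr_ae ?_).trans lintegral_zero
  filter_upwards [ae_forall_notMem_of_oracleLaw_eq_zero hp0 hp1 hpos isOpen_Ioo h, hpos]
    with v h1 hv
  have hσ := Real.sqrt_pos.2 hv
  have hempty : {x | oracleT p gμ x √v ∈ Set.Ici t} = ∅ := by
    refine Set.eq_empty_of_forall_notMem fun y hy => ?_
    obtain ⟨x, hx⟩ := exists_oracleT_lt (gμ := gμ) hp0 hp1 hg hσ hs
    have hy' : t ≤ oracleT p gμ y √v := hy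
    -- T falls below s and reaches t, so by continuity it attains the midpoint of (s, t), an
    -- interval whose values are excluded.
    obtain ⟨z, hz⟩ := mem_range_of_exists_le_of_exists_ge
      (continuous_oracleT (gμ := gμ) hp0 hp1 hσ) (c := (s + t) / 2)
      ⟨x, by linarith⟩ ⟨y, by linarith⟩
    exact h1 z ⟨by simp only at hz; linarith, by simp only at hz; linarith⟩
  simp only [hempty, measure_empty]

omit hg hpos in
lemma oracleLaw_compl_Icc : oracleLaw p gμ gσ (Set.Icc 0 1)ᶜ = 0 := by
  rw [oracleLaw, Measure.map_apply (by fun_prop) measurableSet_Icc.compl]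
  refine measure_mono_null (t := ∅) (fun q hq => ?_) measure_empty
  exact hq ⟨oracleT_nonneg hp0.le hp1.le (Real.sqrt_nonneg _) _,
    oracleT_le_one hp0.le hp1.le (Real.sqrt_nonneg _) _⟩

/-- The posterior property of T, integrated over {T ∈ A}. It makes the expected number of false
rejections of a rule in T a functional of the law of T. -/
lemma unitLaw_null_inter {A : Set ℝ} (hA : MeasurableSet A) :
    unitLaw p gμ gσ {q | q.1.1 = 0 ∧ oracleT p gμ q.2 √q.1.2 ∈ A}
      = ∫⁻ u in A, ENNReal.ofReal u ∂(oracleLaw p gμ gσ) := by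
  have hm : Measurable (Set.indicator A fun _ => (1 : ENNReal)) := measurable_const.indicator hA
  have h := lintegral_unitLaw_null (gσ := gσ) hp0 hp1 hg hpos
    (F := fun z => Set.indicator A (fun _ => (1 : ENNReal)) (oracleT p gμ z.2 √z.1)) (by fun_prop)
  have hset : MeasurableSet {q : (ℝ × ℝ) × ℝ | q.1.1 = 0 ∧ oracleT p gμ q.2 √q.1.2 ∈ A} :=
    ((measurableSet_singleton (0 : ℝ)).preimage (by fun_prop)).inter
      (hA.preimage (by fun_prop))
  rw [← lintegral_indicator_one hset, ← lintegral_indicator hA, oracleLaw,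
    lintegral_map (ENNReal.measurable_ofReal.indicator hA) (by fun_prop)]
  refine Eq.trans (lintegral_congr fun q => ?_) (h.trans (lintegral_congr fun q => ?_))
  · by_cases h1 : q.1.1 = 0 <;> by_cases h2 : oracleT p gμ q.2 √q.1.2 ∈ A <;>
      simp [h1, h2, Set.indicator]
  · by_cases h2 : oracleT p gμ q.2 √q.1.2 ∈ A <;> simp [h2]

lemma integral_id_oracleLaw : ∫ u, u ∂(oracleLaw p gμ gσ) = 1 - p := by
  have h := unitLaw_null_inter hp0 hp1 hg hpos MeasurableSet.univ
  simp only [Set.mem_univ, and_true, Measure.restrict_univ] at h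
  have h2 : unitLaw p gμ gσ {q | q.1.1 = 0} = ENNReal.ofReal (1 - p) := by
    have hset : MeasurableSet {q : (ℝ × ℝ) × ℝ | q.1.1 = 0} :=
      (measurableSet_singleton (0 : ℝ)).preimage (by fun_prop)
    have := isProbabilityMeasure_effectPrior (gμ := gμ) hp0 hp1
    rw [unitLaw, Measure.compProd_apply hset]
    have e : ∀ a : ℝ × ℝ, normalKernel a (Prod.mk a ⁻¹' {q : (ℝ × ℝ) × ℝ | q.1.1 = 0})
        = Set.indicator ({0} ×ˢ Set.univ) 1 a := fun a => by
      by_cases ha : a.1 = 0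
      · simp [ha, Set.indicator]
      · simp [ha, Set.indicator]
    simp_rw [e]
    rw [lintegral_indicator_one ((measurableSet_singleton _).prod MeasurableSet.univ),
      Measure.prod_prod, measure_univ, mul_one, effectPrior]
    simp [hg]
  have hae : 0 ≤ᵐ[oracleLaw p gμ gσ] fun u => u := by
    have := oracleLaw_compl_Icc (gμ := gμ) (gσ := gσ) hp0 hp1
    exact (measure_eq_zero_iff_ae_notMem.1 this).mono fun u hu => (not_not.1 hu).1
  rw [integral_eq_lintegral_of_nonneg_ae hae (by fun_prop), ← h, h2,
    ENNReal.toReal_ofReal (by linarith)]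

end OracleLaw

/-! ### The population threshold -/

section Population

variable {ν : Measure ℝ} [IsProbabilityMeasure ν] [NullSingletonClass ν]
  (hν : ν (Set.Icc 0 1)ᶜ = 0) {α : ℝ}

/-- The threshold `sup {t : E[T | T < t] ≤ α}` for a statistic `T` with law `ν`. -/
def lawThreshold (ν : Measure ℝ) (α : ℝ) : ℝ :=
  sSup {t : ℝ | (∫ u in Set.Iio t, u ∂ν) / ν.real (Set.Iio t) ≤ α}

/-- The expected excess over `α` of the values up to `t`. -/
def lawExcess (ν : Measure ℝ) (α t : ℝ) : ℝ := ∫ u in Set.Iic t, (u - α) ∂ν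

include hν

omit [NullSingletonClass ν] [IsProbabilityMeasure ν] in
lemma ae_mem_Icc_of_compl : ∀ᵐ u ∂ν, u ∈ Set.Icc (0 : ℝ) 1 :=
  (measure_eq_zero_iff_ae_notMem.1 hν).mono fun _ hu => not_not.1 hu

omit [NullSingletonClass ν] in
lemma integrable_id_law : Integrable (fun u : ℝ => u) ν := by
  refine Integrable.of_bound (by fun_prop) 1 ((ae_mem_Icc_of_compl hν).mono fun u hu => ?_)
  rw [Real.norm_eq_abs, abs_of_nonneg hu.1]
  exact hu.2

omit [NullSingletonClass ν] in
lemma integrable_sub_const_law : Integrable (fun u : ℝ => u - α) ν :=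
  (integrable_id_law hν).sub (integrable_const α)

lemma continuous_lawExcess : Continuous (lawExcess ν α) := by
  have hi := integrable_sub_const_law (α := α) hν
  have h := intervalIntegral.continuous_primitive (fun a b => hi.intervalIntegrable) (0 : ℝ)
  have e : lawExcess ν α = fun b => lawExcess ν α 0 + ∫ u in (0 : ℝ)..b, (u - α) ∂ν := by
    funext b
    rw [lawExcess, lawExcess,
      ← intervalIntegral.integral_Iic_sub_Iic hi.integrableOn hi.integrableOn]
    ring
  rw [e]
  fun_prop

lemma lawExcess_eq (t : ℝ) :
    lawExcess ν α t = (∫ u in Set.Iio t, u ∂ν) - α * ν.real (Set.Iio t) := by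
  rw [lawExcess, ← setIntegral_congr_set (Iio_ae_eq_Iic (μ := ν) (a := t)),
    integral_sub (integrable_id_law hν).integrableOn (integrable_const α).integrableOn,
    setIntegral_const, smul_eq_mul, mul_comm]

lemma ratio_le_iff (hα : 0 < α) (t : ℝ) :
    (∫ u in Set.Iio t, u ∂ν) / ν.real (Set.Iio t) ≤ α ↔ lawExcess ν α t ≤ 0 := by
  rw [lawExcess_eq hν]
  -- When nothing lies below t, the ratio is 0/0 = 0 and the excess is 0, so both sides hold.
  rcases (measureReal_nonneg (μ := ν) (s := Set.Iio t)).eq_or_lt with h | h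
  · have h0 : ν (Set.Iio t) = 0 := (measureReal_eq_zero_iff (measure_ne_top _ _)).1 h.symm
    rw [← h, setIntegral_measure_zero _ h0]
    simp [hα.le]
  · rw [div_le_iff₀ h, sub_nonpos]

/-- For s ≥ α this says that the excess does not decrease beyond s, and for s > α that it gains
strictly from any mass in (s, t]. -/
lemma lawExcess_le_add {s t : ℝ} (hst : s ≤ t) :
    lawExcess ν α s + (s - α) * ν.real (Set.Ioc s t) ≤ lawExcess ν α t := by
  have hi := integrable_sub_const_law (α := α) hν
  have h := intervalIntegral.integral_Iic_sub_Iic (a := s) (b := t) (f := fun u => u - α) (μ := ν)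
    hi.integrableOn hi.integrableOn
  rw [intervalIntegral.integral_of_le hst] at h
  have h2 : (s - α) * ν.real (Set.Ioc s t) ≤ ∫ u in Set.Ioc s t, (u - α) ∂ν := by
    rw [mul_comm, ← smul_eq_mul, ← setIntegral_const]
    exact setIntegral_mono_on (integrable_const _).integrableOn hi.integrableOn measurableSet_Ioc
      fun u hu => by linarith [hu.1]
  simp only [lawExcess]
  linarith

lemma lawExcess_nonpos {t : ℝ} (ht : t ≤ α) : lawExcess ν α t ≤ 0 :=
  setIntegral_nonpos measurableSet_Iic fun u hu => by
    have : u ≤ t := hu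
    linarith

lemma lawExcess_of_Ici_eq_zero {t : ℝ} (ht : ν (Set.Ici t) = 0) :
    lawExcess ν α t = ∫ u, u ∂ν - α := by
  have h : ∀ᵐ u ∂ν, u ∈ Set.Iic t := (measure_eq_zero_iff_ae_notMem.1 ht).mono fun u hu => by
    simp only [Set.mem_Ici, not_le] at hu
    exact hu.le
  rw [lawExcess, Measure.restrict_eq_self_of_ae_mem h, integral_sub (integrable_id_law hν)
    (integrable_const α)]
  simp

variable (hα0 : 0 < α) (hα : α < ∫ u, u ∂ν)
include hα0 hα

/-- Beyond all the mass the excess equals the total mean minus α, which is positive; a nonpositive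
excess at t therefore leaves mass above t. -/
lemma Ici_pos_of_lawExcess_nonpos {t : ℝ} (ht : lawExcess ν α t ≤ 0) : 0 < ν (Set.Ici t) := by
  refine pos_iff_ne_zero.2 fun h => ?_
  rw [lawExcess_of_Ici_eq_zero hν h] at ht
  linarith

lemma bddAbove_lawThreshold :
    BddAbove {t : ℝ | (∫ u in Set.Iio t, u ∂ν) / ν.real (Set.Iio t) ≤ α} := by
  refine ⟨1, fun t ht => ?_⟩
  by_contra! h
  have hpos := Ici_pos_of_lawExcess_nonpos hν hα0 hα ((ratio_le_iff hν hα0 t).1 ht)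
  refine hpos.ne' (measure_mono_null (t := (Set.Icc 0 1)ᶜ) (fun u hu hu' => ?_) hν)
  have : t ≤ u := hu
  linarith [hu'.2]

lemma le_lawThreshold : α ≤ lawThreshold ν α :=
  le_csSup (bddAbove_lawThreshold hν hα0 hα)
    ((ratio_le_iff hν hα0 α).2 (lawExcess_nonpos hν le_rfl))

lemma lawExcess_pos {t : ℝ} (ht : lawThreshold ν α < t) : 0 < lawExcess ν α t := by
  by_contra! h
  exact ht.not_ge (le_csSup (bddAbove_lawThreshold hν hα0 hα) ((ratio_le_iff hν hα0 t).2 h))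

lemma exists_lawExcess_nonpos {t : ℝ} (ht : t < lawThreshold ν α) :
    ∃ s, t < s ∧ lawExcess ν α s ≤ 0 := by
  obtain ⟨s, hs, hts⟩ := exists_lt_of_lt_csSup
    (s := {t : ℝ | (∫ u in Set.Iio t, u ∂ν) / ν.real (Set.Iio t) ≤ α}) ⟨α, (ratio_le_iff hν hα0 α).2 (lawExcess_nonpos hν le_rfl)⟩ ht
  exact ⟨s, hts, (ratio_le_iff hν hα0 s).1 hs⟩

lemma lawExcess_nonpos_of_lt {t : ℝ} (ht : t < lawThreshold ν α) : lawExcess ν α t ≤ 0 := by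
  rcases le_total t α with h | h
  · exact lawExcess_nonpos hν h
  obtain ⟨s, hts, hs⟩ := exists_lawExcess_nonpos hν hα0 hα ht
  have h1 := lawExcess_le_add (α := α) hν hts.le
  have h2 : 0 ≤ (t - α) * ν.real (Set.Ioc t s) :=
    mul_nonneg (by linarith) measureReal_nonneg
  linarith

lemma lawExcess_lawThreshold_nonpos : lawExcess ν α (lawThreshold ν α) ≤ 0 := by
  have h : Tendsto (lawExcess ν α) (𝓝[<] lawThreshold ν α) (𝓝 (lawExcess ν α (lawThreshold ν α))) :=
    ((continuous_lawExcess hν).tendsto _).mono_left nhdsWithin_le_nhds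
  exact le_of_tendsto h (eventually_mem_nhdsWithin.mono fun t ht =>
    lawExcess_nonpos_of_lt hν hα0 hα ht)

variable (hIio : ∀ t, 0 < t → 0 < ν (Set.Iio t))
  (hIoo : ∀ s t, 0 < s → s < t → 0 < ν (Set.Ici t) → 0 < ν (Set.Ioo s t))

omit hν hα0 hα [NullSingletonClass ν] in
include hIio in
lemma measureReal_Iio_pos {t : ℝ} (ht : 0 < t) : 0 < ν.real (Set.Iio t) :=
  ENNReal.toReal_pos (hIio t ht).ne' (measure_ne_top _ _)

include hIoo in
lemma measureReal_Ioc_pos {s t : ℝ} (hs : 0 < s) (hst : s < t) (ht : lawExcess ν α t ≤ 0) :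
    0 < ν.real (Set.Ioc s t) :=
  ENNReal.toReal_pos ((hIoo s t hs hst (Ici_pos_of_lawExcess_nonpos hν hα0 hα ht)).trans_le
    (measure_mono Set.Ioo_subset_Ioc_self)).ne' (measure_ne_top _ _)

include hIio hIoo

/-- Below α the integrand is negative on a set of positive mass. Above α the excess increases
strictly, because ν charges every interval below a point of nonpositive excess, and it is still
nonpositive at some later point. Strictness prevents the empirical threshold from stopping short of
the population one. -/
lemma lawExcess_neg {t : ℝ} (ht0 : 0 < t) (ht : t < lawThreshold ν α) : lawExcess ν α t < 0 := by
  have key : ∀ s, 0 < s → s < α → lawExcess ν α s < 0 := fun s hs hsα => by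
    have h1 := measureReal_Iio_pos hIio hs
    have h2 : ∫ u in Set.Iio s, u ∂ν ≤ s * ν.real (Set.Iio s) := by
      rw [mul_comm, ← smul_eq_mul, ← setIntegral_const]
      exact setIntegral_mono_on (integrable_id_law hν).integrableOn
        (integrable_const _).integrableOn measurableSet_Iio fun u hu => le_of_lt hu
    rw [lawExcess_eq hν]
    nlinarith
  obtain ⟨s, hts, hs⟩ := exists_lawExcess_nonpos hν hα0 hα ht
  rcases lt_or_ge α t with h | h
  · have h1 := lawExcess_le_add (α := α) hν hts.le
    have h2 : 0 < (t - α) * ν.real (Set.Ioc t s) :=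
      mul_pos (by linarith) (measureReal_Ioc_pos hν hα0 hα hIoo ht0 hts hs)
    linarith
  -- Passing through t/2, which is strictly below α, also covers t = α.
  · have hi := integrable_sub_const_law (α := α) hν
    have h1 := intervalIntegral.integral_Iic_sub_Iic (a := t / 2) (b := t) (f := fun u => u - α)
      (μ := ν) hi.integrableOn hi.integrableOn
    rw [intervalIntegral.integral_of_le (by linarith)] at h1
    have h2 : ∫ u in Set.Ioc (t / 2) t, (u - α) ∂ν ≤ 0 :=
      setIntegral_nonpos measurableSet_Ioc fun u hu => by linarith [hu.2]
    have h3 := key (t / 2) (by linarith) (by linarith)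
    simp only [lawExcess] at h3 ⊢
    linarith

end Population

/-! ### Concentration of averages and of the step-wise threshold -/

section Concentration

variable {Ω : Type*} [MeasurableSpace Ω] {P : Measure Ω} [IsProbabilityMeasure P]

lemma tendsto_measureReal_le_zero {f : ℕ → Ω → ℝ} {c : ℝ}
    (hf : TendstoInMeasure P f atTop fun _ => c) (hc : 0 < c) :
    Tendsto (fun m => P.real {ω | f m ω ≤ 0}) atTop (𝓝 0) := by
  have h := tendstoInMeasure_iff_measureReal_dist.1 hf c hc
  refine squeeze_zero (fun _ => measureReal_nonneg) (fun m => measureReal_mono fun ω hω => ?_) h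
  simp only [Set.mem_ofPred_eq, Real.dist_eq] at hω ⊢
  rw [abs_sub_comm]
  exact (by linarith : c ≤ c - f m ω).trans (le_abs_self _)

lemma tendsto_measureReal_ge_zero {f : ℕ → Ω → ℝ} {c : ℝ}
    (hf : TendstoInMeasure P f atTop fun _ => c) (hc : c < 0) :
    Tendsto (fun m => P.real {ω | 0 ≤ f m ω}) atTop (𝓝 0) := by
  have h := tendstoInMeasure_iff_measureReal_dist.1 hf (-c) (by linarith)
  refine squeeze_zero (fun _ => measureReal_nonneg) (fun m => measureReal_mono fun ω hω => ?_) h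
  simp only [Set.mem_ofPred_eq, Real.dist_eq] at hω ⊢
  exact (by linarith : -c ≤ f m ω - c).trans (le_abs_self _)

lemma tendstoInMeasure_sub_const {f g : ℕ → Ω → ℝ} {c d : ℝ}
    (hf : TendstoInMeasure P f atTop fun _ => c) (hg : TendstoInMeasure P g atTop fun _ => d) :
    TendstoInMeasure P (fun m ω => f m ω - g m ω) atTop fun _ => c - d := by
  rw [tendstoInMeasure_iff_measureReal_dist] at hf hg ⊢
  intro ε hε
  have h := (hf (ε / 2) (by linarith)).add (hg (ε / 2) (by linarith))
  rw [add_zero] at h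
  refine squeeze_zero (fun _ => measureReal_nonneg) (fun m => ?_) h
  refine le_trans (measureReal_mono fun ω hω => ?_) (measureReal_union_le _ _)
  simp only [Set.mem_union, Set.mem_ofPred_eq, Real.dist_eq] at hω ⊢
  by_contra! hc
  have h1 : f m ω - g m ω - (c - d) = (f m ω - c) - (g m ω - d) := by ring
  rw [h1] at hω
  linarith [abs_sub (f m ω - c) (g m ω - d)]

lemma Negligible.tendstoInMeasure_average {a : (m : ℕ) → Fin m → Ω → ℝ} (ha : Negligible P a)
    (hm : ∀ m i, Measurable (a m i)) (h01 : ∀ m i ω, a m i ω ∈ Set.Icc (0 : ℝ) 1) :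
    TendstoInMeasure P (fun m ω => (∑ i, a m i ω) / m) atTop fun _ => 0 := by
  rw [tendstoInMeasure_iff_measureReal_dist]
  intro ε hε
  have h := (ha.tendsto_integral hm h01).div_const ε
  rw [zero_div] at h
  refine squeeze_zero (fun _ => measureReal_nonneg) (fun m => ?_) h
  have h_int : ∀ i, Integrable (a m i) P := fun i => integrable_of_abs_le (hm m i) (C := 1)
    fun ω => by rw [abs_of_nonneg (h01 m i ω).1]; exact (h01 m i ω).2
  have h0 : ∀ ω, 0 ≤ (∑ i, a m i ω) / m := fun ω =>
    div_nonneg (Finset.sum_nonneg fun i _ => (h01 m i ω).1) (Nat.cast_nonneg m)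
  have hmk := mul_meas_ge_le_integral_of_nonneg (μ := P) (Eventually.of_forall h0)
    ((integrable_finsetSum _ fun i _ => h_int i).div_const (m : ℝ)) ε
  rw [integral_div, integral_finsetSum _ fun i _ => h_int i] at hmk
  rw [le_div_iff₀ hε, mul_comm]
  refine le_trans (le_of_eq ?_) hmk
  congr 2
  ext ω
  simp only [Set.mem_ofPred_eq, Real.dist_eq, sub_zero, abs_of_nonneg (h0 ω)]

variable {ν : Measure ℝ} [IsProbabilityMeasure ν] [NullSingletonClass ν] {T : ℕ → Ω → ℝ}
  (hT : ∀ i, Measurable (T i)) (hlaw : ∀ i, P.map (T i) = ν) (hind : iIndepFun T P)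

omit [NullSingletonClass ν] in
include hT hlaw hind in
lemma tendstoInMeasure_average_law {h : ℝ → ℝ} (hh : Measurable h) (hb : ∀ x, |h x| ≤ 1) :
    TendstoInMeasure P (fun (m : ℕ) ω => (∑ i : Fin m, h (T i ω)) / m) atTop
      fun _ => ∫ u, h u ∂ν := by
  have hm : ∀ i, Measurable fun ω => h (T i ω) := fun i => hh.comp (hT i)
  have hsl := strong_law_ae_real (μ := P) (fun i ω => h (T i ω))
    (integrable_of_abs_le (hm 0) fun ω => hb _)
    (fun i j hij => (hind.indepFun hij).comp hh hh)
    (fun i => (IdentDistrib.mk (hT i).aemeasurable (hT 0).aemeasurable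
      (by rw [hlaw, hlaw])).comp hh)
  have e : ∫ ω, h (T 0 ω) ∂P = ∫ u, h u ∂ν := by
    rw [← hlaw 0, integral_map (hT 0).aemeasurable hh.aestronglyMeasurable]
  rw [e] at hsl
  simp only [Finset.sum_range] at hsl
  exact tendstoInMeasure_of_tendsto_ae (fun m => Measurable.aestronglyMeasurable
    (by fun_prop)) hsl

lemma exists_measureReal_closedBall_le (t : ℝ) {η : ℝ} (hη : 0 < η) :
    ∃ δ > 0, ν.real (Metric.closedBall t δ) ≤ η := by
  have h := tendsto_measure_cthickening_of_isClosed (μ := ν) (s := {t})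
    ⟨1, one_pos, measure_ne_top _ _⟩ isClosed_singleton
  rw [measure_singleton] at h
  have h2 : ∀ᶠ r in 𝓝[>] (0 : ℝ), ν (Metric.cthickening r {t}) < ENNReal.ofReal η :=
    (h.mono_left nhdsWithin_le_nhds).eventually_lt_const (ENNReal.ofReal_pos.2 hη)
  obtain ⟨r, hr, hr0⟩ := (h2.and eventually_mem_nhdsWithin).exists
  have hr0' : 0 < r := hr0
  rw [Metric.cthickening_singleton _ hr0'.le] at hr
  exact ⟨r, hr0', ENNReal.toReal_le_of_le_ofReal hη.le hr.le⟩

variable {S : (m : ℕ) → Fin m → Ω → ℝ} (hneg : Negligible P fun m i ω => |S m i ω - T i ω|)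

include hT hlaw hneg in
/-- A function that is `1`-Lipschitz away from a jump at `t` preserves consistency. -/
lemma negligible_comp_sub {h : ℝ → ℝ} {t : ℝ}
    (hh : ∀ x y, |x - y| < |y - t| → |h x - h y| ≤ |x - y|) :
    Negligible P fun m i ω => |h (S m i ω) - h (T i ω)| := by
  refine Negligible.of_approx fun ε hε η hη => ⟨_, hneg, ?_⟩
  obtain ⟨δ, hδ, hle⟩ := exists_measureReal_closedBall_le (ν := ν) t hη
  refine ⟨min ε δ, lt_min hε hδ, Eventually.of_forall fun m i => ?_⟩
  rw [← hlaw i, map_measureReal_apply (hT i) Metric.isClosed_closedBall.measurableSet] at hle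
  refine le_trans (le_trans (measureReal_mono (s₂ := {ω | min ε δ < |S m i ω - T i ω|} ∪
    T i ⁻¹' Metric.closedBall t δ) fun ω hω => ?_) (measureReal_union_le _ _))
    (add_le_add_right hle _)
  simp only [Set.mem_union, Set.mem_ofPred_eq, Set.mem_preimage, Metric.mem_closedBall,
    Real.dist_eq] at hω ⊢
  by_contra! hc
  have h1 := hh (S m i ω) (T i ω) ((hc.1.trans (min_le_right _ _)).trans_lt hc.2)
  linarith [hc.1.trans (min_le_left _ _)]

include hT hlaw hind hneg in
lemma tendstoInMeasure_average_comp (hS : ∀ m i, Measurable (S m i)) {h : ℝ → ℝ} {t : ℝ}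
    (hm : Measurable h) (hb : ∀ x, |h x| ≤ 1)
    (hh : ∀ x y, |x - y| < |y - t| → |h x - h y| ≤ |x - y|) :
    TendstoInMeasure P (fun m ω => (∑ i, h (S m i ω)) / m) atTop fun _ => ∫ u, h u ∂ν := by
  have h1 := tendstoInMeasure_average_law hT hlaw hind hm hb
  have hms : ∀ m i, Measurable fun ω => h (S m i ω) := fun m i => hm.comp (hS m i)
  have hmt : ∀ i, Measurable fun ω => h (T i ω) := fun i => hm.comp (hT i)
  -- Two values of h differ by at most 2; halving brings the array into [0, 1]. This is the source
  -- of ε/4 below.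
  have h2 := ((negligible_comp_sub hT hlaw hneg hh).const_mul
    (show (0 : ℝ) < 1 / 2 by norm_num)).tendstoInMeasure_average
    (fun m i => (((hms m i).sub (hmt i)).abs).const_mul _)
    (fun m i ω => ⟨by positivity, by
      have := abs_sub (h (S m i ω)) (h (T i ω))
      linarith [hb (S m i ω), hb (T i ω)]⟩)
  rw [tendstoInMeasure_iff_measureReal_dist] at h1 h2 ⊢
  intro ε hε
  have h3 := (h1 (ε / 2) (by linarith)).add (h2 (ε / 4) (by linarith))
  rw [add_zero] at h3
  refine squeeze_zero (fun _ => measureReal_nonneg) (fun m => ?_) h3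
  refine le_trans (measureReal_mono fun ω hω => ?_) (measureReal_union_le _ _)
  simp only [Set.mem_union, Set.mem_ofPred_eq, Real.dist_eq] at hω ⊢
  by_contra! hc
  obtain ⟨c1, c2⟩ := hc
  rw [sub_zero, ← Finset.mul_sum, mul_div_assoc, abs_of_nonneg (by positivity)] at c2
  have c3 : |(∑ i, h (S m i ω)) / m - (∑ i : Fin m, h (T i ω)) / m|
      ≤ (∑ i : Fin m, |h (S m i ω) - h (T i ω)|) / m := by
    rw [← sub_div, ← Finset.sum_sub_distrib, abs_div,
      abs_of_nonneg (Nat.cast_nonneg (α := ℝ) m)]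
    gcongr
    exact Finset.abs_sum_le_sum_abs _ _
  have c4 := abs_sub_le ((∑ i, h (S m i ω)) / m) ((∑ i : Fin m, h (T i ω)) / m) (∫ u, h u ∂ν)
  linarith

lemma abs_indicator_Iic_sub_le {g : ℝ → ℝ} (hg : ∀ x y, |g x - g y| ≤ |x - y|) (t x y : ℝ)
    (hxy : |x - y| < |y - t|) :
    |Set.indicator (Set.Iic t) g x - Set.indicator (Set.Iic t) g y| ≤ |x - y| := by
  by_cases hy : y ≤ t
  · have hx : x ≤ t := by
      rw [abs_of_nonpos (a := y - t) (by linarith)] at hxy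
      linarith [le_abs_self (x - y)]
    rw [Set.indicator_of_mem (by exact hx), Set.indicator_of_mem (by exact hy)]
    exact hg x y
  · have hx : ¬ x ≤ t := by
      rw [abs_of_nonneg (a := y - t) (by linarith)] at hxy
      linarith [neg_abs_le (x - y)]
    rw [Set.indicator_of_notMem (by exact hx), Set.indicator_of_notMem (by exact hy)]
    simp

variable (hν : ν (Set.Icc 0 1)ᶜ = 0) {α : ℝ} (hα0 : 0 < α) (hα1 : α < 1)
  (hα : α < ∫ u, u ∂ν) (hIio : ∀ t, 0 < t → 0 < ν (Set.Iio t))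
  (hIoo : ∀ s t, 0 < s → s < t → 0 < ν (Set.Ici t) → 0 < ν (Set.Ioo s t))
  (hS : ∀ m i, Measurable (S m i)) (hS01 : ∀ m i ω, S m i ω ∈ Set.Icc (0 : ℝ) 1)

include hT hlaw hind hneg hν hα0 hα1 hS hS01 in
lemma tendstoInMeasure_excess (t : ℝ) :
    TendstoInMeasure P (fun m ω => excess α (fun i => S m i ω) t / m) atTop
      fun _ => lawExcess ν α t := by
  have hmin : ∀ x ∈ Set.Icc (0 : ℝ) 1, min (max x 0) 1 = x := fun x hx => by
    rw [max_eq_left hx.1, min_eq_left hx.2]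
  -- Clamping makes u - α bounded by 1 on the whole line, without changing it on [0, 1], where the
  -- statistics and ν live.
  obtain ⟨g, hgdef⟩ : ∃ g : ℝ → ℝ, g = fun u => min (max u 0) 1 - α := ⟨_, rfl⟩
  have hgm : Measurable g := by rw [hgdef]; fun_prop
  have hgl : ∀ x y, |g x - g y| ≤ |x - y| := fun x y => by
    rw [hgdef]
    simp only [sub_sub_sub_cancel_right]
    refine (abs_min_sub_min_le_max _ _ _ _).trans ?_
    rw [sub_self, abs_zero, max_eq_left (abs_nonneg _)]
    exact abs_max_sub_max_le_abs _ _ _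
  have hgb : ∀ x, |g x| ≤ 1 := fun x => by
    have h1 : 0 ≤ min (max x 0) 1 := le_min (le_max_right _ _) zero_le_one
    have h2 : min (max x 0) 1 ≤ 1 := min_le_right _ _
    rw [hgdef, abs_le]
    constructor <;> linarith
  have h := tendstoInMeasure_average_comp hT hlaw hind hneg hS
    (h := Set.indicator (Set.Iic t) g) (hgm.indicator measurableSet_Iic)
    (fun x => (by
      by_cases hx : x ∈ Set.Iic t
      · rw [Set.indicator_of_mem hx]; exact hgb x
      · rw [Set.indicator_of_notMem hx]; simp))
    (abs_indicator_Iic_sub_le hgl t)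
  have e1 : ∫ u, Set.indicator (Set.Iic t) g u ∂ν = lawExcess ν α t := by
    rw [integral_indicator measurableSet_Iic, lawExcess]
    refine integral_congr_ae (ae_restrict_of_ae ((ae_mem_Icc_of_compl hν).mono fun u hu => ?_))
    simp only [hgdef, hmin u hu]
  rw [e1] at h
  refine h.congr_left fun m => Eventually.of_forall fun ω => ?_
  simp only [excess]
  congr 1
  refine Finset.sum_congr rfl fun i _ => ?_
  simp only [Set.indicator, hgdef, hmin _ (hS01 m i ω)]

include hT hlaw hind hneg hS in
lemma tendstoInMeasure_card_Ioc {s t : ℝ} (hst : s ≤ t) :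
    TendstoInMeasure P (fun m ω => (∑ i, Set.indicator (Set.Ioc s t) (fun _ => (1 : ℝ))
      (S m i ω)) / m) atTop fun _ => ν.real (Set.Ioc s t) := by
  -- The comparison lemma admits a single jump, so the interval is treated as a difference of two
  -- half-lines.
  have key : ∀ r : ℝ, TendstoInMeasure P (fun m ω => (∑ i, Set.indicator (Set.Iic r)
      (fun _ => (1 : ℝ)) (S m i ω)) / m) atTop fun _ => ν.real (Set.Iic r) := fun r => by
    have h := tendstoInMeasure_average_comp hT hlaw hind hneg hS
      (h := Set.indicator (Set.Iic r) fun _ => (1 : ℝ)) (measurable_const.indicator measurableSet_Iic)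
      (fun x => by by_cases hx : x ≤ r <;> simp [Set.indicator, hx])
      (abs_indicator_Iic_sub_le (fun _ _ => by simp) r)
    rwa [integral_indicator_const _ measurableSet_Iic, smul_eq_mul, mul_one] at h
  have h := tendstoInMeasure_sub_const (key t) (key s)
  have e : ν.real (Set.Iic t) - ν.real (Set.Iic s) = ν.real (Set.Ioc s t) := by
    rw [← measureReal_sdiff (Set.Iic_subset_Iic.2 hst) measurableSet_Iic]
    congr 1
    ext u
    simp [and_comm]
  refine (h.congr_left fun m => Eventually.of_forall fun ω => ?_).congr_right
    (Eventually.of_forall fun ω => ?_)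
  · rw [← sub_div, ← Finset.sum_sub_distrib]
    congr 1
    refine Finset.sum_congr rfl fun i _ => ?_
    by_cases h1 : S m i ω ≤ s
    · have h2 := h1.trans hst
      simp [Set.indicator, h1, h2, h1.not_gt]
    · simp [Set.indicator, h1, not_le.1 h1]
  · simpa using e

include hT hlaw hind hneg hν hα0 hα1 hα hIio hIoo hS hS01

/-- A positive empirical excess just above t* caps the threshold. Just below t* a negative excess
alone is not enough: the threshold only reaches the largest statistic there, so a statistic in a
short interval below t* is also needed, and ν charges that interval. -/
lemma tendstoInMeasure_stepThreshold :
    TendstoInMeasure P (fun m ω => stepThreshold α fun i => S m i ω) atTop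
      fun _ => lawThreshold ν α := by
  rw [tendstoInMeasure_iff_measureReal_dist]
  intro ε hε
  obtain ⟨t, htdef⟩ : ∃ t, t = lawThreshold ν α := ⟨_, rfl⟩
  have hαt : α ≤ t := htdef ▸ le_lawThreshold hν hα0 hα
  -- The bound e ≤ t keeps t - e/2 positive, as the strict negativity and the positive mass require.
  obtain ⟨e, he⟩ : ∃ e, e = min ε t := ⟨_, rfl⟩
  have he0 : 0 < e := he ▸ lt_min hε (by linarith)
  have heε : e ≤ ε := he ▸ min_le_left _ _
  have het : e ≤ t := he ▸ min_le_right _ _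
  have h1 := tendsto_measureReal_le_zero (tendstoInMeasure_excess hT hlaw hind hneg hν hα0 hα1 hS
    hS01 (t + e / 2)) (lawExcess_pos hν hα0 hα (by rw [← htdef]; linarith))
  have hlt : t - e / 4 < lawThreshold ν α := by rw [← htdef]; linarith
  have hneg' := lawExcess_neg hν hα0 hα hIio hIoo (t := t - e / 4) (by linarith) hlt
  have h2 := tendsto_measureReal_ge_zero (tendstoInMeasure_excess hT hlaw hind hneg hν hα0 hα1 hS
    hS01 (t - e / 4)) hneg'
  have h3 := tendsto_measureReal_le_zero (tendstoInMeasure_card_Ioc hT hlaw hind hneg hS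
    (s := t - e / 2) (t := t - e / 4) (by linarith))
    (measureReal_Ioc_pos hν hα0 hα hIoo (by linarith) (by linarith) hneg'.le)
  have h4 := (h1.add h2).add h3
  simp only [add_zero] at h4
  refine squeeze_zero' (Eventually.of_forall fun _ => measureReal_nonneg) ?_ h4
  filter_upwards [eventually_gt_atTop 0] with m hm
  have hm' : (0 : ℝ) < m := by exact_mod_cast hm
  refine le_trans (measureReal_mono fun ω hω => ?_) ((measureReal_union_le _ _).trans
    (add_le_add_left (measureReal_union_le _ _) _))
  simp only [Set.mem_union, Set.mem_ofPred_eq, Real.dist_eq, ← htdef] at hω ⊢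
  by_contra! hc
  obtain ⟨⟨c1, c2⟩, c3⟩ := hc
  have d1 := stepThreshold_le_of_excess_pos (α := α) (T := fun i => S m i ω) (t := t + e / 2)
    (by linarith) (by linarith) (by
      by_contra! hcon
      exact absurd (div_nonpos_of_nonpos_of_nonneg hcon hm'.le) (not_le.2 c1))
  have c2' : excess α (fun i => S m i ω) (t - e / 4) ≤ 0 := by
    by_contra! hcon
    have := div_pos hcon hm'
    linarith
  obtain ⟨j, hj⟩ : ∃ j, S m j ω ∈ Set.Ioc (t - e / 2) (t - e / 4) := by
    by_contra! hcon
    rw [Finset.sum_eq_zero fun i _ => Set.indicator_of_notMem (hcon i) _] at c3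
    simp at c3
  have d2 := le_stepThreshold_of_excess_nonpos (α := α) (T := fun i => S m i ω) c2' hj.2
  have d3 := hj.1
  rcases abs_cases ((stepThreshold α fun i => S m i ω) - t) with h | h <;> linarith

end Concentration

/-! ### Error rates of a consistent decision rule -/

section Rates

variable {Ω : Type*} [MeasurableSpace Ω] {P : Measure Ω} [IsProbabilityMeasure P]

lemma indicator_one_mem_Icc {β : Type*} (A : Set β) (b : β) :
    Set.indicator A (fun _ => (1 : ℝ)) b ∈ Set.Icc (0 : ℝ) 1 := by
  by_cases h : b ∈ A <;> simp [h]

lemma abs_sub_mem_Icc {x y : ℝ} (hx : x ∈ Set.Icc (0 : ℝ) 1) (hy : y ∈ Set.Icc (0 : ℝ) 1) :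
    |x - y| ∈ Set.Icc (0 : ℝ) 1 :=
  ⟨abs_nonneg _, abs_le.2 ⟨by linarith [hx.1, hy.2], by linarith [hx.2, hy.1]⟩⟩

lemma integrable_of_mem_Icc {f : Ω → ℝ} (hf : Measurable f) (h : ∀ ω, f ω ∈ Set.Icc (0 : ℝ) 1) :
    Integrable f P :=
  integrable_of_abs_le hf (C := 1) fun ω => by rw [abs_of_nonneg (h ω).1]; exact (h ω).2

lemma tendsto_integral_abs_sub {f : ℕ → Ω → ℝ} {c : ℝ}
    (hf : TendstoInMeasure P f atTop fun _ => c) (hm : ∀ m, Measurable (f m))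
    (h01 : ∀ m ω, f m ω ∈ Set.Icc (0 : ℝ) 1) (hc : c ∈ Set.Icc (0 : ℝ) 1) :
    Tendsto (fun m => ∫ ω, |f m ω - c| ∂P) atTop (𝓝 0) := by
  refine ((Negligible.of_tendstoInMeasure hf).tendsto_integral
    (fun m _ => ((hm m).sub_const c).abs) fun m _ ω => abs_sub_mem_Icc (h01 m ω) hc).congr' ?_
  filter_upwards [eventually_gt_atTop 0] with m hm0
  have : (m : ℝ) ≠ 0 := by exact_mod_cast hm0.ne'
  simp only [Finset.sum_const, Finset.card_univ, Fintype.card_fin, nsmul_eq_mul]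
  field_simp

variable {D O W : (m : ℕ) → Fin m → Ω → ℝ} (hDm : ∀ m i, Measurable (D m i))
  (hOm : ∀ m i, Measurable (O m i)) (hD : ∀ m i ω, D m i ω ∈ Set.Icc (0 : ℝ) 1)
  (hO : ∀ m i ω, O m i ω ∈ Set.Icc (0 : ℝ) 1)
  (hDO : Negligible P fun m i ω => |D m i ω - O m i ω|)

include hDm hOm hD hO hDO in
-- The weights are bounded by 1, so replacing D by O costs at most the mean of |D - O| per unit, and
-- for O every unit contributes the same c.
lemma tendsto_integral_sum_mul (hWm : ∀ m i, Measurable (W m i))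
    (hW : ∀ m i ω, W m i ω ∈ Set.Icc (0 : ℝ) 1) {c : ℝ}
    (hc : ∀ m i, ∫ ω, W m i ω * O m i ω ∂P = c) :
    Tendsto (fun m : ℕ => (∫ ω, ∑ i, W m i ω * D m i ω ∂P) / m) atTop (𝓝 c) := by
  have h := hDO.tendsto_integral (fun m i => ((hDm m i).sub (hOm m i)).abs)
    fun m i ω => abs_sub_mem_Icc (hD m i ω) (hO m i ω)
  rw [tendsto_iff_dist_tendsto_zero]
  refine squeeze_zero' (Eventually.of_forall fun _ => dist_nonneg) ?_ h
  filter_upwards [eventually_gt_atTop 0] with m hm0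
  have hm : (0 : ℝ) < m := by exact_mod_cast hm0
  have hi : ∀ {E : Fin m → Ω → ℝ}, (∀ i, Measurable (E i)) → (∀ i ω, E i ω ∈ Set.Icc (0 : ℝ) 1) →
      ∀ i, Integrable (fun ω => W m i ω * E i ω) P := fun hE hE1 i =>
    integrable_of_mem_Icc ((hWm m i).mul (hE i)) fun ω =>
      ⟨mul_nonneg (hW m i ω).1 (hE1 i ω).1, mul_le_one₀ (hW m i ω).2 (hE1 i ω).1 (hE1 i ω).2⟩
  have hiD := hi (hDm m) (hD m)
  have hiO := hi (hOm m) (hO m)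
  have e : c = (∑ i, ∫ ω, W m i ω * O m i ω ∂P) / m := by
    simp only [hc, Finset.sum_const, Finset.card_univ, Fintype.card_fin, nsmul_eq_mul]
    field_simp
  rw [integral_finsetSum _ fun i _ => hiD i, Real.dist_eq, e, ← sub_div,
    ← Finset.sum_sub_distrib, abs_div, abs_of_pos hm]
  gcongr
  refine (Finset.abs_sum_le_sum_abs _ _).trans (Finset.sum_le_sum fun i _ => ?_)
  rw [← integral_sub (hiD i) (hiO i)]
  refine (abs_integral_le_integral_abs).trans (integral_mono
    ((hiD i).sub (hiO i)).abs (integrable_of_mem_Icc ((hDm m i).sub (hOm m i)).abs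
      fun ω => abs_sub_mem_Icc (hD m i ω) (hO m i ω)) fun ω => ?_)
  dsimp only
  rw [← mul_sub, abs_mul, abs_of_nonneg (hW m i ω).1]
  exact mul_le_of_le_one_left (abs_nonneg _) (hW m i ω).2

include hDm hOm hD hO hDO in
lemma tendsto_integral_average_sub {d : ℝ} (hd : d ∈ Set.Icc (0 : ℝ) 1)
    (hOd : TendstoInMeasure P (fun m ω => (∑ i, O m i ω) / m) atTop fun _ => d) :
    Tendsto (fun m : ℕ => ∫ ω, |(∑ i, D m i ω) / m - d| ∂P) atTop (𝓝 0) := by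
  have hav : ∀ {E : (m : ℕ) → Fin m → Ω → ℝ}, (∀ m i ω, E m i ω ∈ Set.Icc (0 : ℝ) 1) →
      ∀ m ω, (∑ i, E m i ω) / m ∈ Set.Icc (0 : ℝ) 1 := fun hE m ω => by
    refine ⟨div_nonneg (Finset.sum_nonneg fun i _ => (hE m i ω).1) (Nat.cast_nonneg m),
      div_le_one_of_le₀ ?_ (Nat.cast_nonneg m)⟩
    refine (Finset.sum_le_sum fun i _ => (hE m i ω).2).trans (by simp)
  have hDO1 : ∀ m i ω, |D m i ω - O m i ω| ∈ Set.Icc (0 : ℝ) 1 :=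
    fun m i ω => abs_sub_mem_Icc (hD m i ω) (hO m i ω)
  have hDOm : ∀ m i, Measurable fun ω => |D m i ω - O m i ω| :=
    fun m i => ((hDm m i).sub (hOm m i)).abs
  have h1 := hDO.tendsto_integral hDOm hDO1
  have h2 := tendsto_integral_abs_sub hOd (fun m => by fun_prop) (hav hO) hd
  have h3 := h1.add h2
  rw [add_zero] at h3
  refine squeeze_zero (fun m => integral_nonneg fun ω => abs_nonneg _) (fun m => ?_) h3
  have hi : ∀ i, Integrable (fun ω => |D m i ω - O m i ω|) P := fun i =>
    integrable_of_mem_Icc (hDOm m i) (hDO1 m i)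
  have hi2 : Integrable (fun ω => |(∑ i, O m i ω) / m - d|) P :=
    integrable_of_mem_Icc (by fun_prop) fun ω => abs_sub_mem_Icc (hav hO m ω) hd
  rw [← integral_finsetSum _ fun i _ => hi i, ← integral_div, ← integral_add
    ((integrable_finsetSum _ fun i _ => hi i).div_const _) hi2]
  refine integral_mono (integrable_of_mem_Icc (by fun_prop) fun ω =>
    abs_sub_mem_Icc (hav hD m ω) hd)
    (((integrable_finsetSum _ fun i _ => hi i).div_const _).add hi2) fun ω => ?_
  dsimp only
  refine (abs_sub_le _ ((∑ i, O m i ω) / m) _).trans (add_le_add_left ?_ _)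
  rw [← sub_div, ← Finset.sum_sub_distrib, abs_div, abs_of_nonneg (Nat.cast_nonneg (α := ℝ) m)]
  gcongr
  exact Finset.abs_sum_le_sum_abs _ _

/-- The quotient is at most 1, so replacing its denominator by m d costs only |B/m - d|/d. No lower
bound for the number of rejections is needed, and the FDR is controlled through expectations; the
last summand is slack. -/
lemma div_max_one_le {A B m d : ℝ} (hA : 0 ≤ A) (hAB : A ≤ B) (hm : 0 < m) (hd : 0 < d) :
    A / max B 1 ≤ A / m / d + |B / m - d| / d + 1 / m / d := by
  have hB : 0 < max B 1 := lt_max_of_lt_right one_pos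
  have h1 : A / max B 1 ≤ 1 := div_le_one_of_le₀ (hAB.trans (le_max_left _ _)) hB.le
  have h2 : m * d - max B 1 ≤ m * |B / m - d| := by
    have e : m * (B / m) = B := by field_simp
    nlinarith [neg_abs_le (B / m - d), le_max_left B 1]
  have h3 : A / max B 1 * (m * d) = A + A / max B 1 * (m * d - max B 1) := by field_simp; ring
  have h4 : A / max B 1 * (m * d - max B 1) ≤ m * |B / m - d| :=
    (mul_le_mul_of_nonneg_left h2 (by positivity)).trans
      (mul_le_of_le_one_left (by positivity) h1)
  have h5 : A / m / d + |B / m - d| / d + 1 / m / d = (A + m * |B / m - d| + 1) / (m * d) := by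
    field_simp
  rw [h5, le_div_iff₀ (by positivity)]
  linarith

lemma FDR_le {m : ℕ} (hm : 0 < m) {θ D : Fin m → Ω → ℝ} (hθm : ∀ i, Measurable (θ i))
    (hDm : ∀ i, Measurable (D i)) (hθ : ∀ i ω, θ i ω ∈ Set.Icc (0 : ℝ) 1)
    (hD : ∀ i ω, D i ω ∈ Set.Icc (0 : ℝ) 1) {d : ℝ} (hd : 0 < d) :
    FDR P θ D ≤ (∫ ω, ∑ i, (1 - θ i ω) * D i ω ∂P) / m / d
      + (∫ ω, |(∑ i, D i ω) / m - d| ∂P) / d + 1 / m / d := by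
  have hm' : (0 : ℝ) < m := by exact_mod_cast hm
  have hA0 : ∀ ω i, 0 ≤ (1 - θ i ω) * D i ω := fun ω i =>
    mul_nonneg (by linarith [(hθ i ω).2]) (hD i ω).1
  have hA1 : ∀ ω i, (1 - θ i ω) * D i ω ≤ D i ω := fun ω i =>
    mul_le_of_le_one_left (hD i ω).1 (by linarith [(hθ i ω).1])
  have i1 : Integrable (fun ω => ∑ i, (1 - θ i ω) * D i ω) P :=
    integrable_finsetSum _ fun i _ => integrable_of_mem_Icc (by fun_prop) fun ω =>
      ⟨hA0 ω i, (hA1 ω i).trans (hD i ω).2⟩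
  have i2 : Integrable (fun ω => |(∑ i, D i ω) / m - d|) P :=
    (((integrable_finsetSum _ fun i _ => integrable_of_mem_Icc (hDm i) (hD i)).div_const _).sub
      (integrable_const d)).abs
  have i3 : Integrable (fun _ : Ω => 1 / (m : ℝ) / d) P := integrable_const _
  have e : (∫ ω, ∑ i, (1 - θ i ω) * D i ω ∂P) / m / d
      + (∫ ω, |(∑ i, D i ω) / m - d| ∂P) / d + 1 / m / d
      = ∫ ω, (((∑ i, (1 - θ i ω) * D i ω) / m / d + |(∑ i, D i ω) / m - d| / d) + 1 / m / d) ∂P := by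
    rw [integral_add (((i1.div_const _).div_const _).fun_add (i2.div_const _)) i3,
      integral_add ((i1.div_const _).div_const _) (i2.div_const _), integral_div, integral_div,
      integral_div]
    simp
  rw [e, FDR]
  refine integral_mono_of_nonneg (Eventually.of_forall fun ω => ?_)
    ((((i1.div_const _).div_const _).add (i2.div_const _)).add i3)
    (Eventually.of_forall fun ω => ?_)
  · exact div_nonneg (Finset.sum_nonneg fun i _ => hA0 ω i) (le_max_of_le_right zero_le_one)
  · exact div_max_one_le (Finset.sum_nonneg fun i _ => hA0 ω i)
      (Finset.sum_le_sum fun i _ => hA1 ω i) hm' hd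

lemma exists_tendsto_zero_of_le {f g : ℕ → ℝ} {a α : ℝ} (hg : Tendsto g atTop (𝓝 a)) (ha : a ≤ α)
    (hfg : ∀ᶠ m in atTop, f m ≤ g m) :
    ∃ ε : ℕ → ℝ, Tendsto ε atTop (𝓝 0) ∧ ∀ m, f m ≤ α + ε m := by
  refine ⟨fun m => max (f m - α) 0, ?_, fun m => by linarith [le_max_left (f m - α) 0]⟩
  have h : Tendsto (fun m => max (g m - α) 0) atTop (𝓝 0) := by
    have := (hg.sub_const α).max (tendsto_const_nhds (x := (0 : ℝ)))
    rwa [max_eq_right (by linarith)] at this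
  refine squeeze_zero' (Eventually.of_forall fun _ => le_max_right _ _) ?_ h
  filter_upwards [hfg] with m hm
  gcongr

end Rates

/-! ### Application to the model -/

section Application

variable {Ω : Type*} [MeasurableSpace Ω] {P : Measure Ω} [IsProbabilityMeasure P]
  {gμ gσ : Measure ℝ} [IsProbabilityMeasure gμ] [IsProbabilityMeasure gσ] {p : ℝ}
  (hp0 : 0 < p) (hp1 : p < 1) (hg : gμ {0} = 0) (hpos : ∀ᵐ v ∂gσ, 0 < v)
  {μ V X : ℕ → Ω → ℝ} (hmodel : IsModel P p gμ gσ μ V X)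

lemma theta_mem_Icc (m : ℕ) (i : Fin m) (ω : Ω) : theta μ m i ω ∈ Set.Icc (0 : ℝ) 1 :=
  indicator_one_mem_Icc _ _

lemma oracleRule_eq (m : ℕ) (t : ℝ) (i : Fin m) (ω : Ω) :
    oracleRule p gμ V X m t i ω
      = Set.indicator (Set.Iio t) (fun _ => (1 : ℝ)) (unitT p gμ V X i ω) := rfl

lemma oracleRule_mem_Icc (m : ℕ) (t : ℝ) (i : Fin m) (ω : Ω) :
    oracleRule p gμ V X m t i ω ∈ Set.Icc (0 : ℝ) 1 :=
  indicator_one_mem_Icc _ _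

lemma abs_clamp_sub_le (x : ℝ) {y : ℝ} (hy : y ∈ Set.Icc (0 : ℝ) 1) :
    |min (max x 0) 1 - y| ≤ |x - y| := by
  have h1 := abs_min_sub_min_le_max (max x 0) 1 (max y 0) 1
  rw [sub_self, abs_zero, max_eq_left (abs_nonneg (max x 0 - _)), max_eq_left hy.1, min_eq_left hy.2] at h1
  have h2 := abs_max_sub_max_le_abs x y 0
  rw [max_eq_left hy.1] at h2
  exact h1.trans h2

lemma dataT_mem_Icc {hx hs : ℕ → ℝ} (hx0 : ∀ m, 0 < hx m) (hs0 : ∀ m, 0 < hs m)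
    {phat : ℕ → Ω → ℝ} {m : ℕ} {ω : Ω} (hq0 : 0 ≤ phat m ω) (hq1 : phat m ω ≤ 1) (i : Fin m) :
    dataT hx hs phat V X m ω i ∈ Set.Icc (0 : ℝ) 1 := by
  have hs' : ∀ j : Fin m, 0 ≤ √(V j ω) := fun j => Real.sqrt_nonneg _
  rw [dataT, That]
  refine updateT_mem_Icc (hx0 m) (hs0 m) hs' hq0 hq1 (fun j => ?_) i
  refine (updateT_mem_Icc (hx0 m) (hs0 m) hs' hq0 hq1 (fun k => ?_) j).2
  exact (That0_mem_Icc (hx0 m) (hs0 m) hs' hq1 k).2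

include hmodel

lemma measurable_unit (i : ℕ) : Measurable fun ω => ((μ i ω, V i ω), X i ω) := by
  have := hmodel.measurable_effect i
  have := hmodel.measurable_var i
  have := hmodel.measurable_obs i
  fun_prop

lemma measurable_theta (m : ℕ) (i : Fin m) : Measurable (theta μ m i) :=
  measurable_const.indicator ((measurableSet_singleton (0 : ℝ)).compl.preimage
    (hmodel.measurable_effect i))

lemma measurable_oracleRule (m : ℕ) (t : ℝ) (i : Fin m) :
    Measurable (oracleRule p gμ V X m t i) :=
  measurable_const.indicator (measurableSet_Iio.preimage (measurable_unitT hmodel i))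

lemma map_unitT (i : ℕ) : P.map (unitT p gμ V X i) = oracleLaw p gμ gσ := by
  rw [oracleLaw, ← hmodel.law i, Measure.map_map (by fun_prop) (measurable_unit hmodel i)]
  rfl

lemma iIndepFun_unitT : iIndepFun (unitT p gμ V X) P :=
  hmodel.indep.comp (fun _ q => oracleT p gμ q.2 √q.1.2) fun _ => by fun_prop

lemma integral_oracleRule (m : ℕ) (t : ℝ) (i : Fin m) :
    ∫ ω, oracleRule p gμ V X m t i ω ∂P = (oracleLaw p gμ gσ).real (Set.Iio t) := by
  simp_rw [oracleRule_eq]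
  rw [← map_unitT hmodel i, map_measureReal_apply (measurable_unitT hmodel i) measurableSet_Iio]
  exact integral_indicator_one (measurableSet_Iio.preimage (measurable_unitT hmodel i))

include hp0 hp1 hg hpos

lemma integral_null_mul_oracleRule (m : ℕ) (t : ℝ) (i : Fin m) :
    ∫ ω, (1 - theta μ m i ω) * oracleRule p gμ V X m t i ω ∂P
      = ∫ u in Set.Iio t, u ∂(oracleLaw p gμ gσ) := by
  have hB : MeasurableSet {q : (ℝ × ℝ) × ℝ | q.1.1 = 0 ∧ oracleT p gμ q.2 √q.1.2 ∈ Set.Iio t} :=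
    ((measurableSet_singleton (0 : ℝ)).preimage (by fun_prop)).inter
      ((measurableSet_Iio (a := t)).preimage (by fun_prop))
  have hA := hB.preimage (measurable_unit hmodel i)
  have e : ∀ ω, (1 - theta μ m i ω) * oracleRule p gμ V X m t i ω
      = Set.indicator ((fun ω => ((μ i ω, V i ω), X i ω)) ⁻¹'
        {q | q.1.1 = 0 ∧ oracleT p gμ q.2 √q.1.2 ∈ Set.Iio t}) 1 ω := fun ω => by
    by_cases h1 : μ i ω = 0 <;> by_cases h2 : oracleT p gμ (X i ω) √(V i ω) < t <;>
      simp [theta, oracleRule, Set.indicator, h1, h2]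
  simp_rw [e]
  have hae : 0 ≤ᵐ[(oracleLaw p gμ gσ).restrict (Set.Iio t)] fun u => u :=
    ae_restrict_of_ae ((ae_mem_Icc_of_compl (oracleLaw_compl_Icc hp0 hp1)).mono
      fun u hu => hu.1)
  rw [integral_indicator_one hA, integral_eq_lintegral_of_nonneg_ae hae (by fun_prop),
    ← unitLaw_null_inter hp0 hp1 hg hpos measurableSet_Iio, measureReal_def, ← hmodel.law i,
    Measure.map_apply (measurable_unit hmodel i) hB]

lemma integral_nonnull_mul_oracleRule (m : ℕ) (t : ℝ) (i : Fin m) :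
    ∫ ω, theta μ m i ω * oracleRule p gμ V X m t i ω ∂P
      = (oracleLaw p gμ gσ).real (Set.Iio t) - ∫ u in Set.Iio t, u ∂(oracleLaw p gμ gσ) := by
  have hm1 := measurable_theta hmodel m i
  have hm2 := measurable_oracleRule hmodel m t i
  rw [← integral_null_mul_oracleRule hp0 hp1 hg hpos hmodel m t i,
    ← integral_oracleRule hmodel m t i, ← integral_sub]
  · refine integral_congr_ae (Eventually.of_forall fun ω => ?_)
    dsimp only
    ring
  · exact integrable_of_mem_Icc hm2 (oracleRule_mem_Icc m t i)
  · refine integrable_of_mem_Icc (by fun_prop) fun ω => ?_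
    have h1 := theta_mem_Icc (μ := μ) m i ω
    have h2 := oracleRule_mem_Icc (p := p) (gμ := gμ) (V := V) (X := X) m t i ω
    exact ⟨mul_nonneg (by linarith [h1.2]) h2.1, mul_le_one₀ (by linarith [h1.1]) h2.1 h2.2⟩

/-- Both integrals in the mFDR are m times those of a single unit, so m cancels. For m = 0 the ratio
is 0/0 and every t would qualify. -/
lemma tStar_eq (α : ℝ) {m : ℕ} (hm : 0 < m) :
    tStar P p gμ μ V X α m = lawThreshold (oracleLaw p gμ gσ) α := by
  have hm' : (m : ℝ) ≠ 0 := by exact_mod_cast hm.ne'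
  rw [tStar, lawThreshold]
  congr 1
  ext t
  have h1 : ∀ i : Fin m, Measurable (theta μ m i) := measurable_theta hmodel m
  have h2 := measurable_oracleRule hmodel m t
  have h3 := theta_mem_Icc (μ := μ) m
  have h4 := oracleRule_mem_Icc (p := p) (gμ := gμ) (V := V) (X := X) m t
  have e : mFDR P (theta μ m) (oracleRule p gμ V X m t)
      = (∫ u in Set.Iio t, u ∂(oracleLaw p gμ gσ)) / (oracleLaw p gμ gσ).real (Set.Iio t) := by
    rw [mFDR, integral_finsetSum _ fun i _ => integrable_of_mem_Icc (by fun_prop) fun ω =>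
        ⟨mul_nonneg (by linarith [(h3 i ω).2]) (h4 i ω).1,
          mul_le_one₀ (by linarith [(h3 i ω).1]) (h4 i ω).1 (h4 i ω).2⟩,
      integral_finsetSum _ fun i _ => integrable_of_mem_Icc (h2 i) (h4 i)]
    simp only [integral_null_mul_oracleRule hp0 hp1 hg hpos hmodel, integral_oracleRule hmodel,
      Finset.sum_const, Finset.card_univ, Fintype.card_fin, nsmul_eq_mul]
    rw [mul_div_mul_left _ _ hm']
  simp only [Set.mem_ofPred_eq, e]

lemma ETP_oracleRule (m : ℕ) (t : ℝ) :
    ETP P (theta μ m) (oracleRule p gμ V X m t) = m * ((oracleLaw p gμ gσ).real (Set.Iio t) -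
      ∫ u in Set.Iio t, u ∂(oracleLaw p gμ gσ)) := by
  have h1 : ∀ i : Fin m, Measurable (theta μ m i) := measurable_theta hmodel m
  have h2 := measurable_oracleRule hmodel m t
  have h3 := theta_mem_Icc (μ := μ) m
  have h4 := oracleRule_mem_Icc (p := p) (gμ := gμ) (V := V) (X := X) m t
  rw [ETP, integral_finsetSum _ fun i _ => integrable_of_mem_Icc (by fun_prop) fun ω =>
        ⟨mul_nonneg (h3 i ω).1 (h4 i ω).1, mul_le_one₀ (h3 i ω).2 (h4 i ω).1 (h4 i ω).2⟩]
  simp only [integral_nonnull_mul_oracleRule hp0 hp1 hg hpos hmodel, Finset.sum_const,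
    Finset.card_univ, Fintype.card_fin, nsmul_eq_mul]

variable {hx hs : ℕ → ℝ} (hx0 : ∀ m, 0 < hx m) (hs0 : ∀ m, 0 < hs m)
  {phat : ℕ → Ω → ℝ} (hphat_meas : ∀ m, Measurable (phat m))
  (hphat : TendstoInMeasure P phat atTop fun _ => p)
  (hneg : Negligible P fun m i ω => |dataT hx hs phat V X m ω i - unitT p gμ V X i ω|)
  {α : ℝ} (hα0 : 0 < α) (hα1 : α < 1 - p)

omit hp0 hp1 hg hpos in
include hphat_meas in
lemma measurable_dataT (m : ℕ) : Measurable fun ω => dataT hx hs phat V X m ω := by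
  have := hmodel.measurable_var
  have := hmodel.measurable_obs
  exact measurable_That (hphat_meas m) (by fun_prop) (by fun_prop)

omit hp0 hp1 hg hpos in
include hphat_meas in
lemma measurable_deltaDD (m : ℕ) (i : Fin m) : Measurable (deltaDD hx hs phat V X α m i) := by
  have hd := measurable_dataT (hx := hx) (hs := hs) hmodel hphat_meas m
  exact measurable_const.indicator (measurableSet_le (measurable_pi_iff.1 hd i)
    (measurable_stepThreshold.comp hd))

include hx0 hs0 hphat hphat_meas hneg hα0 hα1

lemma tendstoInMeasure_tHat :
    TendstoInMeasure P (tHat hx hs phat V X α) atTop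
      fun _ => lawThreshold (oracleLaw p gμ gσ) α := by
  have := isProbabilityMeasure_oracleLaw (gμ := gμ) (gσ := gσ) hp0 hp1
  have := nullSingletonClass_oracleLaw hp0 hp1 hg hpos
  have hstep := tendstoInMeasure_stepThreshold (P := P) (ν := oracleLaw p gμ gσ)
    -- The statistics lie in [0, 1] only when `phat` does. Clamping enforces this everywhere and
    -- changes nothing when `phat` is within min(p, 1 - p) of p, which fails with vanishing
    -- probability.
    (S := fun m i ω => min (max (dataT hx hs phat V X m ω i) 0) 1)
    (measurable_unitT hmodel) (map_unitT hmodel) (iIndepFun_unitT hmodel)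
    (hneg.mono (Eventually.of_forall fun m i => Eventually.of_forall fun ω =>
      abs_clamp_sub_le _ (unitT_mem_Icc hp0 hp1 i ω)))
    (oracleLaw_compl_Icc hp0 hp1) hα0 (by linarith)
    (by rw [integral_id_oracleLaw hp0 hp1 hg hpos]; exact hα1)
    (fun t ht => oracleLaw_Iio_pos hp0 hp1 hg hpos ht)
    (fun s t hs hst ht => oracleLaw_Ioo_pos hp0 hp1 hg hpos hs hst ht)
    (fun m i => by
      have := measurable_pi_iff.1 (measurable_dataT (hx := hx) (hs := hs) hmodel hphat_meas m) i
      fun_prop)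
    (fun m i ω => ⟨le_min (le_max_right _ _) zero_le_one, min_le_right _ _⟩)
  rw [tendstoInMeasure_iff_measureReal_dist] at hstep hphat ⊢
  intro ε hε
  have h := (hstep ε hε).add (hphat (min p (1 - p)) (lt_min hp0 (by linarith)))
  rw [add_zero] at h
  refine squeeze_zero (fun _ => measureReal_nonneg) (fun m => ?_) h
  refine le_trans (measureReal_mono fun ω hω => ?_) (measureReal_union_le _ _)
  simp only [Set.mem_union, Set.mem_ofPred_eq] at hω ⊢
  by_contra! hc
  obtain ⟨c1, c2⟩ := hc
  rw [Real.dist_eq] at c2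
  have q1 := abs_lt.1 (c2.trans_le (min_le_left _ _))
  have q2 := abs_lt.1 (c2.trans_le (min_le_right _ _))
  have hmem := dataT_mem_Icc (V := V) (X := X) hx0 hs0 (m := m) (ω := ω) (phat := phat)
    (by linarith) (by linarith)
  have e : (fun i => min (max (dataT hx hs phat V X m ω i) 0) 1) = dataT hx hs phat V X m ω :=
    funext fun i => by rw [max_eq_left (hmem i).1, min_eq_left (hmem i).2]
  rw [e] at c1
  exact absurd hω (not_le.2 c1)

/-- If the errors of the statistic and of the threshold add up to at most δ, the two decisions can
differ only when T is within δ of t*. The law of T has no atom there, so this has small probability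
for small δ. -/
lemma negligible_deltaDD_sub :
    Negligible P fun m i ω => |deltaDD hx hs phat V X α m i ω -
      oracleRule p gμ V X m (lawThreshold (oracleLaw p gμ gσ) α) i ω| := by
  have := isProbabilityMeasure_oracleLaw (gμ := gμ) (gσ := gσ) hp0 hp1
  have := nullSingletonClass_oracleLaw hp0 hp1 hg hpos
  obtain ⟨t, ht⟩ : ∃ t, t = lawThreshold (oracleLaw p gμ gσ) α := ⟨_, rfl⟩
  have hb := hneg.add (Negligible.of_tendstoInMeasure (tendstoInMeasure_tHat hp0 hp1 hg hpos hmodel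
    hx0 hs0 hphat_meas hphat hneg hα0 hα1))
  rw [← ht] at hb ⊢
  refine Negligible.of_approx fun ε hε η hη => ⟨_, hb, ?_⟩
  obtain ⟨δ, hδ, hle⟩ := exists_measureReal_closedBall_le (ν := oracleLaw p gμ gσ) t hη
  refine ⟨δ, hδ, Eventually.of_forall fun m i => ?_⟩
  rw [← map_unitT hmodel i, map_measureReal_apply (measurable_unitT hmodel i)
    Metric.isClosed_closedBall.measurableSet] at hle
  refine le_trans (le_trans (measureReal_mono (s₂ := {ω | δ < |dataT hx hs phat V X m ω i -
    unitT p gμ V X i ω| + |tHat hx hs phat V X α m ω - t|} ∪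
    unitT p gμ V X i ⁻¹' Metric.closedBall t δ) fun ω hω => ?_) (measureReal_union_le _ _))
    (add_le_add_right hle _)
  simp only [Set.mem_union, Set.mem_ofPred_eq, Set.mem_preimage, Metric.mem_closedBall,
    Real.dist_eq] at hω ⊢
  by_contra! hc
  obtain ⟨c1, c2⟩ := hc
  have b1 := le_abs_self (dataT hx hs phat V X m ω i - unitT p gμ V X i ω)
  have b2 := neg_abs_le (dataT hx hs phat V X m ω i - unitT p gμ V X i ω)
  have b3 := le_abs_self (tHat hx hs phat V X α m ω - t)
  have b4 := neg_abs_le (tHat hx hs phat V X α m ω - t)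
  have heq : deltaDD hx hs phat V X α m i ω = oracleRule p gμ V X m t i ω := by
    by_cases h : unitT p gμ V X i ω < t
    · rw [abs_of_neg (a := unitT p gμ V X i ω - t) (by linarith)] at c2
      have h' : dataT hx hs phat V X m ω i ≤ tHat hx hs phat V X α m ω := by linarith
      have h2 : oracleT p gμ (X i ω) √(V i ω) < t := h
      simp [deltaDD, oracleRule, Set.indicator, h', h2]
    · rw [abs_of_nonneg (a := unitT p gμ V X i ω - t) (by linarith)] at c2
      have h' : ¬ dataT hx hs phat V X m ω i ≤ tHat hx hs phat V X α m ω := by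
        rw [not_le]; linarith
      have h2 : ¬ oracleT p gμ (X i ω) √(V i ω) < t := h
      simp [deltaDD, oracleRule, Set.indicator, h', h2]
  rw [heq, sub_self, abs_zero] at hω
  linarith

end Application

end HART

end

/-! ### The theorem: error rates and power from the limits per unit -/

theorem theorem2 {Ω : Type*} [MeasurableSpace Ω] (P : Measure Ω) [IsProbabilityMeasure P]
    (p α : ℝ) (hp0 : 0 < p) (hp1 : p < 1) (hα0 : 0 < α) (hα1 : α < 1 - p)
    (gμ gσ : Measure ℝ) [IsProbabilityMeasure gμ] [IsProbabilityMeasure gσ] (hgμ0 : gμ {0} = 0)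
    (μ V X : ℕ → Ω → ℝ) (hmodel : HART.IsModel P p gμ gσ μ V X)
    (M₁ M₂ M : ℝ) (hM₁ : 0 < M₁) (hgσ : gσ.support ⊆ Set.Ioo M₁ M₂)
    (hgμ : gμ.support ⊆ Set.Ioo (-M) M)
    (hx hs : ℕ → ℝ) (hbw : HART.BandwidthCondition hx hs)
    (phat : ℕ → Ω → ℝ) (hphat_meas : ∀ m, Measurable (phat m))
    (hphat : TendstoInMeasure P phat atTop (fun _ => p)) :
    TendstoInMeasure P
      (fun m ω => HART.tHat hx hs phat V X α m ω - HART.tStar P p gμ μ V X α m) atTop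
      (fun _ => 0) ∧
    (∃ ε : ℕ → ℝ, Tendsto ε atTop (𝓝 0) ∧ ∀ m,
      HART.mFDR P (HART.theta μ m) (HART.deltaDD hx hs phat V X α m) ≤ α + ε m) ∧
    (∃ ε : ℕ → ℝ, Tendsto ε atTop (𝓝 0) ∧ ∀ m,
      HART.FDR P (HART.theta μ m) (HART.deltaDD hx hs phat V X α m) ≤ α + ε m) ∧
    Tendsto (fun m : ℕ =>
      HART.ETP P (HART.theta μ m) (HART.deltaDD hx hs phat V X α m) /
        HART.ETP P (HART.theta μ m) (HART.deltaFull P p gμ μ V X α m)) atTop (𝓝 1) := by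
  have hS : ∀ᵐ v ∂gσ, v ∈ Set.Icc M₁ M₂ := by
    filter_upwards [Measure.support_mem_ae (μ := gσ)] with v hv
    exact Set.Ioo_subset_Icc_self (hgσ hv)
  have hM : M₁ ≤ M₂ := by
    obtain ⟨v, hv⟩ := hS.exists
    exact hv.1.trans hv.2
  have hpos : ∀ᵐ v ∂gσ, 0 < v := hS.mono fun v hv => hM₁.trans_le hv.1
  have hneg := HART.negligible_dataT_sub hp0 hp1 hmodel hM₁ hM hS hbw.pos_x hbw.pos_s
    hbw.tendsto_x hbw.tendsto_s (hbw.tendsto_inv_mul_diagBound M₁ M₂)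
    (hbw.tendsto_diagBound hM₁ M₂) hphat_meas hphat
  have := HART.isProbabilityMeasure_oracleLaw (gμ := gμ) (gσ := gσ) hp0 hp1
  have := HART.nullSingletonClass_oracleLaw hp0 hp1 hgμ0 hpos
  have hν := HART.oracleLaw_compl_Icc (gμ := gμ) (gσ := gσ) hp0 hp1
  have hmean : α < ∫ u, u ∂(HART.oracleLaw p gμ gσ) := by
    rw [HART.integral_id_oracleLaw hp0 hp1 hgμ0 hpos]; exact hα1
  have htHat := HART.tendstoInMeasure_tHat hp0 hp1 hgμ0 hpos hmodel hbw.pos_x hbw.pos_s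
    hphat_meas hphat hneg hα0 hα1
  have hDO := HART.negligible_deltaDD_sub hp0 hp1 hgμ0 hpos hmodel hbw.pos_x hbw.pos_s
    hphat_meas hphat hneg hα0 hα1
  have htpos := hα0.trans_le (HART.le_lawThreshold hν hα0 hmean)
  have hexc := HART.lawExcess_lawThreshold_nonpos hν hα0 hmean
  rw [HART.lawExcess_eq hν] at hexc
  have htStar : ∀ {m : ℕ}, 0 < m → HART.tStar P p gμ μ V X α m
      = HART.lawThreshold (HART.oracleLaw p gμ gσ) α := fun hm =>
    HART.tStar_eq hp0 hp1 hgμ0 hpos hmodel α hm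
  obtain ⟨t, ht⟩ : ∃ t, t = HART.lawThreshold (HART.oracleLaw p gμ gσ) α := ⟨_, rfl⟩
  simp only [← ht] at htHat hDO htpos hexc htStar
  have hOm := fun m => HART.measurable_oracleRule hmodel m t
  have hDm := HART.measurable_deltaDD (hx := hx) (hs := hs) (α := α) hmodel hphat_meas
  have hθm := HART.measurable_theta hmodel
  have hθ := HART.theta_mem_Icc (μ := μ)
  have hO := fun m => HART.oracleRule_mem_Icc (p := p) (gμ := gμ) (V := V) (X := X) m t
  have hD : ∀ m i ω, HART.deltaDD hx hs phat V X α m i ω ∈ Set.Icc (0 : ℝ) 1 :=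
    fun m i ω => HART.indicator_one_mem_Icc _ _
  -- At t*, a is the probability that a unit is falsely rejected and d the probability that it is
  -- rejected; nonpositivity of the excess at t* reads a ≤ α d.
  obtain ⟨a, ha⟩ : ∃ a, a = ∫ u in Set.Iio t, u ∂(HART.oracleLaw p gμ gσ) := ⟨_, rfl⟩
  obtain ⟨d, hd⟩ : ∃ d, d = (HART.oracleLaw p gμ gσ).real (Set.Iio t) := ⟨_, rfl⟩
  have hd0 : 0 < d := hd ▸ HART.measureReal_Iio_pos
    (fun _ h => HART.oracleLaw_Iio_pos hp0 hp1 hgμ0 hpos h) htpos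
  have hd1 : d ≤ 1 := hd ▸ measureReal_le_one
  rw [← ha, ← hd] at hexc
  have had : a / d ≤ α := by rw [div_le_iff₀ hd0]; linarith
  -- From a ≤ α d with α < 1 and d > 0; d - a is the oracle power per unit, so the power ratio has a
  -- positive denominator.
  have hda : 0 < d - a := by nlinarith
  have hA := HART.tendsto_integral_sum_mul hDm hOm hD hO hDO
    (W := fun m i ω => 1 - HART.theta μ m i ω) (fun m i => (hθm m i).const_sub 1)
    (fun m i ω => ⟨by linarith [(hθ m i ω).2], by linarith [(hθ m i ω).1]⟩) (c := a)
    (fun m i => (HART.integral_null_mul_oracleRule hp0 hp1 hgμ0 hpos hmodel m t i).trans ha.symm)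
  have hB := HART.tendsto_integral_sum_mul hDm hOm hD hO hDO (W := fun _ _ _ => 1)
    (fun _ _ => measurable_const) (fun _ _ _ => by simp) (c := d)
    (fun m i => by simp only [one_mul]; rw [HART.integral_oracleRule hmodel m t i, hd])
  have hE := HART.tendsto_integral_sum_mul hDm hOm hD hO hDO (W := HART.theta μ) hθm hθ
    (c := d - a) (fun m i => by
      rw [HART.integral_nonnull_mul_oracleRule hp0 hp1 hgμ0 hpos hmodel m t i, hd, ha])
  simp only [one_mul] at hB
  have hOd : TendstoInMeasure P (fun m ω => (∑ i, HART.oracleRule p gμ V X m t i ω) / m) atTop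
      fun _ => d := by
    have h := HART.tendstoInMeasure_average_law (HART.measurable_unitT hmodel)
      (HART.map_unitT hmodel) (HART.iIndepFun_unitT hmodel)
      (h := Set.indicator (Set.Iio t) fun _ => (1 : ℝ))
      (measurable_const.indicator measurableSet_Iio) (fun x => by
        have h := HART.indicator_one_mem_Icc (Set.Iio t) x
        rw [abs_of_nonneg h.1]; exact h.2)
    rw [integral_indicator_const _ measurableSet_Iio, smul_eq_mul, mul_one, ← hd] at h
    exact h
  have hBd := HART.tendsto_integral_average_sub hDm hOm hD hO hDO ⟨hd0.le, hd1⟩ hOd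
  refine ⟨?_, ?_, ?_, ?_⟩
  · rw [tendstoInMeasure_iff_measureReal_dist] at htHat ⊢
    intro ε hε
    refine (htHat ε hε).congr' ?_
    filter_upwards [eventually_gt_atTop 0] with m hm
    simp only [htStar hm, Real.dist_eq, sub_zero]
  · refine HART.exists_tendsto_zero_of_le (hA.div hB hd0.ne') had ?_
    filter_upwards [eventually_gt_atTop 0] with m hm
    have hm' : (m : ℝ) ≠ 0 := by exact_mod_cast hm.ne'
    rw [HART.mFDR, Pi.div_apply, div_div_div_cancel_right₀ hm']
  -- The bound of `FDR_le` tends to a/d, because the proportion of rejections converges to d in L¹.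
  · have hlim := ((hA.div_const d).add (hBd.div_const d)).add
      (tendsto_one_div_atTop_nhds_zero_nat.div_const d)
    rw [zero_div, add_zero, add_zero] at hlim
    refine HART.exists_tendsto_zero_of_le hlim had ?_
    filter_upwards [eventually_gt_atTop 0] with m hm
    exact HART.FDR_le hm (hθm m) (hDm m) (hθ m) (hD m) hd0
  · have hlim := hE.div_const (d - a)
    rw [div_self hda.ne'] at hlim
    refine hlim.congr' ?_
    filter_upwards [eventually_gt_atTop 0] with m hm
    rw [HART.deltaFull, htStar hm, HART.ETP_oracleRule hp0 hp1 hgμ0 hpos hmodel, ← hd, ← ha,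
      HART.ETP, div_div]
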